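/- **Model and notation.** Let $y=X\beta+e\in\mathbb R^n$ with $n\ge 1$, $p\ge 2$, deterministic design $X=(x_1,\dots,x_p)\in\mathbb R^{n\times p}$, $\|x_j\|_2^2=n$, and $e\sim N(0,\sigma^2I_n)$, $\sigma>0$. Let $0<\varepsilon\le 1$, $s>0$, $\lambda_{univ}=\sqrt{(2/n)\log p}$, $r=\sqrt{(2/n)\log(p/\varepsilon)}$, $\lambda_0=Ar$, $\sigma^*=\|e\|_2/\sqrt n$ and $S=\{j:|\beta_j|>\sigma\lambda_{univ}\}$. $\beta$ is *capped-$\ell_1$ sparse* if $\sum_{j}\min\{|\beta_j|/(\sigma\lambda_{univ}),1\}\le s$. Put $\kappa(\xi,S)=\inf\{\|Xu\|_2|S|^{1/2}/(n^{1/2}\|u_S\|_1):0\ne u,\ \|u_{S^c}\|_1\le\xi\|u_S\|_1\}$ (which is $+\infty$ if $S=\emptyset$), $\phi_-(m,S)=\min_{B\supseteq S,|B\setminus S|\le m}\phi_{\min}(X_B^TX_B/n)$ and $\phi_+(m,S)=\max_{B\cap S=\emptyset,|B|\le m}\phi_{\max}(X_B^TX_B/n)$, where $\phi_{\min},\phi_{\max}$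 are the smallest and largest eigenvalues ($\infty$ and $0$ for the empty matrix). The *scaled Lasso* $(\hat\beta^{(init)},\hat\sigma)$ is a minimizer over $b\in\mathbb R^p$, $\sigma\ge0$ of $\|y-Xb\|_2^2/(2\sigma n)+\sigma/2+\lambda_0\|b\|_1$; with $\hat S$ the support of a scaled Lasso coefficient vector, the *scaled Lasso-LSE* is a minimizer of $\|y-Xb\|_2^2/\{2\sigma(n-|\hat S|)\}+\sigma/2$ over $\sigma\ge 0$ and $b$ with $b_j=0$ for $j\notin\hat S$. (A quotient with denominator $0$, or with $n\le|\hat S|$, is $0$ if $y=Xb$ and $+\infty$ otherwise.) Consider the conditions $$(E)\quad P\{\|\hat\beta^{(init)}-\beta\|_1\ge C_1 s\,\sigma^* r\}\le\varepsilon,\qquad (N)\quad P\{|\hat\sigma/\sigma^*-1|\ge C_2 s\,r^2\}\le\varepsilon .$$ **Theorem.** Let $\xi>1$, $A>(\xi+1)/(\xi-1)$ and $c_0>0$. (i) There are constants $\mu_*,C_1,C_2>0$ depending only on $(A,\xi,c_0)$ such that, if $\beta$ is capped-$\ell_1$ sparse, $\kappa^2(\xi,S)\ge c_0$ and $(s\vee1)(2/n)\log(p/\varepsilon)\le\mu_*$,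 then the scaled Lasso satisfies $(E)$ and $(N)$. Moreover the conclusions (a)–(e) below hold for it. (ii) Let $c_1,K>0$. There are constants $\mu_*,C_1,C_2>0$ depending only on $(A,\xi,c_0,c_1,K)$ such that, if in addition to the conditions of (i) the integer $m$ with $m-1<Ks\le m$ satisfies $\xi^2/\min\{\kappa^2(\xi,S),1\}\le K/\phi_+(m,S)$ and $\phi_-(m,S)\ge c_1$, then the scaled Lasso-LSE satisfies $(E)$ and $(N)$. Moreover the conclusions (a)–(e) hold for it. (For $S\neq\emptyset$ one always has $\kappa(\xi,S)\le1$.) **The conclusions.** Let $z_1,\dots,z_p\in\mathbb R^n$ be nonrandom with $z_j^Tx_j>0$, and let $\eta_j=\max_{k\ne j}|z_j^Tx_k|/\|z_j\|_2$, $\tau_j=\|z_j\|_2/|z_j^Tx_j|$, $V_{jk}=z_j^Tz_k/(|z_j^Tx_j||z_k^Tx_k|)$ and $\hat\beta_j=\{z_j^Ty-\sum_{k\ne j}z_j^Tx_k\hat\beta^{(init)}_k\}/z_j^Tx_j$. Let $\eta^*>0$. Except in (e), assume $C_1\eta^*s\lambda_0/A\le\varepsilon'$. $\Phi,\varphi$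 are the standard normal distribution function and density, $\Phi_k$ is the Student distribution function with $k$ degrees of freedom. (a) If $\eta_j\le\eta^*$, then $P\{|\tau_j^{-1}(\hat\beta_j-\beta_j)-z_j^Te/\|z_j\|_2|>\sigma^*\varepsilon'\}\le\varepsilon$; and if $C_2s(\lambda_0/A)^2\le\varepsilon''<1$, then for all $t\ge(1+\varepsilon')/(1-\varepsilon'')$, $P\{|\hat\beta_j-\beta_j|\ge\tau_j\hat\sigma t\}\le2\Phi_{n-1}(-(1-\varepsilon'')t+\varepsilon')+2\varepsilon$. (b) For every sequence of such problems (with $X,\beta,\sigma,s,\varepsilon,p,z_j,\eta^*,\varepsilon',\varepsilon''$ varying, the constants fixed, and $C_2s(\lambda_0/A)^2\le\varepsilon''$) along which $n\to\infty$ and $\max(\varepsilon',\varepsilon'',\varepsilon)\to0$, every fixed $m$ and $\alpha\in(0,1)$, $\inf_{a\in\mathscr A}P\{|a^T\hat\beta-a^T\beta|\le\hat\sigma\Phi^{-1}(1-\alpha/2)(a^TVa)^{1/2}\}\to1-\alpha$, where $\mathscr A$ (assumed nonempty) is the set of $a$ with $\|a\|_0\le m$, $a^TVa>0$ and $\max_j|a_j|\tau_j\eta_j\le\eta^*(a^TVa)^{1/2}$.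 (c) $P\{\max_{\eta_j\le\eta^*}|\tau_j^{-1}(\hat\beta_j-\beta_j)-z_j^Te/\|z_j\|_2|>\sigma^*\varepsilon'\}\le\varepsilon$; and if $C_2s(\lambda_0/A)^2\le\varepsilon''<1$, then for all $t\ge(1+\varepsilon')/(1-\varepsilon'')$, $P\{|\hat\beta_j-\beta_j|>\tau_j\hat\sigma t\text{ for some }j\text{ with }\eta_j\le\eta^*\}\le2\Phi_{n-1}(-(1-\varepsilon'')t+\varepsilon')\,\#\{j:\eta_j\le\eta^*\}+2\varepsilon$. (d) For every sequence of such problems as in (b) along which $\max_j\eta_j\le\eta^*$, $\min(n,p)\to\infty$ and $\max(\varepsilon',\varepsilon,\varepsilon''\sqrt{\log p})\to0$, and all fixed $\alpha\in(0,1)$, $c>0$: $\liminf P\{|\hat\beta_j-\beta_j|\le\tau_j(\hat\sigma\wedge\sigma)(c+\sqrt{2\log(p/\alpha)})\ \forall j\le p\}\ge1-\alpha$. (e) Let $0<\alpha<p$, $c>0$, $L_0=\Phi^{-1}(1-\alpha/(2p))$, $\tilde t_j=\tau_j\sigma L_0$, $\hat t_j=(1+c)\hat\sigma\tau_jL_0$,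 $\hat\beta^{(thr)}_j=\mathrm{sgn}(\hat\beta_j)(|\hat\beta_j|-\hat t_j)_+$ and $\hat S^{(thr)}=\{j:|\hat\beta_j|>\hat t_j\}$. Suppose $\max_j\eta_j\le\eta^*$, $C_1\eta^*s\lambda_0/A\le\varepsilon'L_0$, and, outside an event of probability at most $2\varepsilon$, $\hat\sigma>0$ and $(\hat\sigma/\sigma)\vee(\sigma/\hat\sigma)-1+\varepsilon'\sigma^*/(\hat\sigma\wedge\sigma)\le c\{1-(\hat\sigma/\sigma-1)_+\}$. If $\varphi(L_0)\le\varepsilon/p$, there is an event $\Omega_n$ with $P(\Omega_n^c)\le3\varepsilon$ and $$E\|\hat\beta^{(thr)}-\beta\|_2^2I_{\Omega_n}\le\sum_{j}\min\{\beta_j^2,\tau_j^2\sigma^2(L_0^2(1+2c)^2+1)\}+\frac{\varepsilon L_n}{p}\sigma^2\sum_j\tau_j^2,\quad L_n=\frac4{L_0^3}+\frac{4c}{L_0}+12c^2L_0 .$$ Moreover, with probability at least $1-\alpha-3\varepsilon$, $\{j:|\beta_j|>(2+2c)\tilde t_j\}\subseteq\hat S^{(thr)}\subseteq\{j:\beta_j\ne0\}$.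 The displayed condition on $\hat\sigma$ is a consequence of $(N)$ when $\varepsilon'\ge0$, $C_2s(\lambda_0/A)^2\le\varepsilon''<1$, $\varepsilon'''\in(0,1)$, $P\{(1-\varepsilon''')/(1-\varepsilon'')\le\sigma^*/\sigma\le(1+\varepsilon''')/(1+\varepsilon'')\}\ge1-\varepsilon$ and $c\ge(\varepsilon'''+\varepsilon')/(1-\varepsilon''')^2$. -/

import Mathlib

open MeasureTheory ProbabilityTheory Filter Topology
open scoped ENNReal Matrix

noncomputable section

namespace LDPE

/-! ### Norms, distribution functions -/

/-- The `ℓ₁` norm of a finite real vector. -/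
def l1norm {ι : Type} [Fintype ι] (v : ι → ℝ) : ℝ := ∑ i, |v i|

/-- The Euclidean norm of a finite real vector. -/
def l2norm {ι : Type} [Fintype ι] (v : ι → ℝ) : ℝ := Real.sqrt (∑ i, v i ^ 2)

/-- The support `{j : v j ≠ 0}`. -/
def supp {p : ℕ} (v : Fin p → ℝ) : Finset (Fin p) := Finset.univ.filter fun j => v j ≠ 0

/-- The quantile function `Φ⁻¹` of the standard normal distribution. -/
def normalQuantile (u : ℝ) : ℝ := sInf {x : ℝ | u ≤ cdf (gaussianReal 0 1) x}

/-- The standard normal density `φ`. -/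
def normalDensity (x : ℝ) : ℝ := gaussianPDFReal 0 1 x

/-- The distribution function at `t` of Student's distribution with `k` degrees of freedom,
that is of `g₀ / √((g₁² + ⋯ + g_k²) / k)` with independent standard normal `g₀, …, g_k`. -/
def studentCDF (k : ℕ) (t : ℝ) : ℝ :=
  (Measure.pi fun _ : Fin (k + 1) => gaussianReal 0 1).real
    {g | g 0 / Real.sqrt ((∑ i : Fin k, g i.succ ^ 2) / k) ≤ t}

/-! ### Compatibility factor and sparse eigenvalues -/

/-- The cone `{u : ‖u_{Sᶜ}‖₁ ≤ ξ ‖u_S‖₁}`. -/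
def cone {p : ℕ} (ξ : ℝ) (S : Finset (Fin p)) : Set (Fin p → ℝ) :=
  {u | ∑ j ∈ Sᶜ, |u j| ≤ ξ * ∑ j ∈ S, |u j|}

/-- The compatibility factor; it is an infimum in `[0, ∞]`, so it is `∞` when `S` is empty
(the cone is then `{0}`). -/
def compat {n p : ℕ} (X : Matrix (Fin n) (Fin p) ℝ) (ξ : ℝ) (S : Finset (Fin p)) : ℝ≥0∞ :=
  ⨅ u : Fin p → ℝ, ⨅ _ : u ≠ 0 ∧ u ∈ cone ξ S,
    ENNReal.ofReal
      (l2norm (X *ᵥ u) * Real.sqrt (S.card : ℝ) / (Real.sqrt (n : ℝ) * ∑ j ∈ S, |u j|))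

/-- The matrix `X_Bᵀ X_B / n`. -/
def gram {n p : ℕ} (X : Matrix (Fin n) (Fin p) ℝ) (B : Finset (Fin p)) : Matrix B B ℝ :=
  (1 / (n : ℝ)) • ((X.submatrix id (fun j : B => (j : Fin p)))ᵀ *
    X.submatrix id (fun j : B => (j : Fin p)))

/-- Smallest eigenvalue of a positive semidefinite matrix (`∞` for the empty matrix). -/
def eigMin {ι : Type} [Fintype ι] [DecidableEq ι] (G : Matrix ι ι ℝ) : ℝ≥0∞ :=
  ⨅ r ∈ spectrum ℝ G, ENNReal.ofReal r

/-- Largest eigenvalue of a positive semidefinite matrix (`0` for the empty matrix). -/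
def eigMax {ι : Type} [Fintype ι] [DecidableEq ι] (G : Matrix ι ι ℝ) : ℝ≥0∞ :=
  ⨆ r ∈ spectrum ℝ G, ENNReal.ofReal r

/-- Lower sparse eigenvalue `φ₋(m, S)`. -/
def sparseEigMin {n p : ℕ} (X : Matrix (Fin n) (Fin p) ℝ) (m : ℕ) (S : Finset (Fin p)) : ℝ≥0∞ :=
  ⨅ B : Finset (Fin p), ⨅ _ : S ⊆ B ∧ (B \ S).card ≤ m, eigMin (gram X B)

/-- Upper sparse eigenvalue `φ₊(m, S)`. -/
def sparseEigMax {n p : ℕ} (X : Matrix (Fin n) (Fin p) ℝ) (m : ℕ) (S : Finset (Fin p)) : ℝ≥0∞ :=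
  ⨆ B : Finset (Fin p), ⨆ _ : Disjoint B S ∧ B.card ≤ m, eigMax (gram X B)

/-! ### The scaled Lasso and the scaled Lasso-LSE -/

/-- The joint loss `‖y - X b‖₂² / (2 σ N) + σ / 2 + lam ‖b‖₁` for `σ ≥ 0`, with values in `[0, ∞]`.
At `σ = 0` (and when `N ≤ 0`) the quotient is `0` if `y = X b` and `∞` otherwise; at `σ = 0` this
is the limit as `σ ↓ 0`. -/
def jointLoss {n p : ℕ} (X : Matrix (Fin n) (Fin p) ℝ) (y : Fin n → ℝ) (N lam : ℝ)
    (b : Fin p → ℝ) (σ : ℝ) : ℝ≥0∞ :=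
  ENNReal.ofReal (l2norm (y - X *ᵥ b) ^ 2) / ENNReal.ofReal (2 * σ * N) +
    ENNReal.ofReal (σ / 2 + lam * l1norm b)

/-- `(b, σ)` is a solution of the scaled Lasso with penalty level `lam`. -/
def IsScaledLasso {n p : ℕ} (X : Matrix (Fin n) (Fin p) ℝ) (y : Fin n → ℝ) (lam : ℝ)
    (b : Fin p → ℝ) (σ : ℝ) : Prop :=
  0 ≤ σ ∧ ∀ (b' : Fin p → ℝ) (σ' : ℝ), 0 ≤ σ' →
    jointLoss X y n lam b σ ≤ jointLoss X y n lam b' σ'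

/-- `(b, σ)` is the least squares solution, with degrees of freedom adjustment, in the model `T`. -/
def IsModelLSE {n p : ℕ} (X : Matrix (Fin n) (Fin p) ℝ) (y : Fin n → ℝ) (T : Finset (Fin p))
    (b : Fin p → ℝ) (σ : ℝ) : Prop :=
  (0 ≤ σ ∧ ∀ j, j ∉ T → b j = 0) ∧
    ∀ (b' : Fin p → ℝ) (σ' : ℝ), 0 ≤ σ' → (∀ j, j ∉ T → b' j = 0) →
      jointLoss X y ((n : ℝ) - T.card) 0 b σ ≤ jointLoss X y ((n : ℝ) - T.card) 0 b' σ'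

/-! ### The linear model together with initial estimators -/

/-- A linear model `y = X β + e`, `e ∼ N(0, σ² I)`, a sparsity index `s`, a level `ε`, and an initial
estimator of `β` and an estimator of the noise level, both functions of the response `y`. -/
structure Setup where
  n : ℕ
  p : ℕ
  X : Matrix (Fin n) (Fin p) ℝ
  β : Fin p → ℝ
  σ : ℝ
  s : ℝ
  ε : ℝ
  coef : (Fin n → ℝ) → Fin p → ℝ
  noise : (Fin n → ℝ) → ℝ

namespace Setup

variable (D : Setup)

/-- The law `N(0, σ² I)` of the noise vector. -/
def P : Measure (Fin D.n → ℝ) := Measure.pi fun _ => gaussianReal 0 (Real.toNNReal (D.σ ^ 2))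

/-- The response as a function of the noise vector. -/
def y (e : Fin D.n → ℝ) : Fin D.n → ℝ := D.X *ᵥ D.β + e

/-- The initial estimator of `β`, as a function of the noise vector. -/
def bInit (e : Fin D.n → ℝ) : Fin D.p → ℝ := D.coef (D.y e)

/-- The estimator of the noise level, as a function of the noise vector. -/
def sigHat (e : Fin D.n → ℝ) : ℝ := D.noise (D.y e)

/-- The oracle noise level `σ* = ‖e‖₂ / √n`. -/
def sigStar (e : Fin D.n → ℝ) : ℝ := l2norm e / Real.sqrt D.n

/-- `λ_univ = √((2/n) log p)`. -/
def lamUniv : ℝ := Real.sqrt (2 / (D.n : ℝ) * Real.log D.p)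

/-- `√((2/n) log (p/ε))`. -/
def rate : ℝ := Real.sqrt (2 / (D.n : ℝ) * Real.log (D.p / D.ε))

/-- The set `{j : |β_j| > σ λ_univ}` of large coefficients. -/
def S : Finset (Fin D.p) := Finset.univ.filter fun j => D.σ * D.lamUniv < |D.β j|

/-- The standing assumptions: nondegenerate sizes, standardized design, measurable estimators. -/
structure Standing : Prop where
  one_le_n : 1 ≤ D.n
  two_le_p : 2 ≤ D.p
  sigma_pos : 0 < D.σ
  s_pos : 0 < D.s
  eps_pos : 0 < D.ε
  eps_le_one : D.ε ≤ 1
  standardized : ∀ j, ∑ i, D.X i j ^ 2 = (D.n : ℝ)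
  coef_measurable : Measurable D.coef
  noise_measurable : Measurable D.noise

/-- The capped-`ℓ₁` sparsity condition. -/
def CappedSparse : Prop := ∑ j, min (|D.β j| / (D.σ * D.lamUniv)) 1 ≤ D.s

/-- The estimators are the scaled Lasso at penalty level `lam`. -/
def ByScaledLasso (lam : ℝ) : Prop := ∀ y, IsScaledLasso D.X y lam (D.coef y) (D.noise y)

/-- The estimators are the scaled Lasso-LSE: least squares in the model selected by the
scaled Lasso at penalty level `lam`. -/
def ByScaledLassoLSE (lam : ℝ) : Prop :=
  ∃ (b₀ : (Fin D.n → ℝ) → Fin D.p → ℝ) (σ₀ : (Fin D.n → ℝ) → ℝ), Measurable b₀ ∧ Measurable σ₀ ∧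
    ∀ y, IsScaledLasso D.X y lam (b₀ y) (σ₀ y) ∧
      IsModelLSE D.X y (supp (b₀ y)) (D.coef y) (D.noise y)

/-- The `ℓ₁` error condition with constant `C₁`. -/
def L1ErrorCond (C₁ : ℝ) : Prop :=
  D.P.real {e | C₁ * D.s * D.sigStar e * D.rate ≤ l1norm (D.bInit e - D.β)} ≤ D.ε

/-- The noise level condition with constant `C₂`. -/
def NoiseCond (C₂ : ℝ) : Prop :=
  D.P.real {e | C₂ * D.s * D.rate ^ 2 ≤ |D.sigHat e / D.sigStar e - 1|} ≤ D.ε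

/-- The assumptions common to both estimators. -/
def Common (ξ c₀ μ : ℝ) : Prop :=
  D.Standing ∧ D.CappedSparse ∧ ENNReal.ofReal c₀ ≤ compat D.X ξ D.S ^ 2 ∧
    max D.s 1 * (2 / (D.n : ℝ)) * Real.log (D.p / D.ε) ≤ μ

/-- The sparse eigenvalue assumptions, with `m` the smallest integer upper bound of `K s`.
The compatibility factor of a nonempty `S` never exceeds `1`, so that the truncation at `1` only
means that an empty `S` is given the factor `1`. -/
def SparseEig (ξ c₁ K : ℝ) : Prop :=
  ∃ m : ℕ, (m : ℝ) - 1 < K * D.s ∧ K * D.s ≤ m ∧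
    ENNReal.ofReal (ξ ^ 2) / min (compat D.X ξ D.S ^ 2) 1 ≤
      ENNReal.ofReal K / sparseEigMax D.X m D.S ∧
    ENNReal.ofReal c₁ ≤ sparseEigMin D.X m D.S

/-! ### The low-dimensional projection estimator with score vectors `z` -/

variable (z : Fin D.p → Fin D.n → ℝ)

/-- The `j`-th column of the design. -/
def x (j : Fin D.p) : Fin D.n → ℝ := fun i => D.X i j

/-- The bias factor `η_j`. -/
def eta (j : Fin D.p) : ℝ := ⨆ k : {k : Fin D.p // k ≠ j}, |z j ⬝ᵥ D.x k| / l2norm (z j)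

/-- The noise factor `τ_j`. -/
def tau (j : Fin D.p) : ℝ := l2norm (z j) / |z j ⬝ᵥ D.x j|

/-- The score vectors have positive inner product with their design vectors. -/
def IsScore : Prop := ∀ j, 0 < z j ⬝ᵥ D.x j

/-- The low-dimensional projection estimator of `β_j`. -/
def est (e : Fin D.n → ℝ) (j : Fin D.p) : ℝ :=
  (z j ⬝ᵥ D.y e) / (z j ⬝ᵥ D.x j) -
    ∑ k ∈ Finset.univ.erase j, (z j ⬝ᵥ D.x k) * D.bInit e k / (z j ⬝ᵥ D.x j)

/-- The covariance factor `V`. -/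
def V : Matrix (Fin D.p) (Fin D.p) ℝ :=
  fun j k => (z j ⬝ᵥ z k) / (|z j ⬝ᵥ D.x j| * |z k ⬝ᵥ D.x k|)

/-- Contrasts with at most `m` nonzero entries, nondegenerate, and with small relative bias. -/
def contrasts (m : ℕ) (ηs : ℝ) : Set (Fin D.p → ℝ) :=
  {a | (supp a).card ≤ m ∧ 0 < a ⬝ᵥ (D.V z *ᵥ a) ∧
    ∀ j, |a j| * D.tau z j * D.eta z j ≤ ηs * Real.sqrt (a ⬝ᵥ (D.V z *ᵥ a))}

/-- The coverage probability of the level `1 - α` confidence interval for `aᵀβ`. -/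
def coverage (α : ℝ) (a : Fin D.p → ℝ) : ℝ :=
  D.P.real {e | |a ⬝ᵥ D.est z e - a ⬝ᵥ D.β| ≤
    D.sigHat e * normalQuantile (1 - α / 2) * Real.sqrt (a ⬝ᵥ (D.V z *ᵥ a))}

/-- The event that the estimate of `β_j` is not within `σ* ε'` of its Gaussian approximation,
in units of `τ_j`. -/
def farFromGaussian (e' : ℝ) (j : Fin D.p) : Set (Fin D.n → ℝ) :=
  {e | D.sigStar e * e' <
    |(D.tau z j)⁻¹ * (D.est z e j - D.β j) - (z j ⬝ᵥ e) / l2norm (z j)|}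

/-! ### Thresholding -/

/-- `L₀ = Φ⁻¹(1 - α/(2p))`. -/
def L0 (α : ℝ) : ℝ := normalQuantile (1 - α / (2 * D.p))

/-- The threshold level `(1 + c) σ̂ τ_j L₀`. -/
def thresh (α c : ℝ) (e : Fin D.n → ℝ) (j : Fin D.p) : ℝ :=
  (1 + c) * D.sigHat e * D.tau z j * D.L0 α

/-- The soft thresholded estimator. -/
def softEst (α c : ℝ) (e : Fin D.n → ℝ) (j : Fin D.p) : ℝ :=
  Real.sign (D.est z e j) * max (|D.est z e j| - D.thresh z α c e j) 0

/-- The model selected by thresholding. -/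
def selected (α c : ℝ) (e : Fin D.n → ℝ) : Set (Fin D.p) :=
  {j | D.thresh z α c e j < |D.est z e j|}

/-- The condition that, with probability at least `1 - 2ε`,
`{(σ̂/σ) ∨ (σ/σ̂) - 1 + ε' σ*/(σ̂ ∧ σ)} / {1 - (σ̂/σ - 1)₊} ≤ c`,
where the denominator is cleared because it need not be positive. -/
def NoiseCalibrated (e' c : ℝ) : Prop :=
  D.P.real {e | ¬ (0 < D.sigHat e ∧
    max (D.sigHat e / D.σ) (D.σ / D.sigHat e) - 1 + e' * D.sigStar e / min (D.sigHat e) D.σ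
      ≤ c * (1 - max (D.sigHat e / D.σ - 1) 0))} ≤ 2 * D.ε

end Setup

/-! ### The inferential conclusions for a class of setups -/

/-- Conclusions for a preconceived parameter, fixed sample size. -/
def SingleConclusion (C₁ C₂ : ℝ) (R : Setup → Prop) : Prop :=
  ∀ D : Setup, R D → ∀ z : Fin D.p → Fin D.n → ℝ, D.IsScore z →
    ∀ ηs e' : ℝ, 0 < ηs → C₁ * ηs * (D.s * D.rate) ≤ e' →
    ∀ j : Fin D.p, D.eta z j ≤ ηs →
      D.P.real (D.farFromGaussian z e' j) ≤ D.ε ∧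
      ∀ e'' : ℝ, e'' < 1 → C₂ * D.s * D.rate ^ 2 ≤ e'' → ∀ t : ℝ, (1 + e') / (1 - e'') ≤ t →
        D.P.real {e | D.tau z j * D.sigHat e * t ≤ |D.est z e j - D.β j|} ≤
          2 * studentCDF (D.n - 1) (-((1 - e'') * t) + e') + 2 * D.ε

/-- Asymptotic coverage of the confidence intervals for sparse linear combinations. -/
def CoverageConclusion (C₁ C₂ : ℝ) (R : Setup → Prop) : Prop :=
  ∀ (D : ℕ → Setup) (z : ∀ k, Fin (D k).p → Fin (D k).n → ℝ) (ηs e' e'' : ℕ → ℝ) (m : ℕ) (α : ℝ),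
    (∀ k, R (D k)) → (∀ k, (D k).IsScore (z k)) → (∀ k, 0 < ηs k) →
    (∀ k, C₁ * ηs k * ((D k).s * (D k).rate) ≤ e' k) →
    (∀ k, C₂ * (D k).s * (D k).rate ^ 2 ≤ e'' k) →
    Tendsto (fun k => (D k).n) atTop atTop →
    Tendsto e' atTop (𝓝 0) → Tendsto e'' atTop (𝓝 0) → Tendsto (fun k => (D k).ε) atTop (𝓝 0) →
    0 < α → α < 1 → (∀ k, ((D k).contrasts (z k) m (ηs k)).Nonempty) →
    Tendsto (fun k => ⨅ a : (D k).contrasts (z k) m (ηs k), (D k).coverage (z k) α a) atTop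
      (𝓝 (1 - α))

/-- Simultaneous conclusions, fixed sample size. -/
def SimultaneousConclusion (C₁ C₂ : ℝ) (R : Setup → Prop) : Prop :=
  ∀ D : Setup, R D → ∀ z : Fin D.p → Fin D.n → ℝ, D.IsScore z →
    ∀ ηs e' : ℝ, 0 < ηs → C₁ * ηs * (D.s * D.rate) ≤ e' →
      D.P.real {e | ∃ j, D.eta z j ≤ ηs ∧ e ∈ D.farFromGaussian z e' j} ≤ D.ε ∧
      ∀ e'' : ℝ, e'' < 1 → C₂ * D.s * D.rate ^ 2 ≤ e'' → ∀ t : ℝ, (1 + e') / (1 - e'') ≤ t →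
        D.P.real {e | ∃ j, D.eta z j ≤ ηs ∧ D.tau z j * D.sigHat e * t < |D.est z e j - D.β j|} ≤
          2 * studentCDF (D.n - 1) (-((1 - e'') * t) + e') *
            Set.ncard {j | D.eta z j ≤ ηs} + 2 * D.ε

/-- Asymptotic familywise coverage of the simultaneous confidence intervals. -/
def FamilywiseConclusion (C₁ C₂ : ℝ) (R : Setup → Prop) : Prop :=
  ∀ (D : ℕ → Setup) (z : ∀ k, Fin (D k).p → Fin (D k).n → ℝ) (ηs e' e'' : ℕ → ℝ) (α c : ℝ),
    (∀ k, R (D k)) → (∀ k, (D k).IsScore (z k)) → (∀ k, 0 < ηs k) →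
    (∀ k, C₁ * ηs k * ((D k).s * (D k).rate) ≤ e' k) →
    (∀ k, C₂ * (D k).s * (D k).rate ^ 2 ≤ e'' k) →
    (∀ k j, (D k).eta (z k) j ≤ ηs k) →
    Tendsto (fun k => (D k).n) atTop atTop → Tendsto (fun k => (D k).p) atTop atTop →
    Tendsto e' atTop (𝓝 0) → Tendsto (fun k => (D k).ε) atTop (𝓝 0) →
    Tendsto (fun k => e'' k * Real.sqrt (Real.log (D k).p)) atTop (𝓝 0) →
    0 < α → α < 1 → 0 < c →
    1 - α ≤ liminf (fun k => (D k).P.real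
      {e | ∀ j, |(D k).est (z k) e j - (D k).β j| ≤
        (D k).tau (z k) j * min ((D k).sigHat e) (D k).σ *
          (c + Real.sqrt (2 * Real.log ((D k).p / α)))}) atTop

/-- Estimation and selection by thresholding. The first part says when the calibration condition
follows from the noise level condition. -/
def ThresholdConclusion (C₁ C₂ : ℝ) (R : Setup → Prop) : Prop :=
  (∀ D : Setup, R D → ∀ e' e'' e''' c : ℝ, 0 ≤ e' → e'' < 1 → 0 < e''' → e''' < 1 →
    C₂ * D.s * D.rate ^ 2 ≤ e'' →
    D.P.real {e | D.sigStar e / D.σ ∉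
      Set.Icc ((1 - e''') / (1 - e'')) ((1 + e''') / (1 + e''))} ≤ D.ε →
    (e''' + e') / (1 - e''') ^ 2 ≤ c → D.NoiseCalibrated e' c) ∧
  ∀ D : Setup, R D → ∀ z : Fin D.p → Fin D.n → ℝ, D.IsScore z →
    ∀ ηs e' α c : ℝ, 0 < ηs → 0 < α → α < D.p → 0 < c → (∀ j, D.eta z j ≤ ηs) →
      C₁ * ηs * (D.s * D.rate) ≤ e' * D.L0 α → D.NoiseCalibrated e' c →
      (normalDensity (D.L0 α) ≤ D.ε / D.p →
        ∃ Ωn : Set (Fin D.n → ℝ), MeasurableSet Ωn ∧ D.P.real Ωnᶜ ≤ 3 * D.ε ∧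
          ∫⁻ e in Ωn, ENNReal.ofReal (∑ j, (D.softEst z α c e j - D.β j) ^ 2) ∂D.P ≤
            ENNReal.ofReal
              (∑ j, min (D.β j ^ 2)
                  (D.tau z j ^ 2 * D.σ ^ 2 * (D.L0 α ^ 2 * (1 + 2 * c) ^ 2 + 1)) +
                D.ε * (4 / D.L0 α ^ 3 + 4 * c / D.L0 α + 12 * c ^ 2 * D.L0 α) / D.p *
                  D.σ ^ 2 * ∑ j, D.tau z j ^ 2)) ∧
      1 - α - 3 * D.ε ≤ D.P.real
        {e | {j | (2 + 2 * c) * (D.tau z j * D.σ * D.L0 α) < |D.β j|} ⊆ D.selected z α c e ∧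
          D.selected z α c e ⊆ {j | D.β j ≠ 0}}

/-- All the inferential conclusions together. -/
def AllConclusions (C₁ C₂ : ℝ) (R : Setup → Prop) : Prop :=
  SingleConclusion C₁ C₂ R ∧ CoverageConclusion C₁ C₂ R ∧ SimultaneousConclusion C₁ C₂ R ∧
    FamilywiseConclusion C₁ C₂ R ∧ ThresholdConclusion C₁ C₂ R

end LDPE

end

/-! ## The idea of the proof

Everything rests on two comparisons with the oracle noise level `σ* = ‖e‖₂ / √n`: the initial
estimator is within `C₁ s σ* r` of `β` in the `ℓ₁` norm, and `σ̂ / σ*` is within `C₂ s r²` of `1`,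
each outside an event of probability `ε`, where `r = √((2/n) log (p/ε))`.

*The error conditions.* For fixed `b` the joint loss is minimal at `σ = ‖y - X b‖₂ / √n`, so that
the scaled Lasso minimizes `‖y - X b‖₂ / √n + λ₀ ‖b‖₁` (`IsScaledLasso.profile`); where `σ̂ > 0` it
satisfies the optimality conditions of the Lasso with penalty level `σ̂ λ₀`
(`IsScaledLasso.variational`). On the event that no variable has correlation larger than
`(1 + δ) σ* r` with the noise and that `σ ≤ (1 + δ) σ*` (`Setup.goodNoise`), the penalty dominates
the noise since `A > (ξ + 1) / (ξ - 1)`. Comparing the values at `β̂` and `β` shows that the error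
either lies in the cone, where the compatibility factor bounds it, or is dominated by the small
coefficients, which capped sparsity bounds (`Setup.scaledLasso_l1_le`). The noise level then follows
from `|σ̂ - σ*| ≤ λ₀ ‖β̂ - β‖₁`. The direction of `e` is uniform on the sphere and independent of
`‖e‖₂`, hence each correlation has self-normalized tail `exp(-(n - 1) w² / (2 n))`
(`Setup.noise_sphere_tail`); because of the slack `δ`, the union bound over `p` variables leaves
room for the exponentially small probability of a low noise level
(`Setup.exists_goodNoise_compl_le`).

For the scaled Lasso-LSE, a falsely selected variable has correlation at least `(1 - θ) λ n` with
the prediction error, whose size is bounded, so that the upper sparse eigenvalue limits the number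
of such variables to `K s` (`Setup.card_falsely_selected_le`). The lower sparse eigenvalue on the
selected model then bounds the difference between least squares and the scaled Lasso
(`Setup.lse_sub_lasso_le`).

*The inferential conclusions.* These follow from the two error conditions, `n ≥ 2` and `r ≤ 1` alone
(`Setup.Controlled`, `allConclusions_of_controlled`). The projection estimator is `β_j` plus the
Gaussian term `z_jᵀe / z_jᵀx_j` plus a bias of at most `τ_j η_j ‖β̂ - β‖₁` (`Setup.est_bias_le`).
After division by `σ*` the Gaussian term has an explicit law, whose tail beyond `1` is at most a
Student tail (`Setup.noise_student`). In the asymptotic statements `σ*` is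
replaced by `σ` at the cost of chi-square deviations (`chiBase`), and the simultaneous intervals use
that `log p` is of order at most `n`. The risk of thresholding is bounded coordinate by coordinate
with an envelope of the squared error over all admissible thresholds (`exists_soft_envelope`), whose
Gaussian expectation is explicit; this avoids any independence between the threshold and the
Gaussian term.
-/

noncomputable section

namespace LDPE

/-! ### The standard normal distribution -/

lemma gaussianPDFReal_std (x : ℝ) :
    gaussianPDFReal 0 1 x = (Real.sqrt (2 * Real.pi))⁻¹ * Real.exp (-x ^ 2 / 2) := by
  simp [gaussianPDFReal]

lemma gaussianPDFReal_add (u L : ℝ) :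
    gaussianPDFReal 0 1 (u + L) =
      gaussianPDFReal 0 1 L * Real.exp (-(L * u)) * Real.exp (-u ^ 2 / 2) := by
  rw [gaussianPDFReal_std, gaussianPDFReal_std, mul_assoc, mul_assoc, ← Real.exp_add,
    ← Real.exp_add]
  congr 2; ring

lemma lintegral_gaussian_shift {f : ℝ → ℝ≥0∞} (hf : Measurable f) (L : ℝ) :
    ∫⁻ g, f g ∂(gaussianReal 0 1) = ∫⁻ u, f (u + L) * gaussianPDF 0 1 (u + L) := by
  rw [gaussianReal_of_var_ne_zero 0 one_ne_zero,
    lintegral_withDensity_eq_lintegral_mul _ (measurable_gaussianPDF 0 1) hf,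
    ← lintegral_add_right_eq_self _ L]
  simp [mul_comm]

instance : NullSingletonClass (gaussianReal 0 1) := nullSingletonClass_gaussianReal one_ne_zero

lemma measurePreserving_neg_gaussian :
    MeasurePreserving (fun x : ℝ => -x) (gaussianReal 0 1) (gaussianReal 0 1) :=
  ⟨measurable_neg, by simpa using gaussianReal_map_neg (μ := 0) (v := 1)⟩

lemma gaussian_Iic_neg (x : ℝ) :
    gaussianReal 0 1 (Set.Iic (-x)) = gaussianReal 0 1 (Set.Ici x) := by
  rw [← measurePreserving_neg_gaussian.measure_preimage measurableSet_Iic.nullMeasurableSet]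
  congr 1; ext y; simp

lemma gaussian_Ici_zero : (2 : ℝ≥0∞) * gaussianReal 0 1 (Set.Ici 0) = 1 := by
  have h := prob_add_prob_compl (μ := gaussianReal 0 1) (s := Set.Ici (0 : ℝ)) measurableSet_Ici
  rw [Set.compl_Ici, measure_congr (Iio_ae_eq_Iic (a := (0 : ℝ)))] at h
  have h2 := gaussian_Iic_neg 0
  rw [neg_zero] at h2
  rw [two_mul, ← h, h2]

lemma gaussian_Ici_le {x : ℝ} (hx : 0 ≤ x) :
    gaussianReal 0 1 (Set.Ici x) ≤
      ENNReal.ofReal (Real.exp (-x ^ 2 / 2)) * gaussianReal 0 1 (Set.Ici 0) := by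
  have h1 := lintegral_gaussian_shift (f := (Set.Ici x).indicator 1)
    (measurable_one.indicator measurableSet_Ici) x
  have h2 := lintegral_gaussian_shift (f := (Set.Ici (0:ℝ)).indicator 1)
    (measurable_one.indicator measurableSet_Ici) 0
  rw [lintegral_indicator_one measurableSet_Ici] at h1 h2
  rw [h1, h2, ← lintegral_const_mul _ (by
    refine ((measurable_one.indicator measurableSet_Ici).comp (by fun_prop)).mul
      ((measurable_gaussianPDF 0 1).comp (by fun_prop)))]
  refine lintegral_mono fun u => ?_
  by_cases hu : 0 ≤ u
  · have e1 : u + x ∈ Set.Ici x := by simp [hu]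
    have e2 : u + 0 ∈ Set.Ici (0:ℝ) := by simp [hu]
    rw [Set.indicator_of_mem e1, Set.indicator_of_mem e2]
    simp only [Pi.one_apply, one_mul, gaussianPDF]
    rw [← ENNReal.ofReal_mul (Real.exp_pos _).le]
    apply ENNReal.ofReal_le_ofReal
    rw [gaussianPDFReal_std, gaussianPDFReal_std, mul_left_comm, ← Real.exp_add]
    gcongr
    nlinarith [mul_nonneg hu hx]
  · have e1 : u + x ∉ Set.Ici x := by simp; linarith
    rw [Set.indicator_of_notMem e1]; simp

/-- The sharp two-sided Gaussian tail bound, with constant one: `φ (x + u) ≤ e^{-x²/2} φ u`. -/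
lemma gaussian_abs_tail {x : ℝ} (hx : 0 ≤ x) :
    gaussianReal 0 1 {g | x ≤ |g|} ≤ ENNReal.ofReal (Real.exp (-x ^ 2 / 2)) := by
  have : {g : ℝ | x ≤ |g|} ⊆ Set.Ici x ∪ Set.Iic (-x) := by
    intro g hg
    rcases le_abs.1 (show x ≤ |g| from hg) with h | h
    · exact Or.inl h
    · exact Or.inr (by simp; linarith)
  refine (measure_mono this).trans ((measure_union_le _ _).trans ?_)
  rw [gaussian_Iic_neg, ← two_mul]
  calc _ ≤ 2 * (ENNReal.ofReal (Real.exp (-x ^ 2 / 2)) * gaussianReal 0 1 (Set.Ici 0)) := by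
        gcongr; exact gaussian_Ici_le hx
    _ = _ := by rw [mul_left_comm, gaussian_Ici_zero, mul_one]

lemma continuous_cdf_gaussian : Continuous (cdf (gaussianReal 0 1)) := by
  refine continuous_iff_continuousAt.2 fun x => ?_
  rw [(monotone_cdf _).continuousAt_iff_leftLim_eq_rightLim]
  have h := (cdf (gaussianReal 0 1)).measure_singleton x
  rw [measure_cdf, measure_singleton, eq_comm, ENNReal.ofReal_eq_zero] at h
  rw [StieltjesFunction.rightLim_eq]
  exact le_antisymm ((monotone_cdf _).leftLim_le le_rfl) (by linarith)

lemma cdf_normalQuantile {u : ℝ} (h0 : 0 < u) (h1 : u < 1) :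
    cdf (gaussianReal 0 1) (normalQuantile u) = u := by
  set F := cdf (gaussianReal 0 1)
  have hc := continuous_cdf_gaussian
  obtain ⟨a, ha⟩ := ((tendsto_cdf_atBot (gaussianReal 0 1)).eventually_lt_const h0).exists
  obtain ⟨b, hb⟩ := ((tendsto_cdf_atTop (gaussianReal 0 1)).eventually_const_lt h1).exists
  have hcl : IsClosed {x : ℝ | u ≤ F x} := isClosed_le continuous_const hc
  have hne : {x : ℝ | u ≤ F x}.Nonempty := ⟨b, hb.le⟩
  have hbd : BddBelow {x : ℝ | u ≤ F x} := ⟨a, fun x hx => by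
    by_contra hxa
    exact absurd (hx.trans ((monotone_cdf _) (not_le.1 hxa).le)) (not_le.2 ha)⟩
  refine le_antisymm ?_ (hcl.csInf_mem hne hbd)
  by_contra hlt
  push Not at hlt
  have := hc.continuousAt.eventually_const_lt hlt
  obtain ⟨l, hl, hl2⟩ := (this.filter_mono nhdsWithin_le_nhds).and
    (self_mem_nhdsWithin : Set.Iio (normalQuantile u) ∈ 𝓝[<] (normalQuantile u)) |>.exists
  exact absurd (csInf_le hbd (show l ∈ {x : ℝ | u ≤ F x} from hl.le)) (not_le.2 hl2)

lemma cdf_gaussian_neg (x : ℝ) :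
    cdf (gaussianReal 0 1) (-x) = 1 - cdf (gaussianReal 0 1) x := by
  rw [cdf_eq_real, cdf_eq_real, measureReal_def, gaussian_Iic_neg, ← measureReal_def,
    ← probReal_compl_eq_one_sub measurableSet_Iic, Set.compl_Iic]
  exact (measureReal_congr (Ioi_ae_eq_Ici (a := x))).symm

lemma cdf_gaussian_zero : cdf (gaussianReal 0 1) 0 = 1 / 2 := by
  have := cdf_gaussian_neg 0
  rw [neg_zero] at this; linarith

lemma normalQuantile_pos {u : ℝ} (h0 : 1 / 2 < u) (h1 : u < 1) : 0 < normalQuantile u := by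
  by_contra h
  have := monotone_cdf (gaussianReal 0 1) (not_lt.1 h)
  rw [cdf_normalQuantile (by linarith) h1, cdf_gaussian_zero] at this
  linarith

lemma gaussian_real_abs_gt {x : ℝ} (hx : 0 ≤ x) :
    (gaussianReal 0 1).real {g | x < |g|} = 2 * (1 - cdf (gaussianReal 0 1) x) := by
  have e : {g : ℝ | x < |g|} = Set.Iio (-x) ∪ Set.Ioi x := by
    ext g; simp only [Set.mem_ofPred_eq, Set.mem_union, Set.mem_Iio, Set.mem_Ioi, lt_abs]
    constructor <;> rintro (h | h) <;> first | (left; linarith) | (right; linarith)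
  rw [e, measureReal_union _ measurableSet_Ioi, measureReal_congr (Iio_ae_eq_Iic (a := -x)),
    ← cdf_eq_real, cdf_gaussian_neg, ← Set.compl_Iic, probReal_compl_eq_one_sub measurableSet_Iic,
    ← cdf_eq_real]
  · ring
  · rw [Set.disjoint_left]; intro a h1 h2
    simp at h1 h2; linarith

/-- Integrals of functions of the excess `g - L` over a level `L` are at most `φ L` times the
corresponding exponential integral, since `φ (L + u) ≤ φ L e^{-L u}`. -/
lemma lintegral_gaussian_excess_le {h : ℝ → ℝ≥0∞} (hh : Measurable h) (hneg : ∀ u ≤ 0, h u = 0)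
    (L : ℝ) :
    ∫⁻ g, h (g - L) ∂(gaussianReal 0 1) ≤ ENNReal.ofReal (normalDensity L) *
      ∫⁻ u in Set.Ioi 0, h u * ENNReal.ofReal (Real.exp (-(L * u))) := by
  rw [lintegral_gaussian_shift (f := fun g => h (g - L)) (hh.comp (by fun_prop)) L]
  rw [← lintegral_indicator measurableSet_Ioi, ← lintegral_const_mul' _ _ ENNReal.ofReal_ne_top]
  refine lintegral_mono fun u => ?_
  rcases le_or_gt u 0 with hu | hu
  · simp [hneg u hu]
  · rw [Set.indicator_of_mem (show u ∈ Set.Ioi 0 from hu)]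
    simp only [add_sub_cancel_right, gaussianPDF]
    rw [mul_left_comm, normalDensity, ← ENNReal.ofReal_mul (gaussianPDFReal_nonneg _ _ _)]
    gcongr
    rw [gaussianPDFReal_add]
    refine mul_le_of_le_one_right (mul_nonneg (gaussianPDFReal_nonneg _ _ _) (Real.exp_pos _).le) ?_
    rw [Real.exp_le_one_iff]; nlinarith [sq_nonneg u]

lemma lintegral_pow_mul_exp {k : ℕ} {L : ℝ} (hL : 0 < L) :
    ∫⁻ u in Set.Ioi 0, ENNReal.ofReal (u ^ k) * ENNReal.ofReal (Real.exp (-(L * u))) =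
      ENNReal.ofReal (k.factorial / L ^ (k + 1)) := by
  have h := Real.integral_rpow_mul_exp_neg_mul_Ioi (a := k + 1) (r := L) (by positivity) hL
  have hi : IntegrableOn (fun u : ℝ => u ^ k * Real.exp (-(L * u))) (Set.Ioi 0) := by
    have := integrableOn_rpow_mul_exp_neg_mul_rpow (p := 1) (s := k) (b := L)
      (by have : (0:ℝ) ≤ k := Nat.cast_nonneg k
          linarith) one_pos hL
    refine this.congr_fun (fun u hu => ?_) measurableSet_Ioi
    simp
  rw [show ENNReal.ofReal (k.factorial / L ^ (k + 1)) =
    ENNReal.ofReal (∫ u in Set.Ioi 0, u ^ k * Real.exp (-(L * u))) from ?_]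
  · rw [ofReal_integral_eq_lintegral_ofReal hi
      ((ae_restrict_iff' measurableSet_Ioi).2 (Eventually.of_forall fun u hu => by
        have : (0:ℝ) < u := hu
        positivity))]
    refine setLIntegral_congr_fun measurableSet_Ioi fun u hu => ?_
    rw [ENNReal.ofReal_mul (pow_nonneg (le_of_lt hu) _)]
  · congr 1
    have : ∀ u : ℝ, u ^ ((k:ℝ) + 1 - 1) = u ^ k := fun u => by simp
    simp only [this] at h
    rw [h, Real.Gamma_nat_eq_factorial, show (k:ℝ) + 1 = ((k + 1 : ℕ) : ℝ) by push_cast; rfl,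
      Real.rpow_natCast, one_div, inv_pow, div_eq_inv_mul]

lemma normalDensity_nonneg (x : ℝ) : 0 ≤ normalDensity x := gaussianPDFReal_nonneg _ _ _

lemma lintegral_gaussian_pos_part_pow {k : ℕ} (hk : k ≠ 0) {L : ℝ} (hL : 0 < L) :
    ∫⁻ g, ENNReal.ofReal (max (g - L) 0 ^ k) ∂(gaussianReal 0 1) ≤
      ENNReal.ofReal (normalDensity L * (k.factorial / L ^ (k + 1))) := by
  refine (lintegral_gaussian_excess_le (h := fun u => ENNReal.ofReal (max u 0 ^ k))
    (by fun_prop) (fun u hu => by simp [max_eq_right hu, hk]) L).trans ?_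
  rw [ENNReal.ofReal_mul (normalDensity_nonneg L), ← lintegral_pow_mul_exp hL]
  refine mul_le_mul' le_rfl ?_
  refine (setLIntegral_congr_fun (measurableSet_Ioi (a := (0 : ℝ))) fun u hu => ?_).le
  have hu' : (0 : ℝ) < u := hu
  simp only [max_eq_left hu'.le]

lemma lintegral_gaussian_abs_excess_sq {L : ℝ} (hL : 0 < L) :
    ∫⁻ g, ENNReal.ofReal (max (|g| - L) 0 ^ 2) ∂(gaussianReal 0 1) ≤
      ENNReal.ofReal (normalDensity L * (4 / L ^ 3)) := by
  have h1 := lintegral_gaussian_pos_part_pow (k := 2) two_ne_zero hL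
  have h2 : ∫⁻ g, ENNReal.ofReal (max (-g - L) 0 ^ 2) ∂(gaussianReal 0 1) =
      ∫⁻ g, ENNReal.ofReal (max (g - L) 0 ^ 2) ∂(gaussianReal 0 1) :=
    measurePreserving_neg_gaussian.lintegral_comp
      (f := fun g => ENNReal.ofReal (max (g - L) 0 ^ 2)) (by fun_prop)
  calc _ ≤ ∫⁻ g, (ENNReal.ofReal (max (g - L) 0 ^ 2) + ENNReal.ofReal (max (-g - L) 0 ^ 2))
        ∂(gaussianReal 0 1) := by
        refine lintegral_mono fun g => ?_
        rcases abs_choice g with h | h <;> rw [h]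
        · exact le_self_add
        · exact le_add_self
    _ ≤ _ := by
        rw [lintegral_add_left (by fun_prop), h2]
        refine (add_le_add h1 h1).trans ?_
        rw [← ENNReal.ofReal_add]
        · apply ENNReal.ofReal_le_ofReal
          norm_num [Nat.factorial]; ring_nf; rfl
        all_goals exact mul_nonneg (normalDensity_nonneg L) (by positivity)

lemma lintegral_gaussian_sub_sq (a : ℝ) :
    ∫⁻ g, ENNReal.ofReal ((g - a) ^ 2) ∂(gaussianReal 0 1) = ENNReal.ofReal (1 + a ^ 2) := by
  have h2 : MemLp (id : ℝ → ℝ) 2 (gaussianReal 0 1) := memLp_id_gaussianReal 2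
  have i2 : Integrable (fun g : ℝ => g ^ 2) (gaussianReal 0 1) := h2.integrable_sq
  have i1 : Integrable (fun g : ℝ => g) (gaussianReal 0 1) := h2.integrable one_le_two
  have v := variance_id_gaussianReal (μ := 0) (v := 1)
  rw [variance_eq_sub h2] at v
  have m : ∫ g, g ∂(gaussianReal 0 1) = 0 := integral_id_gaussianReal
  have s2 : ∫ g, g ^ 2 ∂(gaussianReal 0 1) = 1 := by
    have : ∫ g, (id g : ℝ) ∂(gaussianReal 0 1) = 0 := m
    rw [this] at v
    simpa using v
  have e : (fun g : ℝ => (g - a) ^ 2) = fun g => g ^ 2 - (2 * a) * g + a ^ 2 := by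
    funext g; ring
  rw [← ofReal_integral_eq_lintegral_ofReal _ (Eventually.of_forall fun g => sq_nonneg _)]
  · rw [e, integral_add (f := fun g : ℝ => g ^ 2 - (2 * a) * g) (i2.sub (i1.const_mul _))
      (integrable_const _), integral_sub i2 (i1.const_mul _), integral_const_mul, m, s2]
    simp
  · rw [e]; exact (i2.sub (i1.const_mul _)).add (integrable_const _)

/-- The moment generating function of `g²`. -/
lemma gaussian_mgf_sq {t : ℝ} (ht : t < 1 / 2) :
    Integrable (fun g : ℝ => Real.exp (t * g ^ 2)) (gaussianReal 0 1) ∧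
    ∫ g, Real.exp (t * g ^ 2) ∂(gaussianReal 0 1) = (Real.sqrt (1 - 2 * t))⁻¹ := by
  have hb : 0 < 1 / 2 - t := by linarith
  have key : ∀ g : ℝ, gaussianPDFReal 0 1 g * Real.exp (t * g ^ 2) =
      (Real.sqrt (2 * Real.pi))⁻¹ * Real.exp (-(1 / 2 - t) * g ^ 2) := fun g => by
    rw [gaussianPDFReal_std, mul_assoc, ← Real.exp_add]; congr 2; ring
  constructor
  · rw [gaussianReal_of_var_ne_zero 0 one_ne_zero,
      integrable_withDensity_iff_integrable_smul' (measurable_gaussianPDF 0 1)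
        (Eventually.of_forall fun x => gaussianPDF_lt_top)]
    have : (fun g : ℝ => (gaussianPDF 0 1 g).toReal • Real.exp (t * g ^ 2)) =
        fun g => (Real.sqrt (2 * Real.pi))⁻¹ * Real.exp (-(1 / 2 - t) * g ^ 2) := by
      funext g
      rw [toReal_gaussianPDF, smul_eq_mul, key]
    rw [this]
    exact (integrable_exp_neg_mul_sq hb).const_mul _
  · rw [integral_gaussianReal_eq_integral_smul one_ne_zero]
    simp only [smul_eq_mul, key]
    rw [integral_const_mul, integral_gaussian, ← Real.sqrt_inv, ← Real.sqrt_inv,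
      ← Real.sqrt_mul (by positivity)]
    congr 1
    have := Real.pi_pos
    have h2 : (1 - t * 2) ≠ 0 := by linarith
    field_simp

/-! ### The standard normal distribution on `ℝⁿ` -/

/-- The law of a vector of `n` independent standard normal variables. -/
abbrev stdPi (n : ℕ) : Measure (Fin n → ℝ) := Measure.pi fun _ => gaussianReal 0 1

lemma l2norm_nonneg {ι : Type} [Fintype ι] (v : ι → ℝ) : 0 ≤ l2norm v := Real.sqrt_nonneg _

lemma l2norm_sq {ι : Type} [Fintype ι] (v : ι → ℝ) : l2norm v ^ 2 = ∑ i, v i ^ 2 :=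
  Real.sq_sqrt (Finset.sum_nonneg fun i _ => sq_nonneg (v i))

lemma l2norm_eq_norm {ι : Type} [Fintype ι] (v : ι → ℝ) : l2norm v = ‖WithLp.toLp 2 v‖ := by
  rw [EuclideanSpace.norm_eq]; simp [l2norm]

lemma dot_eq_inner {ι : Type} [Fintype ι] (v w : ι → ℝ) :
    v ⬝ᵥ w = inner ℝ (WithLp.toLp 2 v) (WithLp.toLp 2 w) := by
  simp [PiLp.inner_apply, dotProduct, mul_comm]

lemma l2norm_pos {ι : Type} [Fintype ι] {v : ι → ℝ} (hv : v ≠ 0) : 0 < l2norm v := by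
  rw [l2norm_eq_norm, norm_pos_iff]; simpa using hv

lemma l2norm_smul {ι : Type} [Fintype ι] (c : ℝ) (v : ι → ℝ) : l2norm (c • v) = |c| * l2norm v := by
  rw [l2norm_eq_norm, l2norm_eq_norm, WithLp.toLp_smul, norm_smul, Real.norm_eq_abs]

/-- Rotation invariance: the joint law of `(vᵀe, ‖e‖₂)` under `N(0, σ² I)` is that of
`(‖v‖₂ σ g_i, σ ‖g‖₂)` for a standard normal vector `g` and any fixed coordinate `i`. -/
lemma exists_rotation {n : ℕ} {σ : ℝ} (hσ : 0 < σ) (v : Fin n → ℝ) (i : Fin n) :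
    ∃ T : (Fin n → ℝ) ≃ᵐ (Fin n → ℝ),
      MeasurePreserving T (stdPi n)
        (Measure.pi fun _ => gaussianReal 0 (Real.toNNReal (σ ^ 2))) ∧
      ∀ g, v ⬝ᵥ T g = l2norm v * (σ * g i) ∧ l2norm (T g) = σ * l2norm g := by
  set w : EuclideanSpace ℝ (Fin n) := WithLp.toLp 2 v with hw
  set w' : EuclideanSpace ℝ (Fin n) := EuclideanSpace.single i (l2norm v) with hw'
  have hnorm : ‖w‖ = ‖w'‖ := by
    rw [hw', PiLp.norm_single, Real.norm_of_nonneg (l2norm_nonneg v), hw,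
      l2norm_eq_norm]
  set ρ := (ℝ ∙ (w - w'))ᗮ.reflection with hρ
  have hρw : ρ w = w' := Submodule.reflection_sub hnorm
  have hmp1 : MeasurePreserving (WithLp.toLp 2 : (Fin n → ℝ) → EuclideanSpace ℝ (Fin n)) (stdPi n)
      (stdGaussian (EuclideanSpace ℝ (Fin n))) :=
    ⟨(MeasurableEquiv.toLp 2 (Fin n → ℝ)).measurable, map_pi_eq_stdGaussian⟩
  have hmp2 : MeasurePreserving ρ (stdGaussian (EuclideanSpace ℝ (Fin n)))
      (stdGaussian (EuclideanSpace ℝ (Fin n))) :=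
    ⟨ρ.continuous.measurable, stdGaussian_map ρ⟩
  have hmp3 : MeasurePreserving (MeasurableEquiv.toLp 2 (Fin n → ℝ)).symm
      (stdGaussian (EuclideanSpace ℝ (Fin n))) (stdPi n) :=
    MeasurePreserving.symm (MeasurableEquiv.toLp 2 (Fin n → ℝ)) hmp1
  have hmp4 : MeasurePreserving (fun (g : Fin n → ℝ) i => σ * g i) (stdPi n)
      (Measure.pi fun _ => gaussianReal 0 (Real.toNNReal (σ ^ 2))) := by
    refine measurePreserving_pi _ _ fun i => ⟨by fun_prop, ?_⟩
    rw [gaussianReal_map_const_mul]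
    congr 1
    · simp
    · ext; simp [sq_nonneg]
  refine ⟨(((MeasurableEquiv.toLp 2 (Fin n → ℝ)).trans ρ.toMeasurableEquiv).trans
      (MeasurableEquiv.toLp 2 (Fin n → ℝ)).symm).trans (MeasurableEquiv.smul₀ σ hσ.ne'), ?_, ?_⟩
  · exact hmp4.comp (hmp3.comp (hmp2.comp hmp1))
  · intro g
    set u := WithLp.ofLp (ρ (WithLp.toLp 2 g)) with hu
    have e : ((((MeasurableEquiv.toLp 2 (Fin n → ℝ)).trans ρ.toMeasurableEquiv).trans
      (MeasurableEquiv.toLp 2 (Fin n → ℝ)).symm).trans (MeasurableEquiv.smul₀ σ hσ.ne')) g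
        = σ • u := rfl
    rw [e]
    constructor
    · rw [dotProduct_smul, dot_eq_inner, ← hw, hu, WithLp.toLp_ofLp]
      rw [← ρ.inner_map_map, hρw, hρ, Submodule.reflection_reflection, hw',
        EuclideanSpace.inner_single_left]
      simp; ring
    · rw [l2norm_smul, abs_of_pos hσ, l2norm_eq_norm u, l2norm_eq_norm g, hu, WithLp.toLp_ofLp,
        ρ.norm_map]

lemma stdPi_mgf_sq (n : ℕ) {t : ℝ} (ht : t < 1 / 2) :
    Integrable (fun g : Fin n → ℝ => Real.exp (t * ∑ i, g i ^ 2)) (stdPi n) ∧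
    ∫ g, Real.exp (t * ∑ i, g i ^ 2) ∂(stdPi n) = (Real.sqrt (1 - 2 * t))⁻¹ ^ n := by
  have e : (fun g : Fin n → ℝ => Real.exp (t * ∑ i, g i ^ 2)) =
      fun g => ∏ i, Real.exp (t * g i ^ 2) := by
    funext g; rw [Finset.mul_sum, Real.exp_sum]
  have h := gaussian_mgf_sq ht
  rw [e]
  refine ⟨Integrable.fintype_prod (f := fun _ x => Real.exp (t * x ^ 2)) fun _ => h.1, ?_⟩
  rw [integral_fintype_prod_eq_pow (fun x : ℝ => Real.exp (t * x ^ 2)), h.2, Fintype.card_fin]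

/-- The base of the exponential bounds for the chi-square tails at `n x`. -/
def chiBase (x : ℝ) : ℝ := Real.sqrt x * Real.exp ((1 - x) / 2)

lemma chiBase_pos {x : ℝ} (hx : 0 < x) : 0 < chiBase x :=
  mul_pos (Real.sqrt_pos.2 hx) (Real.exp_pos _)

lemma chiBase_lt_one {x : ℝ} (hx : 0 < x) (h1 : x ≠ 1) : chiBase x < 1 := by
  have h := Real.log_lt_sub_one_of_pos hx h1
  rw [chiBase, Real.sqrt_eq_rpow, Real.rpow_def_of_pos hx, ← Real.exp_add, Real.exp_lt_one_iff]
  linarith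

/-- Chernoff's bound for the chi-square distribution, with exponent `t = (1 - x⁻¹) / 2`. -/
lemma chi_chernoff (n : ℕ) {x : ℝ} (hx : 0 < x) :
    (stdPi n).real {g | (1 - x⁻¹) / 2 * (x * n) ≤ (1 - x⁻¹) / 2 * ∑ i, g i ^ 2} ≤
      chiBase x ^ n := by
  set t := (1 - x⁻¹) / 2 with ht
  have hx' := inv_pos.2 hx
  obtain ⟨hi, he⟩ := stdPi_mgf_sq n (t := t) (by rw [ht]; linarith)
  have hM := mul_meas_ge_le_integral_of_nonneg (Eventually.of_forall fun g => (Real.exp_pos _).le)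
    hi (Real.exp (t * (x * n)))
  simp only [Real.exp_le_exp] at hM
  rw [he, mul_comm, ← le_div_iff₀ (Real.exp_pos _)] at hM
  refine hM.trans (le_of_eq ?_)
  rw [div_eq_mul_inv, ← Real.exp_neg, chiBase, mul_pow, ← Real.exp_nat_mul]
  congr 2
  · rw [ht, show 1 - 2 * ((1 - x⁻¹) / 2) = x⁻¹ by ring, Real.sqrt_inv, inv_inv]
  · rw [ht]; field_simp; ring

lemma chi_lower {n : ℕ} {x : ℝ} (hx : 0 < x) (h1 : x < 1) :
    (stdPi n).real {g | l2norm g ^ 2 ≤ x * n} ≤ chiBase x ^ n := by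
  refine le_trans (measureReal_mono fun g hg => ?_) (chi_chernoff n hx)
  have : (1 - x⁻¹) / 2 ≤ 0 := by
    have := one_lt_inv₀ hx |>.2 h1
    linarith
  have hg' : l2norm g ^ 2 ≤ x * n := hg
  rw [l2norm_sq] at hg'
  exact mul_le_mul_of_nonpos_left hg' this

lemma chi_upper {n : ℕ} {x : ℝ} (h1 : 1 < x) :
    (stdPi n).real {g | x * n ≤ l2norm g ^ 2} ≤ chiBase x ^ n := by
  refine le_trans (measureReal_mono fun g hg => ?_) (chi_chernoff n (one_pos.trans h1))
  have : 0 ≤ (1 - x⁻¹) / 2 := by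
    have := inv_lt_one_of_one_lt₀ h1
    linarith
  have hg' : x * n ≤ l2norm g ^ 2 := hg
  rw [l2norm_sq] at hg'
  exact mul_le_mul_of_nonneg_left hg' this

/-- Conditionally on the last `k` coordinates the event has probability at most `e^{-κ² R / 2}`,
where `R` is their sum of squares. -/
lemma first_coordinate_tail (k : ℕ) (κ : ℝ) :
    stdPi (k + 1) {g | κ ^ 2 * ∑ i : Fin k, g i.succ ^ 2 ≤ g 0 ^ 2} ≤
      ENNReal.ofReal ((Real.sqrt (1 + κ ^ 2))⁻¹ ^ k) := by
  set B : Set (ℝ × (Fin k → ℝ)) := {q | κ ^ 2 * ∑ i : Fin k, q.2 i ^ 2 ≤ q.1 ^ 2} with hB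
  have hBm : MeasurableSet B := measurableSet_le (by fun_prop) (by fun_prop)
  have hmp := measurePreserving_piFinSuccAbove
    (fun _ : Fin (k + 1) => gaussianReal 0 1) 0
  have e : {g : Fin (k + 1) → ℝ | κ ^ 2 * ∑ i : Fin k, g i.succ ^ 2 ≤ g 0 ^ 2} =
      (MeasurableEquiv.piFinSuccAbove (fun _ : Fin (k + 1) => ℝ) 0) ⁻¹' B := by
    ext g; rfl
  rw [stdPi, e, hmp.measure_preimage_equiv, Measure.prod_apply_symm hBm]
  obtain ⟨hi, he⟩ := stdPi_mgf_sq k (t := -(κ ^ 2 / 2)) (by nlinarith [sq_nonneg κ])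
  calc _ ≤ ∫⁻ y : Fin k → ℝ, ENNReal.ofReal (Real.exp (-(κ ^ 2 / 2) * ∑ i, y i ^ 2))
        ∂(stdPi k) := by
        refine lintegral_mono fun y => ?_
        have hS : 0 ≤ ∑ i, y i ^ 2 := Finset.sum_nonneg fun i _ => sq_nonneg _
        refine (measure_mono ?_).trans
          ((gaussian_abs_tail (x := |κ| * Real.sqrt (∑ i, y i ^ 2)) (by positivity)).trans_eq ?_)
        · intro x hx
          have hx' : κ ^ 2 * ∑ i, y i ^ 2 ≤ x ^ 2 := hx
          refine abs_le_of_sq_le_sq' ?_ (abs_nonneg x) |>.2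
          rw [mul_pow, sq_abs, sq_abs, Real.sq_sqrt hS]; exact hx'
        · rw [mul_pow, sq_abs, Real.sq_sqrt hS]; congr 2; ring
    _ = _ := by
        rw [← ofReal_integral_eq_lintegral_ofReal hi
          (Eventually.of_forall fun g => (Real.exp_pos _).le), he,
          show 1 - 2 * -(κ ^ 2 / 2) = 1 + κ ^ 2 by ring]

lemma l2norm_sq_succ {k : ℕ} (g : Fin (k + 1) → ℝ) :
    l2norm g ^ 2 = g 0 ^ 2 + ∑ i : Fin k, g i.succ ^ 2 := by
  rw [l2norm_sq, Fin.sum_univ_succ]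

/-- The tail of a coordinate of a uniform point of the sphere of radius `√n`. With `x = w² / n`,
the event forces `(eˣ - 1) R ≤ g₀²`, where `R` is the sum of squares of the other coordinates. -/
lemma sphere_tail (k : ℕ) {w : ℝ} (hw : 0 ≤ w) :
    stdPi (k + 1) {g | w * (l2norm g / Real.sqrt ((k + 1 : ℕ) : ℝ)) ≤ |g 0|} ≤
      ENNReal.ofReal (Real.exp (-(k * w ^ 2 / (2 * ((k + 1 : ℕ) : ℝ))))) := by
  set n : ℝ := ((k + 1 : ℕ) : ℝ) with hn
  have hn0 : 0 < n := by rw [hn]; positivity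
  set x := w ^ 2 / n with hx
  have hx0 : 0 ≤ x := by positivity
  have hκ : 0 ≤ Real.exp x - 1 := by linarith [Real.one_le_exp hx0]
  refine (measure_mono ?_).trans ((first_coordinate_tail k (Real.sqrt (Real.exp x - 1))).trans_eq ?_)
  · intro g hg
    have hg' : w * (l2norm g / Real.sqrt n) ≤ |g 0| := hg
    have h2 := pow_le_pow_left₀ (mul_nonneg hw (div_nonneg (l2norm_nonneg g) (Real.sqrt_nonneg _)))
      hg' 2
    rw [mul_pow, div_pow, Real.sq_sqrt hn0.le, sq_abs, l2norm_sq_succ] at h2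
    set R := ∑ i : Fin k, g i.succ ^ 2 with hR
    have hR0 : 0 ≤ R := Finset.sum_nonneg fun i _ => sq_nonneg _
    have h3 : x * (g 0 ^ 2 + R) ≤ g 0 ^ 2 := by
      rw [hx, div_mul_eq_mul_div, mul_div_assoc]; exact h2
    change Real.sqrt (Real.exp x - 1) ^ 2 * R ≤ g 0 ^ 2
    rw [Real.sq_sqrt hκ]
    rcases lt_or_ge x 1 with h1 | h1
    · have h4 : Real.exp x * (1 - x) ≤ 1 := by
        have := Real.add_one_le_exp (-x)
        calc Real.exp x * (1 - x) ≤ Real.exp x * Real.exp (-x) := by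
              gcongr; linarith
          _ = 1 := by rw [← Real.exp_add]; simp
      have h5 : x * R ≤ (1 - x) * g 0 ^ 2 := by linarith
      have h6 : (1 - x) * ((Real.exp x - 1) * R) ≤ (1 - x) * g 0 ^ 2 := by
        refine le_trans ?_ h5
        nlinarith
      exact le_of_mul_le_mul_left h6 (by linarith)
    · have : R = 0 := by nlinarith [sq_nonneg (g 0)]
      rw [this, mul_zero]; positivity
  · congr 1
    rw [Real.sq_sqrt hκ, add_sub_cancel, ← Real.exp_half, ← Real.exp_neg, ← Real.exp_nat_mul]
    congr 1; rw [hx]; field_simp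

lemma stdPi_neg (n : ℕ) : MeasurePreserving (fun g : Fin n → ℝ => -g) (stdPi n) (stdPi n) :=
  measurePreserving_pi _ _ fun _ => measurePreserving_neg_gaussian

/-- A coordinate of a uniform point on the sphere of radius `√(k+1)` has lighter tails than
Student's distribution with `k` degrees of freedom, beyond the level `1`. -/
lemma sphere_student {k : ℕ} (hk : 1 ≤ k) {u : ℝ} (hu : 1 ≤ u) :
    (stdPi (k + 1)).real {g | u * (l2norm g / Real.sqrt ((k + 1 : ℕ) : ℝ)) ≤ |g 0|} ≤
      2 * studentCDF k (-u) := by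
  set E : Set (Fin (k + 1) → ℝ) :=
    {g | g 0 / Real.sqrt ((∑ i : Fin k, g i.succ ^ 2) / k) ≤ -u} with hE
  have hEm : MeasurableSet E := measurableSet_le (by fun_prop) (by fun_prop)
  set i1 : Fin (k + 1) := ⟨1, by omega⟩
  have hsub : {g : Fin (k + 1) → ℝ | u * (l2norm g / Real.sqrt ((k + 1 : ℕ) : ℝ)) ≤ |g 0|} ⊆
      (E ∪ (fun g => -g) ⁻¹' E) ∪ {g | g i1 = 0} := by
    intro g hg
    by_cases hg1 : g i1 = 0
    · exact Or.inr hg1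
    left
    have hn0 : (0 : ℝ) < ((k + 1 : ℕ) : ℝ) := by positivity
    have hk0 : (0 : ℝ) < k := by exact_mod_cast hk
    have hg' : u * (l2norm g / Real.sqrt ((k + 1 : ℕ) : ℝ)) ≤ |g 0| := hg
    have h2 := pow_le_pow_left₀ (mul_nonneg (by linarith)
      (div_nonneg (l2norm_nonneg g) (Real.sqrt_nonneg _))) hg' 2
    rw [mul_pow, div_pow, Real.sq_sqrt hn0.le, sq_abs, l2norm_sq_succ] at h2
    set R := ∑ i : Fin k, g i.succ ^ 2 with hR
    have hRpos : 0 < R := by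
      refine Finset.sum_pos' (fun i _ => sq_nonneg _) ⟨⟨0, by omega⟩, Finset.mem_univ _, ?_⟩
      exact sq_pos_of_ne_zero hg1
    have h3 : u ^ 2 * (g 0 ^ 2 + R) ≤ g 0 ^ 2 * (k + 1) := by
      push_cast at h2
      rw [← mul_div_assoc, div_le_iff₀ (by positivity)] at h2
      exact h2
    have h4 : u ^ 2 * (R / k) ≤ g 0 ^ 2 := by
      rw [← mul_div_assoc, div_le_iff₀ hk0]
      nlinarith [sq_nonneg (g 0), mul_nonneg (sq_nonneg (g 0)) (show 0 ≤ u ^ 2 - 1 by nlinarith)]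
    have hs : 0 < Real.sqrt (R / k) := Real.sqrt_pos.2 (by positivity)
    have h5 : u * Real.sqrt (R / k) ≤ |g 0| := by
      refine abs_le_of_sq_le_sq' ?_ (abs_nonneg _) |>.2
      rw [mul_pow, sq_abs, Real.sq_sqrt (by positivity)]; exact h4
    rcases le_abs.1 h5 with h | h
    · right
      change (-g) 0 / Real.sqrt ((∑ i : Fin k, (-g) i.succ ^ 2) / k) ≤ -u
      simp only [Pi.neg_apply, neg_sq]
      rw [← hR, div_le_iff₀ hs]; linarith
    · left
      change g 0 / Real.sqrt (R / k) ≤ -u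
      rw [div_le_iff₀ hs]; linarith
  refine (measureReal_mono hsub).trans ((measureReal_union_le _ _).trans ?_)
  have h0 : (stdPi (k + 1)).real {g | g i1 = 0} = 0 := by
    rw [measureReal_def, Measure.pi_hyperplane]; rfl
  have h1 : (stdPi (k + 1)).real ((fun g => -g) ⁻¹' E) = (stdPi (k + 1)).real E := by
    rw [measureReal_def, (stdPi_neg (k + 1)).measure_preimage hEm.nullMeasurableSet,
      measureReal_def]
  rw [h0, add_zero]
  refine (measureReal_union_le _ _).trans ?_
  rw [h1, two_mul]
  rfl

lemma l1norm_nonneg {ι : Type} [Fintype ι] (v : ι → ℝ) : 0 ≤ l1norm v :=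
  Finset.sum_nonneg fun _ _ => abs_nonneg _

/-- A lower bound by the complement holds for every set, measurable or not. -/
lemma one_sub_measureReal_compl_le {Ω : Type*} [MeasurableSpace Ω] (μ : Measure Ω)
    [IsProbabilityMeasure μ] (s : Set Ω) : 1 - μ.real sᶜ ≤ μ.real s := by
  have h := measureReal_union_le (μ := μ) s sᶜ
  rw [Set.union_compl_self, probReal_univ] at h
  linarith

namespace Setup

/-! ### The noise of a linear model -/

instance (D : Setup) : IsProbabilityMeasure D.P := by unfold P; infer_instance

lemma sigStar_nonneg (D : Setup) (e : Fin D.n → ℝ) : 0 ≤ D.sigStar e :=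
  div_nonneg (l2norm_nonneg e) (Real.sqrt_nonneg _)

/-- `vᵀe / ‖v‖₂` and `σ*` are jointly distributed as `σ g₀` and `σ ‖g‖₂ / √n`. -/
lemma P_real_eq_stdPi (D : Setup) (hn : 1 ≤ D.n) (hσ : 0 < D.σ) {v : Fin D.n → ℝ}
    (hv : 0 < l2norm v) (B : ℝ → ℝ → Prop) :
    D.P.real {e | B ((v ⬝ᵥ e) / l2norm v) (D.sigStar e)} =
      (stdPi D.n).real {g | B (D.σ * g ⟨0, hn⟩) (D.σ * (l2norm g / Real.sqrt D.n))} := by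
  obtain ⟨T, hT, h⟩ := exists_rotation hσ v (⟨0, hn⟩ : Fin D.n)
  rw [measureReal_def, measureReal_def, P, ← hT.measure_preimage_equiv]
  congr 2
  ext g
  obtain ⟨h1, h2⟩ := h g
  simp only [Set.mem_preimage, Set.mem_ofPred_eq, sigStar]
  rw [h1, h2, mul_div_cancel_left₀ _ hv.ne', mul_div_assoc]

lemma eval_real (n : ℕ) (i : Fin n) {s : Set ℝ} (hs : MeasurableSet s) :
    (stdPi n).real {g | g i ∈ s} = (gaussianReal 0 1).real s := by
  have := (measurePreserving_eval (fun _ : Fin n => gaussianReal 0 1) i).measure_preimage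
    hs.nullMeasurableSet
  rw [measureReal_def, measureReal_def, ← this]; rfl

lemma noise_coord (D : Setup) (hn : 1 ≤ D.n) (hσ : 0 < D.σ) {v : Fin D.n → ℝ}
    (hv : 0 < l2norm v) {s : Set ℝ} (hs : MeasurableSet s) :
    D.P.real {e | (v ⬝ᵥ e) / l2norm v ∈ s} = (gaussianReal 0 1).real {g | D.σ * g ∈ s} := by
  rw [D.P_real_eq_stdPi hn hσ hv (fun a _ => a ∈ s)]
  exact eval_real D.n ⟨0, hn⟩ (s := {g | D.σ * g ∈ s}) (by
    exact (measurable_const_mul D.σ) hs)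

lemma noise_tail (D : Setup) (hn : 1 ≤ D.n) (hσ : 0 < D.σ) {v : Fin D.n → ℝ}
    (hv : 0 < l2norm v) {x : ℝ} (hx : 0 ≤ x) :
    D.P.real {e | D.σ * x ≤ |(v ⬝ᵥ e) / l2norm v|} ≤ Real.exp (-x ^ 2 / 2) := by
  have h := D.noise_coord hn hσ hv (s := {y | D.σ * x ≤ |y|})
    (measurableSet_le (by fun_prop) (by fun_prop))
  simp only [Set.mem_ofPred_eq, abs_mul, abs_of_pos hσ, mul_le_mul_iff_right₀ hσ] at h
  rw [h, measureReal_def]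
  exact ENNReal.toReal_le_of_le_ofReal (Real.exp_pos _).le (gaussian_abs_tail hx)

lemma noise_tail_eq (D : Setup) (hn : 1 ≤ D.n) (hσ : 0 < D.σ) {v : Fin D.n → ℝ}
    (hv : 0 < l2norm v) {x : ℝ} (hx : 0 ≤ x) :
    D.P.real {e | D.σ * x < |(v ⬝ᵥ e) / l2norm v|} =
      2 * (1 - cdf (gaussianReal 0 1) x) := by
  have h := D.noise_coord hn hσ hv (s := {y | D.σ * x < |y|})
    (measurableSet_lt (by fun_prop) (by fun_prop))
  simp only [Set.mem_ofPred_eq, abs_mul, abs_of_pos hσ, mul_lt_mul_iff_right₀ hσ] at h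
  rw [h, gaussian_real_abs_gt hx]

lemma sphere_event (D : Setup) (hn : 1 ≤ D.n) (hσ : 0 < D.σ) {v : Fin D.n → ℝ}
    (hv : 0 < l2norm v) (w : ℝ) :
    D.P.real {e | w * D.sigStar e ≤ |(v ⬝ᵥ e) / l2norm v|} =
      (stdPi D.n).real {g | w * (l2norm g / Real.sqrt D.n) ≤ |g ⟨0, hn⟩|} := by
  rw [D.P_real_eq_stdPi hn hσ hv (fun a b => w * b ≤ |a|)]
  simp only [abs_mul, abs_of_pos hσ, mul_left_comm w, mul_le_mul_iff_right₀ hσ]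

lemma noise_sphere_tail (D : Setup) (hn : 1 ≤ D.n) (hσ : 0 < D.σ) {v : Fin D.n → ℝ}
    (hv : 0 < l2norm v) {w : ℝ} (hw : 0 ≤ w) :
    D.P.real {e | w * D.sigStar e ≤ |(v ⬝ᵥ e) / l2norm v|} ≤
      Real.exp (-(((D.n : ℝ) - 1) * w ^ 2 / (2 * D.n))) := by
  rw [D.sphere_event hn hσ hv]
  have : ∀ (n : ℕ) (hn : 1 ≤ n), (stdPi n).real
      {g | w * (l2norm g / Real.sqrt n) ≤ |g ⟨0, hn⟩|} ≤
      Real.exp (-(((n : ℝ) - 1) * w ^ 2 / (2 * n))) := by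
    intro n hn
    obtain ⟨k, rfl⟩ : ∃ k, n = k + 1 := ⟨n - 1, by omega⟩
    refine ENNReal.toReal_le_of_le_ofReal (Real.exp_pos _).le ((sphere_tail k hw).trans_eq ?_)
    push_cast; simp
  exact this D.n hn

lemma noise_student (D : Setup) (hn : 2 ≤ D.n) (hσ : 0 < D.σ) {v : Fin D.n → ℝ}
    (hv : 0 < l2norm v) {u : ℝ} (hu : 1 ≤ u) :
    D.P.real {e | u * D.sigStar e ≤ |(v ⬝ᵥ e) / l2norm v|} ≤
      2 * studentCDF (D.n - 1) (-u) := by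
  rw [D.sphere_event (by omega) hσ hv]
  have : ∀ (n : ℕ) (hn : 2 ≤ n), (stdPi n).real
      {g | u * (l2norm g / Real.sqrt n) ≤ |g ⟨0, by omega⟩|} ≤
      2 * studentCDF (n - 1) (-u) := by
    intro n hn
    obtain ⟨k, rfl⟩ : ∃ k, n = k + 1 := ⟨n - 1, by omega⟩
    exact sphere_student (k := k) (by omega) hu
  exact this D.n hn

lemma sigStar_event (D : Setup) (hn : 1 ≤ D.n) (hσ : 0 < D.σ) (B : ℝ → Prop) :
    D.P.real {e | B (D.sigStar e)} =
      (stdPi D.n).real {g | B (D.σ * (l2norm g / Real.sqrt D.n))} :=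
  D.P_real_eq_stdPi hn hσ (v := fun _ => 1)
    (l2norm_pos fun h => one_ne_zero (congrFun h (⟨0, hn⟩ : Fin D.n))) fun _ b => B b

lemma noise_level_lower (D : Setup) (hn : 1 ≤ D.n) (hσ : 0 < D.σ) {a : ℝ} (h0 : 0 < a)
    (h1 : a < 1) : D.P.real {e | D.sigStar e ≤ a * D.σ} ≤ chiBase (a ^ 2) ^ D.n := by
  rw [D.sigStar_event hn hσ (fun b => b ≤ a * D.σ)]
  refine le_trans (measureReal_mono fun g hg => ?_)
    (chi_lower (n := D.n) (x := a ^ 2) (by positivity) (by nlinarith))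
  have hn' : (0 : ℝ) < D.n := by exact_mod_cast hn
  have hg' : D.σ * (l2norm g / Real.sqrt D.n) ≤ a * D.σ := hg
  rw [mul_comm a, mul_le_mul_iff_right₀ hσ, div_le_iff₀ (Real.sqrt_pos.2 hn')] at hg'
  have := pow_le_pow_left₀ (l2norm_nonneg g) hg' 2
  rwa [mul_pow, Real.sq_sqrt hn'.le] at this

lemma noise_level_upper (D : Setup) (hn : 1 ≤ D.n) (hσ : 0 < D.σ) {b : ℝ} (h1 : 1 < b) :
    D.P.real {e | b * D.σ ≤ D.sigStar e} ≤ chiBase (b ^ 2) ^ D.n := by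
  rw [D.sigStar_event hn hσ (fun y => b * D.σ ≤ y)]
  refine le_trans (measureReal_mono fun g hg => ?_)
    (chi_upper (n := D.n) (x := b ^ 2) (by nlinarith))
  have hn' : (0 : ℝ) < D.n := by exact_mod_cast hn
  have hg' : b * D.σ ≤ D.σ * (l2norm g / Real.sqrt D.n) := hg
  rw [mul_comm b, mul_le_mul_iff_right₀ hσ, le_div_iff₀ (Real.sqrt_pos.2 hn')] at hg'
  have := pow_le_pow_left₀ (by positivity) hg' 2
  rwa [mul_pow, Real.sq_sqrt hn'.le] at this

/-! ### The error decomposition of the projection estimator -/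

lemma log_ratio_pos {D : Setup} (h : D.Standing) : Real.log 2 ≤ Real.log (D.p / D.ε) := by
  have h2 : (2 : ℝ) ≤ D.p := by exact_mod_cast h.two_le_p
  refine Real.log_le_log two_pos ?_
  rw [le_div_iff₀ h.eps_pos]
  nlinarith [h.eps_le_one]

lemma rate_sq {D : Setup} (h : D.Standing) :
    D.rate ^ 2 = 2 / (D.n : ℝ) * Real.log (D.p / D.ε) := by
  have := log_ratio_pos h
  have h2 := Real.log_pos one_lt_two
  exact Real.sq_sqrt (mul_nonneg (by positivity) (by linarith))

lemma rate_pos {D : Setup} (h : D.Standing) : 0 < D.rate := by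
  have := log_ratio_pos h
  have h2 := Real.log_pos one_lt_two
  have hn : (0 : ℝ) < D.n := by exact_mod_cast h.one_le_n
  exact Real.sqrt_pos.2 (mul_pos (by positivity) (by linarith))

lemma score_norm_pos {D : Setup} {z : Fin D.p → Fin D.n → ℝ} (hz : D.IsScore z) (j : Fin D.p) :
    0 < l2norm (z j) := by
  refine l2norm_pos fun h => ?_
  have := hz j
  rw [h, zero_dotProduct] at this
  exact lt_irrefl _ this

lemma tau_pos {D : Setup} {z : Fin D.p → Fin D.n → ℝ} (hz : D.IsScore z) (j : Fin D.p) :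
    0 < D.tau z j := div_pos (score_norm_pos hz j) (abs_pos.2 (hz j).ne')

lemma dot_y (D : Setup) (v : Fin D.n → ℝ) (e : Fin D.n → ℝ) :
    v ⬝ᵥ D.y e = ∑ k, (v ⬝ᵥ D.x k) * D.β k + v ⬝ᵥ e := by
  rw [y, dotProduct_add, Matrix.dotProduct_mulVec]
  rfl

lemma est_sub {D : Setup} {z : Fin D.p → Fin D.n → ℝ} (hz : D.IsScore z) (e : Fin D.n → ℝ)
    (j : Fin D.p) :
    D.est z e j - D.β j = (z j ⬝ᵥ e) / (z j ⬝ᵥ D.x j) -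
      ∑ k ∈ Finset.univ.erase j, (z j ⬝ᵥ D.x k) * (D.bInit e k - D.β k) / (z j ⬝ᵥ D.x j) := by
  have hj := (hz j).ne'
  rw [est, dot_y, ← Finset.add_sum_erase _ _ (Finset.mem_univ j)]
  simp only [mul_sub, sub_div, Finset.sum_sub_distrib]
  rw [← Finset.sum_div, ← Finset.sum_div]
  field_simp
  ring

lemma le_eta (D : Setup) (z : Fin D.p → Fin D.n → ℝ) {j k : Fin D.p} (hk : k ≠ j) :
    |z j ⬝ᵥ D.x k| / l2norm (z j) ≤ D.eta z j :=
  le_ciSup (f := fun k : {k : Fin D.p // k ≠ j} => |z j ⬝ᵥ D.x k| / l2norm (z j))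
    (Set.finite_range _).bddAbove ⟨k, hk⟩

/-- The bias of the projection estimator, in units of `τ_j`, is at most `η_j` times the `ℓ₁` error
of the initial estimator. -/
lemma est_bias_le {D : Setup} {z : Fin D.p → Fin D.n → ℝ} (hz : D.IsScore z)
    (hp : 2 ≤ D.p) (e : Fin D.n → ℝ) (j : Fin D.p) :
    |(D.tau z j)⁻¹ * (D.est z e j - D.β j) - (z j ⬝ᵥ e) / l2norm (z j)| ≤
      D.eta z j * l1norm (D.bInit e - D.β) := by
  have hj := hz j
  have hzn := score_norm_pos hz j
  have heta : 0 ≤ D.eta z j := by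
    obtain ⟨k, hk⟩ : ∃ k : Fin D.p, k ≠ j := by
      have : Nontrivial (Fin D.p) := Fin.nontrivial_iff_two_le.2 hp
      exact exists_ne j
    exact le_trans (by positivity) (D.le_eta z hk)
  have e1 : (D.tau z j)⁻¹ * (D.est z e j - D.β j) - (z j ⬝ᵥ e) / l2norm (z j) =
      -∑ k ∈ Finset.univ.erase j, (z j ⬝ᵥ D.x k) / l2norm (z j) * (D.bInit e k - D.β k) := by
    rw [est_sub hz, tau, abs_of_pos hj, mul_sub, Finset.mul_sum, ← Finset.sum_neg_distrib]
    have : ∀ k, -((z j ⬝ᵥ D.x k) / l2norm (z j) * (D.bInit e k - D.β k)) =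
      -((l2norm (z j) / (z j ⬝ᵥ D.x j))⁻¹ *
        ((z j ⬝ᵥ D.x k) * (D.bInit e k - D.β k) / (z j ⬝ᵥ D.x j))) := fun k => by
      field_simp
    simp only [this, Finset.sum_neg_distrib]
    field_simp
    ring
  rw [e1, abs_neg]
  calc _ ≤ ∑ k ∈ Finset.univ.erase j, |(z j ⬝ᵥ D.x k) / l2norm (z j) * (D.bInit e k - D.β k)| :=
        Finset.abs_sum_le_sum_abs _ _
    _ ≤ ∑ k ∈ Finset.univ.erase j, D.eta z j * |D.bInit e k - D.β k| := by
        refine Finset.sum_le_sum fun k hk => ?_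
        rw [abs_mul, abs_div, abs_of_pos hzn]
        exact mul_le_mul_of_nonneg_right (D.le_eta z (Finset.ne_of_mem_erase hk)) (abs_nonneg _)
    _ ≤ ∑ k, D.eta z j * |D.bInit e k - D.β k| :=
        Finset.sum_le_sum_of_subset_of_nonneg (Finset.erase_subset _ _)
          fun k _ _ => mul_nonneg heta (abs_nonneg _)
    _ = _ := by rw [← Finset.mul_sum]; rfl

/-! ### Conclusions at a fixed sample size -/

/-- The properties of a setup from which the inferential conclusions follow. -/
structure Controlled (D : Setup) (C₁ C₂ : ℝ) : Prop where
  standing : D.Standing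
  two_le_n : 2 ≤ D.n
  rate_sq_le : D.rate ^ 2 ≤ 1
  l1 : D.L1ErrorCond C₁
  noise : D.NoiseCond C₂

/-- The event excluded by the `ℓ₁` error condition. -/
def badL1 (D : Setup) (C₁ : ℝ) : Set (Fin D.n → ℝ) :=
  {e | C₁ * D.s * D.sigStar e * D.rate ≤ l1norm (D.bInit e - D.β)}

/-- The event excluded by the noise level condition. -/
def badNoise (D : Setup) (C₂ : ℝ) : Set (Fin D.n → ℝ) :=
  {e | C₂ * D.s * D.rate ^ 2 ≤ |D.sigHat e / D.sigStar e - 1|}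

lemma sigStar_pos_of_notMem {D : Setup} {C₁ : ℝ} {e : Fin D.n → ℝ}
    (he : e ∉ D.badL1 C₁) : 0 < D.sigStar e := by
  refine lt_of_le_of_ne (D.sigStar_nonneg e) fun h0 => he ?_
  change C₁ * D.s * D.sigStar e * D.rate ≤ l1norm (D.bInit e - D.β)
  rw [← h0, mul_zero, zero_mul]; exact l1norm_nonneg _

lemma l1_lt_of_notMem {D : Setup} {C₁ : ℝ} {e : Fin D.n → ℝ} (he : e ∉ D.badL1 C₁) :
    l1norm (D.bInit e - D.β) < C₁ * D.s * D.sigStar e * D.rate := not_le.1 he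

lemma sigHat_bounds {D : Setup} {C₁ C₂ e'' : ℝ} {e : Fin D.n → ℝ}
    (he : e ∉ D.badL1 C₁) (he2 : e ∉ D.badNoise C₂)
    (hb : C₂ * D.s * D.rate ^ 2 ≤ e'') :
    (1 - e'') * D.sigStar e < D.sigHat e ∧ D.sigHat e < (1 + e'') * D.sigStar e := by
  have hs := sigStar_pos_of_notMem he
  have h2 : |D.sigHat e / D.sigStar e - 1| < e'' := lt_of_lt_of_le (not_le.1 he2) hb
  rw [abs_lt] at h2
  constructor
  · rw [← lt_div_iff₀ hs]; linarith
  · rw [← div_lt_iff₀ hs]; linarith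

lemma scaled_bias_le {D : Setup} {C₁ ηs e' : ℝ} (h : D.Standing) (hη : 0 < ηs)
    (hb : C₁ * ηs * (D.s * D.rate) ≤ e') {z : Fin D.p → Fin D.n → ℝ} (hz : D.IsScore z)
    {e : Fin D.n → ℝ} (he : e ∉ D.badL1 C₁) {j : Fin D.p} (hj : D.eta z j ≤ ηs) :
    |(D.tau z j)⁻¹ * (D.est z e j - D.β j) - (z j ⬝ᵥ e) / l2norm (z j)| ≤ D.sigStar e * e' := by
  have h1 := l1_lt_of_notMem he
  calc _ ≤ D.eta z j * l1norm (D.bInit e - D.β) := est_bias_le hz h.two_le_p e j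
    _ ≤ ηs * (C₁ * D.s * D.sigStar e * D.rate) :=
        mul_le_mul hj h1.le (l1norm_nonneg _) hη.le
    _ = D.sigStar e * (C₁ * ηs * (D.s * D.rate)) := by ring
    _ ≤ _ := mul_le_mul_of_nonneg_left hb (D.sigStar_nonneg e)

lemma abs_est_sub_le {D : Setup} {C₁ ηs e' : ℝ} (h : D.Standing) (hη : 0 < ηs)
    (hb : C₁ * ηs * (D.s * D.rate) ≤ e') {z : Fin D.p → Fin D.n → ℝ} (hz : D.IsScore z)
    {e : Fin D.n → ℝ} (he : e ∉ D.badL1 C₁) {j : Fin D.p} (hj : D.eta z j ≤ ηs) :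
    |D.est z e j - D.β j| ≤
      D.tau z j * (|(z j ⬝ᵥ e) / l2norm (z j)| + D.sigStar e * e') := by
  have h1 := scaled_bias_le h hη hb hz he hj
  have ht := tau_pos hz j
  have h2 : |(D.tau z j)⁻¹ * (D.est z e j - D.β j)| ≤
      |(z j ⬝ᵥ e) / l2norm (z j)| + D.sigStar e * e' := by
    have := abs_sub_abs_le_abs_sub ((D.tau z j)⁻¹ * (D.est z e j - D.β j))
      ((z j ⬝ᵥ e) / l2norm (z j))
    linarith
  rw [abs_mul, abs_of_pos (inv_pos.2 ht), inv_mul_le_iff₀ ht] at h2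
  exact h2

/-- Outside the two bad events, an error of the projection estimator beyond `τ_j σ̂ t` forces the
self-normalized noise beyond `(1 - ε'') t - ε'`. -/
lemma sphere_event_of_large_error {D : Setup} {C₁ C₂ ηs e' e'' t : ℝ} (h : D.Standing)
    (hC : 0 < C₁) (hη : 0 < ηs) (hb : C₁ * ηs * (D.s * D.rate) ≤ e') (he1 : e'' < 1)
    (hb2 : C₂ * D.s * D.rate ^ 2 ≤ e'') (ht : (1 + e') / (1 - e'') ≤ t)
    {z : Fin D.p → Fin D.n → ℝ} (hz : D.IsScore z)
    {e : Fin D.n → ℝ} (he : e ∉ D.badL1 C₁) (he2 : e ∉ D.badNoise C₂) {j : Fin D.p}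
    (hj : D.eta z j ≤ ηs) (hlarge : D.tau z j * D.sigHat e * t ≤ |D.est z e j - D.β j|) :
    ((1 - e'') * t - e') * D.sigStar e ≤ |(z j ⬝ᵥ e) / l2norm (z j)| := by
  have h1 := hlarge.trans (abs_est_sub_le h hη hb hz he hj)
  rw [mul_assoc, mul_le_mul_iff_right₀ (tau_pos hz j)] at h1
  have he' : 0 < e' := lt_of_lt_of_le (by have := h.s_pos; have := rate_pos h; positivity) hb
  have ht0 : 0 < t := lt_of_lt_of_le (div_pos (by linarith) (by linarith)) ht
  have h3 := mul_le_mul_of_nonneg_right (sigHat_bounds he he2 hb2).1.le ht0.le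
  nlinarith

lemma one_le_level {e' e'' t : ℝ} (he1 : e'' < 1) (ht : (1 + e') / (1 - e'') ≤ t) :
    1 ≤ (1 - e'') * t - e' := by
  rw [div_le_iff₀ (by linarith)] at ht; linarith

end Setup

lemma singleConclusion_of_controlled {C₁ C₂ : ℝ} {R : Setup → Prop} (hC₁ : 0 < C₁)
    (hR : ∀ D, R D → D.Controlled C₁ C₂) : SingleConclusion C₁ C₂ R := by
  intro D hD z hz ηs e' hη hb j hj
  have hc := hR D hD
  refine ⟨(measureReal_mono fun e he => ?_).trans hc.l1, ?_⟩
  · by_contra hne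
    exact absurd (Setup.scaled_bias_le hc.standing hη hb hz hne hj) (not_le.2 he)
  intro e'' he1 hb2 t ht
  have hu := Setup.one_le_level he1 ht
  have hsub : {e | D.tau z j * D.sigHat e * t ≤ |D.est z e j - D.β j|} ⊆
      {e | ((1 - e'') * t - e') * D.sigStar e ≤ |(z j ⬝ᵥ e) / l2norm (z j)|} ∪
        (D.badL1 C₁ ∪ D.badNoise C₂) := by
    intro e he
    by_cases h1 : e ∈ D.badL1 C₁
    · exact Or.inr (Or.inl h1)
    by_cases h2 : e ∈ D.badNoise C₂
    · exact Or.inr (Or.inr h2)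
    exact Or.inl (Setup.sphere_event_of_large_error hc.standing hC₁ hη hb he1 hb2 ht hz h1 h2 hj he)
  refine (measureReal_mono hsub).trans ((measureReal_union_le _ _).trans ?_)
  have h3 := D.noise_student hc.two_le_n hc.standing.sigma_pos (Setup.score_norm_pos hz j) hu
  have h4 := measureReal_union_le (μ := D.P) (D.badL1 C₁) (D.badNoise C₂)
  have h5 : D.P.real (D.badL1 C₁) ≤ D.ε := hc.l1
  have h6 : D.P.real (D.badNoise C₂) ≤ D.ε := hc.noise
  rw [show -((1 - e'') * t) + e' = -((1 - e'') * t - e') by ring]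
  linarith

lemma simultaneousConclusion_of_controlled {C₁ C₂ : ℝ} {R : Setup → Prop} (hC₁ : 0 < C₁)
    (hR : ∀ D, R D → D.Controlled C₁ C₂) : SimultaneousConclusion C₁ C₂ R := by
  classical
  intro D hD z hz ηs e' hη hb
  have hc := hR D hD
  refine ⟨(measureReal_mono fun e he => ?_).trans hc.l1, ?_⟩
  · obtain ⟨j, hj, he⟩ := he
    by_contra hne
    exact absurd (Setup.scaled_bias_le hc.standing hη hb hz hne hj) (not_le.2 he)
  intro e'' he1 hb2 t ht
  have hu := Setup.one_le_level he1 ht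
  set J : Finset (Fin D.p) := Finset.univ.filter fun j => D.eta z j ≤ ηs with hJ
  have hsub : {e | ∃ j, D.eta z j ≤ ηs ∧ D.tau z j * D.sigHat e * t < |D.est z e j - D.β j|} ⊆
      (⋃ j ∈ J, {e | ((1 - e'') * t - e') * D.sigStar e ≤ |(z j ⬝ᵥ e) / l2norm (z j)|}) ∪
        (D.badL1 C₁ ∪ D.badNoise C₂) := by
    rintro e ⟨j, hj, he⟩
    by_cases h1 : e ∈ D.badL1 C₁
    · exact Or.inr (Or.inl h1)
    by_cases h2 : e ∈ D.badNoise C₂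
    · exact Or.inr (Or.inr h2)
    refine Or.inl (Set.mem_iUnion₂.2 ⟨j, by simp [hJ, hj], ?_⟩)
    exact Setup.sphere_event_of_large_error hc.standing hC₁ hη hb he1 hb2 ht hz h1 h2 hj he.le
  refine (measureReal_mono hsub).trans ((measureReal_union_le _ _).trans ?_)
  have h3 : D.P.real (⋃ j ∈ J, {e | ((1 - e'') * t - e') * D.sigStar e ≤
      |(z j ⬝ᵥ e) / l2norm (z j)|}) ≤ 2 * studentCDF (D.n - 1) (-((1 - e'') * t - e')) * J.card := by
    refine (measureReal_biUnion_finset_le _ _).trans ((Finset.sum_le_card_nsmul _ _ _ fun j _ =>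
      D.noise_student hc.two_le_n hc.standing.sigma_pos (Setup.score_norm_pos hz j) hu).trans_eq ?_)
    rw [nsmul_eq_mul, mul_comm]
  have h4 := measureReal_union_le (μ := D.P) (D.badL1 C₁) (D.badNoise C₂)
  have h5 : D.P.real (D.badL1 C₁) ≤ D.ε := hc.l1
  have h6 : D.P.real (D.badNoise C₂) ≤ D.ε := hc.noise
  have hcard : Set.ncard {j | D.eta z j ≤ ηs} = J.card := by
    rw [← Set.ncard_coe_finset]; congr 1; ext j; simp [hJ]
  rw [show -((1 - e'') * t) + e' = -((1 - e'') * t - e') by ring, hcard]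
  linarith

namespace Setup

/-! ### Asymptotic coverage for sparse contrasts -/

/-- The direction `∑ a_j z_j / z_jᵀx_j`, whose inner product with the noise is the leading term of
the error of `aᵀβ̂`. -/
def contrastDir (D : Setup) (z : Fin D.p → Fin D.n → ℝ) (a : Fin D.p → ℝ) : Fin D.n → ℝ :=
  ∑ j, (a j / (z j ⬝ᵥ D.x j)) • z j

lemma l2norm_contrastDir {D : Setup} {z : Fin D.p → Fin D.n → ℝ} (hz : D.IsScore z)
    (a : Fin D.p → ℝ) : l2norm (D.contrastDir z a) = Real.sqrt (a ⬝ᵥ (D.V z *ᵥ a)) := by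
  have h : l2norm (D.contrastDir z a) ^ 2 = a ⬝ᵥ (D.V z *ᵥ a) := by
    have h1 : l2norm (D.contrastDir z a) ^ 2 = D.contrastDir z a ⬝ᵥ D.contrastDir z a := by
      rw [l2norm_sq, dotProduct]; exact Finset.sum_congr rfl fun i _ => by ring
    rw [h1]
    conv_lhs => enter [1]; rw [contrastDir]
    rw [sum_dotProduct, dotProduct]
    refine Finset.sum_congr rfl fun j _ => ?_
    have hV : (D.V z *ᵥ a) j = ∑ k, D.V z j k * a k := rfl
    rw [hV, contrastDir, smul_dotProduct, dotProduct_sum, Finset.smul_sum, Finset.mul_sum]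
    refine Finset.sum_congr rfl fun k _ => ?_
    rw [dotProduct_smul, V, abs_of_pos (hz j), abs_of_pos (hz k), smul_eq_mul, smul_eq_mul]
    have := (hz j).ne'
    have := (hz k).ne'
    field_simp
  rw [← h, Real.sqrt_sq (l2norm_nonneg _)]

lemma contrast_error_le {D : Setup} {C₁ ηs e' : ℝ} (h : D.Standing) (hη : 0 < ηs)
    (hb : C₁ * ηs * (D.s * D.rate) ≤ e') {z : Fin D.p → Fin D.n → ℝ} (hz : D.IsScore z)
    {e : Fin D.n → ℝ} (he : e ∉ D.badL1 C₁) {m : ℕ} {a : Fin D.p → ℝ}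
    (ha : a ∈ D.contrasts z m ηs) :
    |a ⬝ᵥ D.est z e - a ⬝ᵥ D.β - D.contrastDir z a ⬝ᵥ e| ≤
      m * e' * D.sigStar e * l2norm (D.contrastDir z a) := by
  obtain ⟨ha1, ha2, ha3⟩ := ha
  rw [← l2norm_contrastDir hz a] at ha3
  set w := l2norm (D.contrastDir z a) with hw
  have hw0 : 0 ≤ w := l2norm_nonneg _
  set l := l1norm (D.bInit e - D.β) with hl
  have hl0 : 0 ≤ l := l1norm_nonneg _
  have hs := sigStar_pos_of_notMem he
  have e1 : a ⬝ᵥ D.est z e - a ⬝ᵥ D.β - D.contrastDir z a ⬝ᵥ e =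
      ∑ j, a j * (D.est z e j - D.β j - (z j ⬝ᵥ e) / (z j ⬝ᵥ D.x j)) := by
    have h1 : a ⬝ᵥ D.est z e = ∑ j, a j * D.est z e j := rfl
    have h2 : a ⬝ᵥ D.β = ∑ j, a j * D.β j := rfl
    rw [contrastDir, sum_dotProduct, h1, h2, ← Finset.sum_sub_distrib, ← Finset.sum_sub_distrib]
    refine Finset.sum_congr rfl fun j _ => ?_
    rw [smul_dotProduct, smul_eq_mul]
    ring
  have hterm : ∀ j, |a j * (D.est z e j - D.β j - (z j ⬝ᵥ e) / (z j ⬝ᵥ D.x j))| ≤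
      if j ∈ supp a then ηs * w * l else 0 := by
    intro j
    split_ifs with hj
    · have h1 := est_bias_le hz h.two_le_p e j
      have ht := tau_pos hz j
      have e2 : D.est z e j - D.β j - (z j ⬝ᵥ e) / (z j ⬝ᵥ D.x j) = D.tau z j *
          ((D.tau z j)⁻¹ * (D.est z e j - D.β j) - (z j ⬝ᵥ e) / l2norm (z j)) := by
        rw [mul_sub, mul_inv_cancel_left₀ ht.ne', tau, abs_of_pos (hz j)]
        have := (score_norm_pos hz j).ne'
        field_simp
      rw [e2, abs_mul, abs_mul, abs_of_pos ht]
      calc _ ≤ |a j| * (D.tau z j * (D.eta z j * l)) := by gcongr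
        _ = |a j| * D.tau z j * D.eta z j * l := by ring
        _ ≤ _ := mul_le_mul_of_nonneg_right (ha3 j) hl0
    · have : a j = 0 := by simpa [supp] using hj
      simp [this]
  have hl1 := (l1_lt_of_notMem he).le
  calc _ ≤ ∑ j, |a j * (D.est z e j - D.β j - (z j ⬝ᵥ e) / (z j ⬝ᵥ D.x j))| := by
        rw [e1]; exact Finset.abs_sum_le_sum_abs _ _
    _ ≤ ∑ j, if j ∈ supp a then ηs * w * l else 0 := Finset.sum_le_sum fun j _ => hterm j
    _ = (supp a).card * (ηs * w * l) := by simp [Finset.sum_ite_mem]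
    _ ≤ m * (ηs * w * (C₁ * D.s * D.sigStar e * D.rate)) := by
        gcongr
    _ = m * (C₁ * ηs * (D.s * D.rate)) * D.sigStar e * w := by ring
    _ ≤ _ := by gcongr

lemma self_normalized_upper (D : Setup) (hn : 1 ≤ D.n) (hσ : 0 < D.σ) {v : Fin D.n → ℝ}
    (hv : 0 < l2norm v) {x δ : ℝ} (hx : 0 ≤ x) (hδ : 0 < δ) :
    D.P.real {e | |(v ⬝ᵥ e) / l2norm v| ≤ D.sigStar e * x} ≤
      2 * cdf (gaussianReal 0 1) ((1 + δ) * x) - 1 + chiBase ((1 + δ) ^ 2) ^ D.n := by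
  have hx' : 0 ≤ (1 + δ) * x := by positivity
  have h1 := D.noise_tail_eq hn hσ hv hx'
  have h2 := D.noise_level_upper hn hσ (b := 1 + δ) (by linarith)
  set A := {e | D.σ * ((1 + δ) * x) < |(v ⬝ᵥ e) / l2norm v|}
  have hA : MeasurableSet A :=
    measurableSet_lt measurable_const (by unfold dotProduct; fun_prop)
  have hsub : {e | |(v ⬝ᵥ e) / l2norm v| ≤ D.sigStar e * x} ⊆
      Aᶜ ∪ {e | (1 + δ) * D.σ ≤ D.sigStar e} := by
    intro e he
    by_cases h : (1 + δ) * D.σ ≤ D.sigStar e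
    · exact Or.inr h
    left
    have he' : |(v ⬝ᵥ e) / l2norm v| ≤ D.sigStar e * x := he
    change ¬ (D.σ * ((1 + δ) * x) < |(v ⬝ᵥ e) / l2norm v|)
    rw [not_lt]
    refine he'.trans ?_
    nlinarith [mul_le_mul_of_nonneg_right (not_le.1 h).le hx]
  refine (measureReal_mono hsub).trans ((measureReal_union_le _ _).trans ?_)
  rw [probReal_compl_eq_one_sub hA, h1]
  linarith

lemma self_normalized_lower (D : Setup) (hn : 1 ≤ D.n) (hσ : 0 < D.σ) {v : Fin D.n → ℝ}
    (hv : 0 < l2norm v) {x δ : ℝ} (hx : 0 ≤ x) (hδ : 0 < δ) (hδ1 : δ < 1) :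
    2 * cdf (gaussianReal 0 1) ((1 - δ) * x) - 1 - chiBase ((1 - δ) ^ 2) ^ D.n ≤
      D.P.real {e | |(v ⬝ᵥ e) / l2norm v| ≤ D.sigStar e * x} := by
  have hx' : 0 ≤ (1 - δ) * x := mul_nonneg (by linarith) hx
  have h1 := D.noise_tail_eq hn hσ hv hx'
  have h2 := D.noise_level_lower hn hσ (a := 1 - δ) (by linarith) (by linarith)
  have h3 := one_sub_measureReal_compl_le D.P {e | |(v ⬝ᵥ e) / l2norm v| ≤ D.sigStar e * x}
  have hsub : {e | |(v ⬝ᵥ e) / l2norm v| ≤ D.sigStar e * x}ᶜ ⊆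
      {e | D.σ * ((1 - δ) * x) < |(v ⬝ᵥ e) / l2norm v|} ∪
        {e | D.sigStar e ≤ (1 - δ) * D.σ} := by
    intro e he
    by_cases h : D.sigStar e ≤ (1 - δ) * D.σ
    · exact Or.inr h
    left
    have he' : D.sigStar e * x < |(v ⬝ᵥ e) / l2norm v| := not_le.1 he
    refine lt_of_le_of_lt ?_ he'
    nlinarith [mul_le_mul_of_nonneg_right (not_le.1 h).le hx]
  have h4 := (measureReal_mono (μ := D.P) hsub).trans (measureReal_union_le _ _)
  linarith

section Coverage

variable {D : Setup} {C₁ C₂ ηs e' e'' α : ℝ} {m : ℕ} {z : Fin D.p → Fin D.n → ℝ}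
  {a : Fin D.p → ℝ}

lemma coverage_le (hc : D.Controlled C₁ C₂) (hη : 0 < ηs)
    (hb : C₁ * ηs * (D.s * D.rate) ≤ e') (hb2 : C₂ * D.s * D.rate ^ 2 ≤ e'')
    (hz : D.IsScore z) (ha : a ∈ D.contrasts z m ηs) (hq : 0 ≤ normalQuantile (1 - α / 2)) :
    D.coverage z α a ≤ D.P.real {e | |(D.contrastDir z a ⬝ᵥ e) / l2norm (D.contrastDir z a)| ≤
      D.sigStar e * ((1 + e'') * normalQuantile (1 - α / 2) + m * e')} + 2 * D.ε := by
  set q := normalQuantile (1 - α / 2)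
  have hw : 0 < l2norm (D.contrastDir z a) := by
    rw [l2norm_contrastDir hz]; exact Real.sqrt_pos.2 ha.2.1
  have hsub : {e | |a ⬝ᵥ D.est z e - a ⬝ᵥ D.β| ≤
      D.sigHat e * q * Real.sqrt (a ⬝ᵥ (D.V z *ᵥ a))} ⊆
      {e | |(D.contrastDir z a ⬝ᵥ e) / l2norm (D.contrastDir z a)| ≤
        D.sigStar e * ((1 + e'') * q + m * e')} ∪ (D.badL1 C₁ ∪ D.badNoise C₂) := by
    intro e he
    by_cases h1 : e ∈ D.badL1 C₁
    · exact Or.inr (Or.inl h1)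
    by_cases h2 : e ∈ D.badNoise C₂
    · exact Or.inr (Or.inr h2)
    left
    have he' : |a ⬝ᵥ D.est z e - a ⬝ᵥ D.β| ≤
      D.sigHat e * q * Real.sqrt (a ⬝ᵥ (D.V z *ᵥ a)) := he
    rw [← l2norm_contrastDir hz] at he'
    have h3 := contrast_error_le hc.standing hη hb hz h1 ha
    have h4 := (sigHat_bounds h1 h2 hb2).2.le
    change |(D.contrastDir z a ⬝ᵥ e) / l2norm (D.contrastDir z a)| ≤ _
    rw [abs_div, abs_of_pos hw, div_le_iff₀ hw]
    have h5 : |D.contrastDir z a ⬝ᵥ e| ≤ |a ⬝ᵥ D.est z e - a ⬝ᵥ D.β| +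
        |a ⬝ᵥ D.est z e - a ⬝ᵥ D.β - D.contrastDir z a ⬝ᵥ e| := by
      have := abs_sub (a ⬝ᵥ D.est z e - a ⬝ᵥ D.β)
        (a ⬝ᵥ D.est z e - a ⬝ᵥ D.β - D.contrastDir z a ⬝ᵥ e)
      rwa [sub_sub_cancel] at this
    have h6 := mul_le_mul_of_nonneg_right h4 (mul_nonneg hq hw.le)
    nlinarith
  refine (measureReal_mono hsub).trans ((measureReal_union_le _ _).trans ?_)
  have h4 := measureReal_union_le (μ := D.P) (D.badL1 C₁) (D.badNoise C₂)
  have h5 : D.P.real (D.badL1 C₁) ≤ D.ε := hc.l1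
  have h6 : D.P.real (D.badNoise C₂) ≤ D.ε := hc.noise
  linarith

lemma le_coverage (hc : D.Controlled C₁ C₂) (hη : 0 < ηs)
    (hb : C₁ * ηs * (D.s * D.rate) ≤ e') (hb2 : C₂ * D.s * D.rate ^ 2 ≤ e'')
    (hz : D.IsScore z) (ha : a ∈ D.contrasts z m ηs) (hq : 0 ≤ normalQuantile (1 - α / 2)) :
    D.P.real {e | |(D.contrastDir z a ⬝ᵥ e) / l2norm (D.contrastDir z a)| ≤
      D.sigStar e * ((1 - e'') * normalQuantile (1 - α / 2) - m * e')} ≤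
      D.coverage z α a + 2 * D.ε := by
  set q := normalQuantile (1 - α / 2)
  have hw : 0 < l2norm (D.contrastDir z a) := by
    rw [l2norm_contrastDir hz]; exact Real.sqrt_pos.2 ha.2.1
  have hsub : {e | |(D.contrastDir z a ⬝ᵥ e) / l2norm (D.contrastDir z a)| ≤
        D.sigStar e * ((1 - e'') * q - m * e')} ⊆
      {e | |a ⬝ᵥ D.est z e - a ⬝ᵥ D.β| ≤
      D.sigHat e * q * Real.sqrt (a ⬝ᵥ (D.V z *ᵥ a))} ∪ (D.badL1 C₁ ∪ D.badNoise C₂) := by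
    intro e he
    by_cases h1 : e ∈ D.badL1 C₁
    · exact Or.inr (Or.inl h1)
    by_cases h2 : e ∈ D.badNoise C₂
    · exact Or.inr (Or.inr h2)
    left
    have he' : |(D.contrastDir z a ⬝ᵥ e) / l2norm (D.contrastDir z a)| ≤
        D.sigStar e * ((1 - e'') * q - m * e') := he
    rw [abs_div, abs_of_pos hw, div_le_iff₀ hw] at he'
    have h3 := contrast_error_le hc.standing hη hb hz h1 ha
    have h4 := (sigHat_bounds h1 h2 hb2).1.le
    change |a ⬝ᵥ D.est z e - a ⬝ᵥ D.β| ≤ D.sigHat e * q * Real.sqrt (a ⬝ᵥ (D.V z *ᵥ a))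
    rw [← l2norm_contrastDir hz]
    have h5 := abs_sub_abs_le_abs_sub (a ⬝ᵥ D.est z e - a ⬝ᵥ D.β) (D.contrastDir z a ⬝ᵥ e)
    have h6 := mul_le_mul_of_nonneg_right h4 (mul_nonneg hq hw.le)
    nlinarith
  refine (measureReal_mono hsub).trans ((measureReal_union_le _ _).trans ?_)
  have h4 := measureReal_union_le (μ := D.P) (D.badL1 C₁) (D.badNoise C₂)
  have h5 : D.P.real (D.badL1 C₁) ≤ D.ε := hc.l1
  have h6 : D.P.real (D.badNoise C₂) ≤ D.ε := hc.noise
  have h7 : D.coverage z α a = D.P.real {e | |a ⬝ᵥ D.est z e - a ⬝ᵥ D.β| ≤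
      D.sigHat e * q * Real.sqrt (a ⬝ᵥ (D.V z *ᵥ a))} := rfl
  linarith

end Coverage

end Setup

lemma tendsto_chiBase_pow {x : ℝ} (hx : 0 < x) (h1 : x ≠ 1) {n : ℕ → ℕ}
    (hn : Tendsto n atTop atTop) : Tendsto (fun k => chiBase x ^ n k) atTop (𝓝 0) :=
  (tendsto_pow_atTop_nhds_zero_of_lt_one (chiBase_pos hx).le (chiBase_lt_one hx h1)).comp hn

lemma coverageConclusion_of_controlled {C₁ C₂ : ℝ} {R : Setup → Prop}
    (hR : ∀ D, R D → D.Controlled C₁ C₂) : CoverageConclusion C₁ C₂ R := by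
  intro D z ηs e' e'' m α hD hz hη hb hb2 hn he' he'' hε hα0 hα1 hne
  set q := normalQuantile (1 - α / 2) with hq
  have hq0 : 0 < q := normalQuantile_pos (by linarith) (by linarith)
  set F := cdf (gaussianReal 0 1)
  have hFc : Continuous F := continuous_cdf_gaussian
  have hFq : 2 * F q - 1 = 1 - α := by
    have := cdf_normalQuantile (u := 1 - α / 2) (by linarith) (by linarith)
    rw [← hq] at this
    change F q = _ at this
    linarith
  have hxp : Tendsto (fun k => (1 + e'' k) * q + m * e' k) atTop (𝓝 q) := by
    simpa using (((tendsto_const_nhds (x := (1 : ℝ))).add he'').mul_const q).add (he'.const_mul (m : ℝ))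
  have hxm : Tendsto (fun k => (1 - e'' k) * q - m * e' k) atTop (𝓝 q) := by
    simpa using (((tendsto_const_nhds (x := (1 : ℝ))).sub he'').mul_const q).sub (he'.const_mul (m : ℝ))
  have hbdd : ∀ k, BddBelow (Set.range fun a : (D k).contrasts (z k) m (ηs k) =>
      (D k).coverage (z k) α a) := fun k => ⟨0, by
    rintro _ ⟨a, rfl⟩; exact measureReal_nonneg⟩
  rw [tendsto_order]
  constructor
  · intro l hl
    -- a radius `δ` for which the limit `2 F ((1 - δ) q) - 1` of the lower bound exceeds `l`
    have hcont : Tendsto (fun δ : ℝ => 2 * F ((1 - δ) * q) - 1) (𝓝[>] 0) (𝓝 (1 - α)) := by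
      have h : Continuous fun δ : ℝ => 2 * F ((1 - δ) * q) - 1 := by fun_prop
      have := h.tendsto 0
      simp only [sub_zero, one_mul, hFq] at this
      exact this.mono_left nhdsWithin_le_nhds
    obtain ⟨δ, hδl, hδ0, hδ1⟩ := ((hcont.eventually_const_lt hl).and
      (Ioo_mem_nhdsGT (show (0 : ℝ) < 1 by norm_num))).exists
    have hlim : Tendsto (fun k => 2 * F ((1 - δ) * ((1 - e'' k) * q - m * e' k)) - 1 -
        chiBase ((1 - δ) ^ 2) ^ (D k).n - 2 * (D k).ε) atTop
        (𝓝 (2 * F ((1 - δ) * q) - 1 - 0 - 2 * 0)) := by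
      refine (Tendsto.sub ?_ (tendsto_chiBase_pow (by nlinarith) (by nlinarith) hn)).sub
        (hε.const_mul 2)
      exact (((hFc.tendsto _).comp (hxm.const_mul (1 - δ))).const_mul 2).sub_const 1
    filter_upwards [hlim.eventually_const_lt (by simpa using hδl), hxm.eventually_const_lt hq0]
      with k hk hk0
    have hc := hR _ (hD k)
    have : Nonempty ((D k).contrasts (z k) m (ηs k)) := (hne k).to_subtype
    refine lt_of_lt_of_le hk (le_ciInf fun a => ?_)
    have h1 := Setup.le_coverage (α := α) hc (hη k) (hb k) (hb2 k) (hz k) a.2 hq0.le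
    have hw : 0 < l2norm ((D k).contrastDir (z k) a) := by
      rw [Setup.l2norm_contrastDir (hz k)]; exact Real.sqrt_pos.2 a.2.2.1
    have h2 := (D k).self_normalized_lower hc.standing.one_le_n hc.standing.sigma_pos hw
      hk0.le hδ0 hδ1
    change 2 * F _ - 1 - _ ≤ _ at h2
    linarith
  · intro u hu
    have hcont : Tendsto (fun δ : ℝ => 2 * F ((1 + δ) * q) - 1) (𝓝[>] 0) (𝓝 (1 - α)) := by
      have h : Continuous fun δ : ℝ => 2 * F ((1 + δ) * q) - 1 := by fun_prop
      have := h.tendsto 0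
      simp only [add_zero, one_mul, hFq] at this
      exact this.mono_left nhdsWithin_le_nhds
    obtain ⟨δ, hδu, hδ0⟩ := ((hcont.eventually_lt_const hu).and
      (self_mem_nhdsWithin : Set.Ioi (0:ℝ) ∈ 𝓝[>] 0)).exists
    have hδ0' : (0:ℝ) < δ := hδ0
    have hlim : Tendsto (fun k => 2 * F ((1 + δ) * ((1 + e'' k) * q + m * e' k)) - 1 +
        chiBase ((1 + δ) ^ 2) ^ (D k).n + 2 * (D k).ε) atTop
        (𝓝 (2 * F ((1 + δ) * q) - 1 + 0 + 2 * 0)) := by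
      refine (Tendsto.add ?_ (tendsto_chiBase_pow (by nlinarith) (by nlinarith) hn)).add
        (hε.const_mul 2)
      exact (((hFc.tendsto _).comp (hxp.const_mul (1 + δ))).const_mul 2).sub_const 1
    filter_upwards [hlim.eventually_lt_const (by simpa using hδu), hxp.eventually_const_lt hq0]
      with k hk hk0
    have hc := hR _ (hD k)
    obtain ⟨a, ha⟩ := hne k
    refine lt_of_le_of_lt ((ciInf_le (hbdd k) ⟨a, ha⟩).trans ?_) hk
    have h1 := Setup.coverage_le (α := α) hc (hη k) (hb k) (hb2 k) (hz k) ha hq0.le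
    have hw : 0 < l2norm ((D k).contrastDir (z k) a) := by
      rw [Setup.l2norm_contrastDir (hz k)]; exact Real.sqrt_pos.2 ha.2.1
    have h2 := (D k).self_normalized_upper hc.standing.one_le_n hc.standing.sigma_pos hw
      hk0.le hδ0'
    change _ ≤ 2 * F _ - 1 + _ at h2
    change (D k).coverage (z k) α a ≤ _
    linarith

/-! ### Asymptotic familywise coverage -/

namespace Setup

/-- The probability that the noise in some direction `z_j` exceeds `σ t` or `σ* (t + c / 2)`. -/
lemma familywise_failure_le {D : Setup} {C₁ C₂ ηs e' e'' c t : ℝ} (hc : D.Controlled C₁ C₂)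
    (hη : 0 < ηs) (hb : C₁ * ηs * (D.s * D.rate) ≤ e')
    (hb2 : C₂ * D.s * D.rate ^ 2 ≤ e'') {z : Fin D.p → Fin D.n → ℝ} (hz : D.IsScore z)
    (hz2 : ∀ j, D.eta z j ≤ ηs) (ht : 0 ≤ t) (hc0 : 0 < c) (he' : e' ≤ c / 4)
    (he'' : e'' * (c + t) ≤ c / 4) :
    D.P.real {e | ∀ j, |D.est z e j - D.β j| ≤ D.tau z j * min (D.sigHat e) D.σ * (c + t)}ᶜ ≤
      D.p * Real.exp (-t ^ 2 / 2) +
      D.p * Real.exp (-(((D.n : ℝ) - 1) * (t + c / 2) ^ 2 / (2 * D.n))) +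
      chiBase (2 ^ 2) ^ D.n + 2 * D.ε := by
  have hs := hc.standing
  have hsub : {e | ∀ j, |D.est z e j - D.β j| ≤
      D.tau z j * min (D.sigHat e) D.σ * (c + t)}ᶜ ⊆
      (⋃ j ∈ Finset.univ, {e | D.σ * t ≤ |(z j ⬝ᵥ e) / l2norm (z j)|}) ∪
      ((⋃ j ∈ Finset.univ, {e | (t + c / 2) * D.sigStar e ≤ |(z j ⬝ᵥ e) / l2norm (z j)|}) ∪
      ({e | 2 * D.σ ≤ D.sigStar e} ∪ (D.badL1 C₁ ∪ D.badNoise C₂))) := by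
    intro e he
    by_contra hne
    simp only [Set.mem_union, Set.mem_iUnion, not_or, not_exists, Finset.mem_univ, true_and,
      Set.mem_ofPred_eq, not_le, exists_prop] at hne
    obtain ⟨hA, hB, hS, h1, h2⟩ := hne
    refine he fun j => ?_
    have h3 := abs_est_sub_le hs hη hb hz h1 (hz2 j)
    refine h3.trans ?_
    rw [mul_assoc]
    refine mul_le_mul_of_nonneg_left ?_ (tau_pos hz j).le
    have hσs := sigStar_pos_of_notMem h1
    have hh := (sigHat_bounds h1 h2 hb2).1.le
    rcases min_choice (D.sigHat e) D.σ with hm | hm <;> rw [hm]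
    · nlinarith [hB j, mul_le_mul_of_nonneg_left he' hσs.le,
        mul_le_mul_of_nonneg_left he'' hσs.le,
        mul_le_mul_of_nonneg_right hh (show 0 ≤ c + t by linarith)]
    · nlinarith [hA j, mul_le_mul_of_nonneg_left he' hσs.le]
  have hU1 : D.P.real (⋃ j ∈ Finset.univ, {e | D.σ * t ≤ |(z j ⬝ᵥ e) / l2norm (z j)|}) ≤
      D.p * Real.exp (-t ^ 2 / 2) := by
    refine (measureReal_biUnion_finset_le _ _).trans ((Finset.sum_le_card_nsmul _ _ _ fun j _ =>
      D.noise_tail hs.one_le_n hs.sigma_pos (score_norm_pos hz j) ht).trans_eq ?_)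
    simp
  have hU2 : D.P.real (⋃ j ∈ Finset.univ,
      {e | (t + c / 2) * D.sigStar e ≤ |(z j ⬝ᵥ e) / l2norm (z j)|}) ≤
      D.p * Real.exp (-(((D.n : ℝ) - 1) * (t + c / 2) ^ 2 / (2 * D.n))) := by
    refine (measureReal_biUnion_finset_le _ _).trans ((Finset.sum_le_card_nsmul _ _ _ fun j _ =>
      D.noise_sphere_tail hs.one_le_n hs.sigma_pos (score_norm_pos hz j)
        (by positivity)).trans_eq ?_)
    simp
  have hU3 := D.noise_level_upper hs.one_le_n hs.sigma_pos (b := 2) one_lt_two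
  have h4 := measureReal_union_le (μ := D.P) (D.badL1 C₁) (D.badNoise C₂)
  have h5 : D.P.real (D.badL1 C₁) ≤ D.ε := hc.l1
  have h6 : D.P.real (D.badNoise C₂) ≤ D.ε := hc.noise
  have h7 := measureReal_union_le (μ := D.P) {e | 2 * D.σ ≤ D.sigStar e}
    (D.badL1 C₁ ∪ D.badNoise C₂)
  have h8 := measureReal_union_le (μ := D.P) (⋃ j ∈ Finset.univ,
      {e | (t + c / 2) * D.sigStar e ≤ |(z j ⬝ᵥ e) / l2norm (z j)|})
    ({e | 2 * D.σ ≤ D.sigStar e} ∪ (D.badL1 C₁ ∪ D.badNoise C₂))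
  have h9 := (measureReal_mono (μ := D.P) hsub).trans (measureReal_union_le _ _)
  refine h9.trans ((add_le_add hU1 (h8.trans (add_le_add hU2 (h7.trans (add_le_add hU3
    (h4.trans (add_le_add h5 h6))))))).trans_eq ?_)
  ring

/-- Since `log p` is at most of order `n`, replacing the exponent `(n - 1) / n` by `1` costs only a
constant factor. -/
lemma familywise_tail_le {D : Setup} {C₁ C₂ α c : ℝ} (hc : D.Controlled C₁ C₂) (hα0 : 0 < α)
    (hα1 : α < 1) (hc0 : 0 < c) :
    D.p * Real.exp (-(((D.n : ℝ) - 1) * (Real.sqrt (2 * Real.log (D.p / α)) + c / 2) ^ 2 /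
        (2 * D.n))) ≤
      Real.exp (1 + 2 * Real.log (1 / α) + c ^ 2 / 4) *
        Real.exp (-(c / 2 * Real.sqrt (2 * Real.log (D.p / α)))) := by
  have hs := hc.standing
  set t := Real.sqrt (2 * Real.log (D.p / α)) with ht
  have ht0 : 0 ≤ t := Real.sqrt_nonneg _
  have hp2 : (2 : ℝ) ≤ D.p := by exact_mod_cast hs.two_le_p
  have hn : (0 : ℝ) < D.n := by exact_mod_cast hs.one_le_n
  have hn1 : (1 : ℝ) ≤ D.n := by exact_mod_cast hs.one_le_n
  have hlp : 0 ≤ Real.log D.p := Real.log_nonneg (by linarith)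
  have hla : 0 ≤ Real.log (1 / α) := Real.log_nonneg (by rw [le_div_iff₀ hα0]; linarith)
  have hlog : Real.log (D.p / α) = Real.log D.p + Real.log (1 / α) := by
    rw [← Real.log_mul (by positivity) (by positivity)]; congr 1; ring
  have ht2 : t ^ 2 = 2 * (Real.log D.p + Real.log (1 / α)) := by
    rw [ht, hlog]; exact Real.sq_sqrt (by linarith)
  have hlpn : 2 * Real.log D.p ≤ D.n := by
    have h1 := hc.rate_sq_le
    rw [rate_sq hs, div_mul_eq_mul_div, div_le_one hn] at h1
    have : Real.log D.p ≤ Real.log (D.p / D.ε) := by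
      refine Real.log_le_log (by linarith) ?_
      rw [le_div_iff₀ hs.eps_pos]; nlinarith [hs.eps_le_one]
    linarith
  have hpexp : (D.p : ℝ) = Real.exp (Real.log D.p) := (Real.exp_log (by linarith)).symm
  rw [← Real.exp_add]
  nth_rw 1 [hpexp]
  rw [← Real.exp_add, Real.exp_le_exp]
  have e1 : ((D.n : ℝ) - 1) * (t + c / 2) ^ 2 / (2 * D.n) =
      (t + c / 2) ^ 2 / 2 - (t + c / 2) ^ 2 / (2 * D.n) := by field_simp
  have e2 : (t + c / 2) ^ 2 / (2 * D.n) ≤ 1 + 2 * Real.log (1 / α) + c ^ 2 / 4 := by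
    rw [div_le_iff₀ (by positivity)]
    have h1 : (t + c / 2) ^ 2 ≤ 2 * t ^ 2 + c ^ 2 / 2 := by nlinarith [sq_nonneg (t - c / 2)]
    rw [ht2] at h1
    nlinarith [mul_nonneg hla (show (0:ℝ) ≤ D.n - 1 by linarith),
      mul_nonneg (sq_nonneg c) (show (0:ℝ) ≤ D.n - 1 by linarith)]
  rw [e1]
  nlinarith [sq_nonneg c]

end Setup

lemma familywiseConclusion_of_controlled {C₁ C₂ : ℝ} {R : Setup → Prop} (hC₂ : 0 < C₂)
    (hR : ∀ D, R D → D.Controlled C₁ C₂) : FamilywiseConclusion C₁ C₂ R := by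
  intro D z ηs e' e'' α c hD hz hη hb hb2 hz2 hn hp he' hε he'' hα0 hα1 hc0
  set t : ℕ → ℝ := fun k => Real.sqrt (2 * Real.log ((D k).p / α)) with ht
  have hpr : Tendsto (fun k => ((D k).p : ℝ)) atTop atTop := tendsto_natCast_atTop_atTop.comp hp
  have htt : Tendsto t atTop atTop := by
    refine Real.tendsto_sqrt_atTop.comp (Tendsto.const_mul_atTop two_pos ?_)
    exact Real.tendsto_log_atTop.comp (hpr.atTop_div_const hα0)
  have hla : 0 ≤ Real.log (1 / α) := Real.log_nonneg (by rw [le_div_iff₀ hα0]; linarith)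
  -- the level `c + t` is of order `√(log p)`
  have hct : ∀ k, e'' k * (c + t k) ≤ (e'' k * Real.sqrt (Real.log (D k).p)) *
      ((c + Real.sqrt (2 * Real.log (1 / α))) / Real.sqrt (Real.log 2) + Real.sqrt 2) := by
    intro k
    have hs := (hR _ (hD k)).standing
    have hp2 : (2 : ℝ) ≤ (D k).p := by exact_mod_cast hs.two_le_p
    have he0 : 0 ≤ e'' k := le_trans (by have := hs.s_pos; positivity) (hb2 k)
    have hl2 : 0 < Real.log 2 := Real.log_pos one_lt_two
    have hlp : Real.log 2 ≤ Real.log (D k).p := Real.log_le_log two_pos hp2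
    rw [mul_assoc]
    refine mul_le_mul_of_nonneg_left ?_ he0
    have h1 : t k ≤ Real.sqrt 2 * Real.sqrt (Real.log (D k).p) +
        Real.sqrt (2 * Real.log (1 / α)) := by
      have hlog : 2 * Real.log ((D k).p / α) =
          2 * Real.log (D k).p + 2 * Real.log (1 / α) := by
        rw [← mul_add, ← Real.log_mul (by positivity) (by positivity)]; congr 2; ring
      simp only [ht]
      rw [hlog, ← Real.sqrt_mul two_pos.le]
      have hp0 : 0 ≤ 2 * Real.log (D k).p := by linarith
      have ha0 : 0 ≤ 2 * Real.log (1 / α) := by linarith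
      refine Real.sqrt_le_iff.2 ⟨by positivity, ?_⟩
      nlinarith [Real.sq_sqrt hp0, Real.sq_sqrt ha0,
        mul_nonneg (Real.sqrt_nonneg (2 * Real.log (D k).p))
          (Real.sqrt_nonneg (2 * Real.log (1 / α)))]
    have h2 : c + Real.sqrt (2 * Real.log (1 / α)) ≤ Real.sqrt (Real.log (D k).p) *
        ((c + Real.sqrt (2 * Real.log (1 / α))) / Real.sqrt (Real.log 2)) := by
      rw [← mul_div_assoc, le_div_iff₀ (Real.sqrt_pos.2 hl2), mul_comm]
      exact mul_le_mul_of_nonneg_right (Real.sqrt_le_sqrt hlp) (by positivity)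
    nlinarith
  have hct0 := he''.mul_const
    ((c + Real.sqrt (2 * Real.log (1 / α))) / Real.sqrt (Real.log 2) + Real.sqrt 2)
  rw [zero_mul] at hct0
  set g : ℕ → ℝ := fun k => 1 - (α + Real.exp (1 + 2 * Real.log (1 / α) + c ^ 2 / 4) *
    Real.exp (-(c / 2 * t k)) + chiBase (2 ^ 2) ^ (D k).n + 2 * (D k).ε) with hg
  have hglim : Tendsto g atTop (𝓝 (1 - α)) := by
    have h1 : Tendsto (fun k => Real.exp (-(c / 2 * t k))) atTop (𝓝 0) :=
      Real.tendsto_exp_neg_atTop_nhds_zero.comp (htt.const_mul_atTop (by positivity))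
    have h2 := tendsto_chiBase_pow (x := 2 ^ 2) (by norm_num) (by norm_num) hn
    have := ((((h1.const_mul (Real.exp (1 + 2 * Real.log (1 / α) + c ^ 2 / 4))).const_add α).add
      h2).add (hε.const_mul 2)).const_sub 1
    simp only [mul_zero, add_zero] at this
    exact this
  have hle : ∀ᶠ k in atTop, g k ≤ (D k).P.real
      {e | ∀ j, |(D k).est (z k) e j - (D k).β j| ≤
        (D k).tau (z k) j * min ((D k).sigHat e) (D k).σ * (c + t k)} := by
    filter_upwards [he'.eventually_lt_const (show 0 < c / 4 by positivity),
      hct0.eventually_lt_const (show 0 < c / 4 by positivity)] with k hk1 hk2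
    have hc := hR _ (hD k)
    have hs := hc.standing
    have hp2 : (2 : ℝ) ≤ (D k).p := by exact_mod_cast hs.two_le_p
    have h1 := Setup.familywise_failure_le hc (hη k) (hb k) (hb2 k) (hz k) (hz2 k)
      (Real.sqrt_nonneg (2 * Real.log ((D k).p / α))) hc0 hk1.le ((hct k).trans hk2.le)
    have h2 := Setup.familywise_tail_le hc hα0 hα1 hc0
    have h3 : (D k).p * Real.exp (-(Real.sqrt (2 * Real.log ((D k).p / α))) ^ 2 / 2) = α := by
      have hpos : (0:ℝ) < (D k).p / α := by positivity
      rw [Real.sq_sqrt]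
      · rw [show -(2 * Real.log ((D k).p / α)) / 2 = -Real.log ((D k).p / α) by ring,
          Real.exp_neg, Real.exp_log hpos]
        field_simp
      · refine mul_nonneg two_pos.le (Real.log_nonneg ?_)
        rw [le_div_iff₀ hα0]; linarith
    have h4 := one_sub_measureReal_compl_le (D k).P
      {e | ∀ j, |(D k).est (z k) e j - (D k).β j| ≤
        (D k).tau (z k) j * min ((D k).sigHat e) (D k).σ * (c + t k)}
    simp only [hg, ht] at h4 ⊢
    linarith
  rw [← hglim.liminf_eq]
  refine liminf_le_liminf hle hglim.isBoundedUnder_ge ?_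
  refine Filter.IsCoboundedUnder.of_frequently_le (a := 1) ?_
  exact Frequently.of_forall fun k => measureReal_le_one

/-! ### Soft thresholding with random thresholds -/

/-- Soft thresholding of `y` at the level `lam`. -/
def soft (y lam : ℝ) : ℝ := Real.sign y * max (|y| - lam) 0

lemma soft_mul {k : ℝ} (hk : 0 < k) (y lam : ℝ) : soft (k * y) (k * lam) = k * soft y lam := by
  have h1 : Real.sign (k * y) = Real.sign y := by
    rcases lt_trichotomy y 0 with h | h | h
    · rw [Real.sign_of_neg h, Real.sign_of_neg (mul_neg_of_pos_of_neg hk h)]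
    · rw [h, mul_zero]
    · rw [Real.sign_of_pos h, Real.sign_of_pos (mul_pos hk h)]
  have h2 : max (|k * y| - k * lam) 0 = k * max (|y| - lam) 0 := by
    rw [abs_mul, abs_of_pos hk, ← mul_sub, mul_max_of_nonneg _ _ hk.le, mul_zero]
  rw [soft, soft, h1, h2]; ring

lemma soft_neg (y lam : ℝ) : soft (-y) lam = -soft y lam := by
  rw [soft, soft, abs_neg, Real.sign_neg]; ring

/-- The three branches of soft thresholding of `b + N + Δ` at `lam`, in terms of an effective
threshold `μ` between `lam - |Δ|` and `lam + |Δ|` applied to `b + N`. -/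
lemma soft_cases {b N Δ lam l u : ℝ} (hl : l + |Δ| ≤ lam) (hu : lam + |Δ| ≤ u) (h0 : 0 ≤ l) :
    (∃ μ, l ≤ μ ∧ μ ≤ u ∧ 0 < b + N - μ ∧ soft (b + N + Δ) lam = b + N - μ) ∨
    (∃ μ, l ≤ μ ∧ μ ≤ u ∧ b + N + μ < 0 ∧ soft (b + N + Δ) lam = b + N + μ) ∨
    (soft (b + N + Δ) lam = 0 ∧ b + N ≤ u ∧ -u ≤ b + N) := by
  have h1 := le_abs_self Δ
  have h2 := neg_abs_le Δ
  have hlam : 0 ≤ lam := by linarith [abs_nonneg Δ]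
  rcases lt_or_ge lam (b + N + Δ) with h | h
  · left
    refine ⟨lam - Δ, by linarith, by linarith, by linarith, ?_⟩
    rw [soft, Real.sign_of_pos (by linarith), abs_of_pos (by linarith),
      max_eq_left (by linarith)]; ring
  rcases lt_or_ge (b + N + Δ) (-lam) with h' | h'
  · right; left
    refine ⟨lam + Δ, by linarith, by linarith, by linarith, ?_⟩
    rw [soft, Real.sign_of_neg (by linarith), abs_of_neg (by linarith),
      max_eq_left (by linarith)]; ring
  · right; right
    refine ⟨?_, by linarith, by linarith⟩
    rw [soft, max_eq_right (by linarith [abs_le.2 ⟨h', h⟩]), mul_zero]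

lemma soft_sub_sq_le_small {b N Δ lam l u : ℝ} (hl : l + |Δ| ≤ lam) (hu : lam + |Δ| ≤ u)
    (h0 : 0 ≤ l) (hb : 0 ≤ b) :
    (soft (b + N + Δ) lam - b) ^ 2 ≤ b ^ 2 + max (|N| - l) 0 ^ 2 := by
  have hm0 : 0 ≤ max (|N| - l) 0 := le_max_right _ _
  have hm1 : |N| - l ≤ max (|N| - l) 0 := le_max_left _ _
  have hN1 := le_abs_self N
  have hN2 := neg_le_abs N
  rcases soft_cases (b := b) (N := N) hl hu h0 with ⟨μ, h1, h2, h3, h4⟩ | ⟨μ, h1, h2, h3, h4⟩ | ⟨h4, h2, h3⟩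
  · rw [h4]
    rcases le_or_gt μ N with h | h
    · nlinarith [sq_nonneg b]
    · nlinarith [sq_nonneg (max (|N| - l) 0)]
  · rw [h4]
    nlinarith [sq_nonneg b]
  · rw [h4]
    nlinarith [sq_nonneg (max (|N| - l) 0)]

/-- For fixed noise, the squared error as a function of the effective threshold is largest at one
of the ends `l`, `u` of its range. -/
lemma soft_sub_sq_le_large {b N Δ lam l u : ℝ} (hl : l + |Δ| ≤ lam) (hu : lam + |Δ| ≤ u)
    (h0 : 0 ≤ l) (hb : 0 ≤ b) :
    (soft (b + N + Δ) lam - b) ^ 2 ≤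
      (N - u) ^ 2 + 2 * (u - l) * max (N - (l + u) / 2) 0 := by
  have hlu : l ≤ u := by linarith [abs_nonneg Δ]
  have hm0 : 0 ≤ max (N - (l + u) / 2) 0 := le_max_right _ _
  have hm1 : N - (l + u) / 2 ≤ max (N - (l + u) / 2) 0 := le_max_left _ _
  have hm : 0 ≤ (u - l) * max (N - (l + u) / 2) 0 := mul_nonneg (by linarith) hm0
  rcases soft_cases (b := b) (N := N) hl hu h0 with ⟨μ, h1, h2, h3, h4⟩ | ⟨μ, h1, h2, h3, h4⟩ | ⟨h4, h2, h3⟩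
  · rw [h4]
    -- `(N - μ)² - (N - u)² = (u - μ) (2 N - μ - u)`
    have e : (u - μ) * (2 * N - μ - u) ≤ 2 * (u - l) * max (N - (l + u) / 2) 0 := by
      rcases le_or_gt (2 * N - μ - u) 0 with h | h
      · nlinarith [mul_nonneg (show 0 ≤ u - μ by linarith) (neg_nonneg.2 h)]
      · have : 2 * N - μ - u ≤ 2 * max (N - (l + u) / 2) 0 := by linarith
        calc (u - μ) * (2 * N - μ - u) ≤ (u - l) * (2 * max (N - (l + u) / 2) 0) :=
              mul_le_mul (by linarith) this h.le (by linarith)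
          _ = _ := by ring
    nlinarith
  · rw [h4]; nlinarith
  · rw [h4]; nlinarith

lemma normalDensity_anti {a b : ℝ} (ha : 0 ≤ a) (h : a ≤ b) :
    normalDensity b ≤ normalDensity a := by
  rw [normalDensity, normalDensity, gaussianPDFReal_std, gaussianPDFReal_std]
  gcongr

lemma exists_soft_envelope_of_nonneg {b L c : ℝ} (hb : 0 ≤ b) (hL : 0 < L) (hc : 0 < c) :
    ∃ h : ℝ → ℝ, Measurable h ∧ (∀ N, 0 ≤ h N) ∧
      (∀ N Δ lam, L + |Δ| ≤ lam → lam + |Δ| ≤ (1 + 2 * c) * L →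
        (soft (b + N + Δ) lam - b) ^ 2 ≤ h N) ∧
      ∫⁻ g, ENNReal.ofReal (h g) ∂(gaussianReal 0 1) ≤
        ENNReal.ofReal (min (b ^ 2) (L ^ 2 * (1 + 2 * c) ^ 2 + 1) +
          normalDensity L * (4 / L ^ 3 + 4 * c / L)) := by
  have hφ := normalDensity_nonneg L
  rcases le_total (b ^ 2) (L ^ 2 * (1 + 2 * c) ^ 2 + 1) with hmin | hmin
  · refine ⟨fun N => b ^ 2 + max (|N| - L) 0 ^ 2, by fun_prop, fun N => by positivity,
      fun N Δ lam h1 h2 => soft_sub_sq_le_small h1 h2 hL.le hb, ?_⟩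
    rw [min_eq_left hmin]
    have : ∀ g : ℝ, ENNReal.ofReal (b ^ 2 + max (|g| - L) 0 ^ 2) =
        ENNReal.ofReal (b ^ 2) + ENNReal.ofReal (max (|g| - L) 0 ^ 2) := fun g =>
      ENNReal.ofReal_add (sq_nonneg _) (sq_nonneg _)
    simp only [this]
    rw [lintegral_add_left measurable_const, lintegral_const, measure_univ, mul_one]
    refine (add_le_add le_rfl (lintegral_gaussian_abs_excess_sq hL)).trans ?_
    rw [← ENNReal.ofReal_add (sq_nonneg _) (by positivity)]
    refine ENNReal.ofReal_le_ofReal ?_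
    have : 0 ≤ normalDensity L * (4 * c / L) := by positivity
    nlinarith
  · set u := (1 + 2 * c) * L with hu
    set a := (L + u) / 2 with ha
    have haL : L ≤ a := by rw [ha, hu]; nlinarith
    have hLu : 0 ≤ 2 * (u - L) := by rw [hu]; nlinarith
    refine ⟨fun N => (N - u) ^ 2 + 2 * (u - L) * max (N - a) 0, by fun_prop, fun N => ?_,
      fun N Δ lam h1 h2 => soft_sub_sq_le_large h1 h2 hL.le hb, ?_⟩
    · have := le_max_right (N - a) 0; positivity
    rw [min_eq_right hmin]
    have : ∀ g : ℝ, ENNReal.ofReal ((g - u) ^ 2 + 2 * (u - L) * max (g - a) 0) =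
        ENNReal.ofReal ((g - u) ^ 2) +
          ENNReal.ofReal (2 * (u - L)) * ENNReal.ofReal (max (g - a) 0 ^ 1) := fun g => by
      rw [ENNReal.ofReal_add (sq_nonneg _) (mul_nonneg hLu (le_max_right _ _)),
        ENNReal.ofReal_mul hLu, pow_one]
    simp only [this]
    rw [lintegral_add_left (by fun_prop), lintegral_gaussian_sub_sq,
      lintegral_const_mul _ (by fun_prop)]
    refine (add_le_add le_rfl (mul_le_mul' le_rfl
      (lintegral_gaussian_pos_part_pow one_ne_zero (hL.trans_le haL)))).trans ?_
    have hφa := normalDensity_nonneg a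
    have ha0 : 0 < a := hL.trans_le haL
    rw [← ENNReal.ofReal_mul hLu, ← ENNReal.ofReal_add (by positivity) (by positivity)]
    refine ENNReal.ofReal_le_ofReal ?_
    have h1 : normalDensity a * (1 / a ^ 2) ≤ normalDensity L * (1 / L ^ 2) := by
      refine mul_le_mul (normalDensity_anti hL.le haL) ?_ (by positivity) hφ
      gcongr
    have h2 : 2 * (u - L) * (normalDensity L * (1 / L ^ 2)) = normalDensity L * (4 * c / L) := by
      rw [hu]; field_simp; ring
    have h3 := mul_le_mul_of_nonneg_left h1 hLu
    have h4 : 0 ≤ normalDensity L * (4 / L ^ 3) := by positivity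
    have h5 : (Nat.factorial 1 : ℝ) / a ^ (1 + 1) = 1 / a ^ 2 := by norm_num
    rw [h5, mul_add]
    have h6 : u ^ 2 = L ^ 2 * (1 + 2 * c) ^ 2 := by rw [hu]; ring
    linarith

/-- An integrable envelope for the squared error of soft thresholding of `b + N + Δ` with `N`
standard normal, valid for all thresholds `lam` and perturbations `Δ` such that
`[lam - |Δ|, lam + |Δ|]` lies in `[L, (1 + 2c) L]`. -/
lemma exists_soft_envelope (b : ℝ) {L c : ℝ} (hL : 0 < L) (hc : 0 < c) :
    ∃ h : ℝ → ℝ, Measurable h ∧ (∀ N, 0 ≤ h N) ∧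
      (∀ N Δ lam, L + |Δ| ≤ lam → lam + |Δ| ≤ (1 + 2 * c) * L →
        (soft (b + N + Δ) lam - b) ^ 2 ≤ h N) ∧
      ∫⁻ g, ENNReal.ofReal (h g) ∂(gaussianReal 0 1) ≤
        ENNReal.ofReal (min (b ^ 2) (L ^ 2 * (1 + 2 * c) ^ 2 + 1) +
          normalDensity L * (4 / L ^ 3 + 4 * c / L)) := by
  rcases le_total 0 b with hb | hb
  · exact exists_soft_envelope_of_nonneg hb hL hc
  · obtain ⟨h, hm, h0, hh, hi⟩ := exists_soft_envelope_of_nonneg (neg_nonneg.2 hb) hL hc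
    refine ⟨fun N => h (-N), hm.comp measurable_neg, fun N => h0 _, fun N Δ lam h1 h2 => ?_, ?_⟩
    · have := hh (-N) (-Δ) lam (by rwa [abs_neg]) (by rwa [abs_neg])
      rw [show -b + -N + -Δ = -(b + N + Δ) by ring, soft_neg] at this
      linarith [show (-soft (b + N + Δ) lam - -b) ^ 2 = (soft (b + N + Δ) lam - b) ^ 2 by ring]
    · rw [neg_sq] at hi
      refine le_trans (le_of_eq ?_) hi
      exact measurePreserving_neg_gaussian.lintegral_comp (f := fun g => ENNReal.ofReal (h g))
        (by fun_prop)

namespace Setup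

/-! ### Thresholding the projection estimator -/

/-- The calibration inequality with the denominators cleared: it bounds the threshold from both
sides, `σ + ε' σ* ≤ (1 + c) σ̂` and `(1 + c) σ̂ + ε' σ* ≤ (1 + 2c) σ`. -/
lemma threshold_bounds {H σ S e' c : ℝ} (hH : 0 < H) (hσ : 0 < σ) (hc : 0 < c)
    (h : max (H / σ) (σ / H) - 1 + e' * S / min H σ ≤ c * (1 - max (H / σ - 1) 0)) :
    σ + e' * S ≤ (1 + c) * H ∧ (1 + c) * H + e' * S ≤ (1 + 2 * c) * σ := by
  rcases le_total H σ with hle | hle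
  · have h1 : H / σ ≤ σ / H :=
      ((div_le_one hσ).2 hle).trans ((one_le_div hH).2 hle)
    rw [max_eq_right h1, min_eq_left hle,
      max_eq_right (by linarith [(div_le_one hσ).2 hle])] at h
    have h2 : (σ + e' * S) / H ≤ 1 + c := by rw [add_div]; linarith
    rw [div_le_iff₀ hH] at h2
    exact ⟨h2, by nlinarith⟩
  · have h1 : σ / H ≤ H / σ :=
      ((div_le_one hH).2 hle).trans ((one_le_div hσ).2 hle)
    rw [max_eq_left h1, min_eq_right hle,
      max_eq_left (by linarith [(one_le_div hσ).2 hle])] at h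
    have h2 : ((1 + c) * H + e' * S) / σ ≤ 1 + 2 * c := by
      rw [add_div, mul_div_assoc]; linarith
    rw [div_le_iff₀ hσ] at h2
    exact ⟨by nlinarith, h2⟩

lemma calibration_of_bounds {H σ S e' e'' e3 c : ℝ} (hσ : 0 < σ) (he' : 0 ≤ e')
    (he0 : 0 ≤ e'') (h3 : e3 < 1) (hle : e'' ≤ e3) (hS : 0 < S)
    (hc : (e3 + e') / (1 - e3) ^ 2 ≤ c)
    (hH1 : (1 - e'') * S < H) (hH2 : H < (1 + e'') * S)
    (hS1 : (1 - e3) / (1 - e'') ≤ S / σ) (hS2 : S / σ ≤ (1 + e3) / (1 + e'')) :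
    0 < H ∧ max (H / σ) (σ / H) - 1 + e' * S / min H σ ≤ c * (1 - max (H / σ - 1) 0) := by
  have hd : 0 < 1 - e3 := by linarith
  rw [div_le_div_iff₀ (by linarith) hσ] at hS1
  rw [div_le_div_iff₀ hσ (by linarith)] at hS2
  have a1 : (1 - e3) * σ < H := by nlinarith
  have a2 : H < (1 + e3) * σ := by nlinarith
  have hH : 0 < H := lt_trans (by positivity) a1
  have hc0 : 0 ≤ c := le_trans (by have : 0 ≤ e3 := he0.trans hle
                                   positivity) hc
  have b1 : max (H / σ) (σ / H) - 1 ≤ e3 / (1 - e3) := by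
    have : e3 / (1 - e3) = 1 / (1 - e3) - 1 := by field_simp; ring
    rw [this]
    refine sub_le_sub_right (max_le ?_ ?_) 1
    · rw [div_le_div_iff₀ hσ hd]; nlinarith [sq_nonneg e3]
    · rw [div_le_div_iff₀ hH hd]; nlinarith
  have b2 : e' * S / min H σ ≤ e' / (1 - e3) := by
    rw [div_le_div_iff₀ (lt_min hH hσ) hd, mul_assoc]
    refine mul_le_mul_of_nonneg_left (le_min ?_ ?_) he'
    · nlinarith
    · nlinarith [sq_nonneg e3]
  have b3 : 1 - e3 ≤ 1 - max (H / σ - 1) 0 := by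
    have : max (H / σ - 1) 0 ≤ e3 := by
      refine max_le ?_ (he0.trans hle)
      have : H / σ < 1 + e3 := by rw [div_lt_iff₀ hσ]; exact a2
      linarith
    linarith
  have b4 : e3 / (1 - e3) + e' / (1 - e3) ≤ c * (1 - e3) := by
    rw [← add_div, div_le_iff₀ hd, mul_assoc, ← sq]
    rwa [div_le_iff₀ (by positivity)] at hc
  exact ⟨hH, by linarith [mul_le_mul_of_nonneg_left b3 hc0]⟩

lemma noiseCalibrated_of_controlled {D : Setup} {C₁ C₂ e' e'' e3 c : ℝ}
    (hD : D.Controlled C₁ C₂) (hC₂ : 0 < C₂) (he' : 0 ≤ e') (he1 : e'' < 1) (h3 : e3 < 1)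
    (hb2 : C₂ * D.s * D.rate ^ 2 ≤ e'')
    (hP : D.P.real {e | D.sigStar e / D.σ ∉
      Set.Icc ((1 - e3) / (1 - e'')) ((1 + e3) / (1 + e''))} ≤ D.ε)
    (hc : (e3 + e') / (1 - e3) ^ 2 ≤ c) : D.NoiseCalibrated e' c := by
  have hs := hD.standing
  have he0 : 0 ≤ e'' := le_trans (by have := hs.s_pos; positivity) hb2
  rcases lt_or_ge e3 e'' with hlt | hle
  · -- the interval is empty, so that `ε ≥ 1`
    have hempty : {e | D.sigStar e / D.σ ∉
        Set.Icc ((1 - e3) / (1 - e'')) ((1 + e3) / (1 + e''))} = Set.univ := by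
      refine Set.eq_univ_of_forall fun e he => ?_
      have h1 : (1 + e3) / (1 + e'') < 1 := by rw [div_lt_one (by linarith)]; linarith
      have h2 : 1 < (1 - e3) / (1 - e'') := by rw [one_lt_div (by linarith)]; linarith
      linarith [he.1, he.2]
    rw [hempty, probReal_univ] at hP
    exact measureReal_le_one.trans (by linarith)
  · have hsub : {e | ¬ (0 < D.sigHat e ∧
        max (D.sigHat e / D.σ) (D.σ / D.sigHat e) - 1 + e' * D.sigStar e / min (D.sigHat e) D.σ
          ≤ c * (1 - max (D.sigHat e / D.σ - 1) 0))} ⊆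
        {e | D.sigStar e / D.σ ∉ Set.Icc ((1 - e3) / (1 - e'')) ((1 + e3) / (1 + e''))} ∪
          D.badNoise C₂ := by
      intro e he
      by_contra hne
      rw [Set.mem_union, not_or] at hne
      obtain ⟨h1, h2⟩ := hne
      have h1' : D.sigStar e / D.σ ∈ Set.Icc ((1 - e3) / (1 - e'')) ((1 + e3) / (1 + e'')) :=
        not_not.1 h1
      have hS : 0 < D.sigStar e := by
        have h4 : 0 < D.sigStar e / D.σ :=
          lt_of_lt_of_le (div_pos (by linarith) (by linarith)) h1'.1
        exact (div_pos_iff_of_pos_right hs.sigma_pos).1 h4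
      have h4 : |D.sigHat e / D.sigStar e - 1| < e'' := lt_of_lt_of_le (not_le.1 h2) hb2
      rw [abs_lt] at h4
      refine he (calibration_of_bounds hs.sigma_pos he' he0 h3 hle hS hc ?_ ?_ h1'.1 h1'.2)
      · rw [← lt_div_iff₀ hS]; linarith
      · rw [← div_lt_iff₀ hS]; linarith
    have h5 : D.P.real (D.badNoise C₂) ≤ D.ε := hD.noise
    have h6 := (measureReal_mono (μ := D.P) hsub).trans (measureReal_union_le _ _)
    change D.P.real _ ≤ _
    linarith

lemma L0_pos {D : Setup} {α : ℝ} (h0 : 0 < α) (h1 : α < D.p) : 0 < D.L0 α := by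
  have hp : 0 < (D.p : ℝ) := h0.trans h1
  have h2 : α / (2 * D.p) < 1 / 2 := by rw [div_lt_div_iff₀ (by positivity) two_pos]; linarith
  have h3 : 0 < α / (2 * D.p) := by positivity
  exact normalQuantile_pos (by linarith) (by linarith)

/-- The event on which the noise level estimate fails to be calibrated. -/
def badCalibration (D : Setup) (e' c : ℝ) : Set (Fin D.n → ℝ) :=
  {e | ¬ (0 < D.sigHat e ∧
    max (D.sigHat e / D.σ) (D.σ / D.sigHat e) - 1 + e' * D.sigStar e / min (D.sigHat e) D.σ
      ≤ c * (1 - max (D.sigHat e / D.σ - 1) 0))}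

section Threshold

variable {D : Setup} {C₁ C₂ ηs e' α c : ℝ} {z : Fin D.p → Fin D.n → ℝ}

lemma badThreshold_le (hD : D.Controlled C₁ C₂) (hcal : D.NoiseCalibrated e' c) :
    D.P.real (D.badL1 C₁ ∪ D.badCalibration e' c) ≤ 3 * D.ε := by
  have h5 : D.P.real (D.badL1 C₁) ≤ D.ε := hD.l1
  have h6 : D.P.real (D.badCalibration e' c) ≤ 2 * D.ε := hcal
  have h7 := measureReal_union_le (μ := D.P) (D.badL1 C₁) (D.badCalibration e' c)
  linarith

lemma selection_of_notMem (hD : D.Controlled C₁ C₂) (hz : D.IsScore z) (hη : 0 < ηs)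
    (hα0 : 0 < α) (hα1 : α < D.p) (hc : 0 < c) (hz2 : ∀ j, D.eta z j ≤ ηs)
    (hb : C₁ * ηs * (D.s * D.rate) ≤ e' * D.L0 α) {e : Fin D.n → ℝ}
    (he : e ∉ D.badL1 C₁ ∪ D.badCalibration e' c)
    (hN : ∀ j, |(z j ⬝ᵥ e) / l2norm (z j)| ≤ D.σ * D.L0 α) :
    {j | (2 + 2 * c) * (D.tau z j * D.σ * D.L0 α) < |D.β j|} ⊆ D.selected z α c e ∧
      D.selected z α c e ⊆ {j | D.β j ≠ 0} := by
  rw [Set.mem_union, not_or] at he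
  have hcal := not_not.1 he.2
  obtain ⟨hb1, hb2⟩ := threshold_bounds hcal.1 hD.standing.sigma_pos hc hcal.2
  have hL := L0_pos hα0 hα1
  have herr : ∀ j, |D.est z e j - D.β j| ≤
      D.tau z j * ((D.σ + e' * D.sigStar e) * D.L0 α) := fun j => by
    refine (abs_est_sub_le hD.standing hη hb hz he.1 (hz2 j)).trans ?_
    refine mul_le_mul_of_nonneg_left ?_ (tau_pos hz j).le
    nlinarith [hN j]
  constructor
  · intro j hj
    have hj' : (2 + 2 * c) * (D.tau z j * D.σ * D.L0 α) < |D.β j| := hj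
    change (1 + c) * D.sigHat e * D.tau z j * D.L0 α < |D.est z e j|
    have h1 := abs_sub_abs_le_abs_sub (D.β j) (D.est z e j)
    rw [abs_sub_comm] at h1
    have hpos := mul_pos (tau_pos hz j) hL
    have h2 := mul_le_mul_of_nonneg_left hb2 hpos.le
    nlinarith [herr j]
  · intro j hj hβ
    have hj' : (1 + c) * D.sigHat e * D.tau z j * D.L0 α < |D.est z e j| := hj
    have h1 := herr j
    rw [hβ, sub_zero] at h1
    have hpos := mul_pos (tau_pos hz j) hL
    have h2 := mul_le_mul_of_nonneg_left hb1 hpos.le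
    nlinarith

lemma selection_probability (hD : D.Controlled C₁ C₂) (hz : D.IsScore z) (hη : 0 < ηs)
    (hα0 : 0 < α) (hα1 : α < D.p) (hc : 0 < c) (hz2 : ∀ j, D.eta z j ≤ ηs)
    (hb : C₁ * ηs * (D.s * D.rate) ≤ e' * D.L0 α) (hcal : D.NoiseCalibrated e' c) :
    1 - α - 3 * D.ε ≤ D.P.real
        {e | {j | (2 + 2 * c) * (D.tau z j * D.σ * D.L0 α) < |D.β j|} ⊆ D.selected z α c e ∧
          D.selected z α c e ⊆ {j | D.β j ≠ 0}} := by
  have hs := hD.standing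
  have hp : 0 < (D.p : ℝ) := hα0.trans hα1
  have hsub : {e | {j | (2 + 2 * c) * (D.tau z j * D.σ * D.L0 α) < |D.β j|} ⊆
      D.selected z α c e ∧ D.selected z α c e ⊆ {j | D.β j ≠ 0}}ᶜ ⊆
      (⋃ j ∈ Finset.univ, {e | D.σ * D.L0 α < |(z j ⬝ᵥ e) / l2norm (z j)|}) ∪
        (D.badL1 C₁ ∪ D.badCalibration e' c) := by
    intro e he
    by_contra hne
    rw [Set.mem_union, not_or] at hne
    refine he (selection_of_notMem hD hz hη hα0 hα1 hc hz2 hb hne.2 fun j => ?_)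
    by_contra hj
    exact hne.1 (Set.mem_iUnion₂.2 ⟨j, Finset.mem_univ j, not_le.1 hj⟩)
  have hU : D.P.real (⋃ j ∈ Finset.univ,
      {e | D.σ * D.L0 α < |(z j ⬝ᵥ e) / l2norm (z j)|}) ≤ α := by
    refine (measureReal_biUnion_finset_le _ _).trans ((Finset.sum_le_card_nsmul _ _ _ fun j _ =>
      (D.noise_tail_eq hs.one_le_n hs.sigma_pos (score_norm_pos hz j)
        (L0_pos hα0 hα1).le).le).trans_eq ?_)
    have h2 : α / (2 * D.p) < 1 / 2 := by
      rw [div_lt_div_iff₀ (by positivity) two_pos]; linarith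
    have h3 : 0 < α / (2 * D.p) := by positivity
    rw [L0, cdf_normalQuantile (by linarith) (by linarith), Finset.card_univ, Fintype.card_fin,
      nsmul_eq_mul]
    field_simp
    ring
  have h1 := badThreshold_le hD hcal
  have h2 := one_sub_measureReal_compl_le D.P
    {e | {j | (2 + 2 * c) * (D.tau z j * D.σ * D.L0 α) < |D.β j|} ⊆ D.selected z α c e ∧
          D.selected z α c e ⊆ {j | D.β j ≠ 0}}
  have h3 := (measureReal_mono (μ := D.P) hsub).trans (measureReal_union_le _ _)
  linarith

/-- On the good event the thresholded estimator of `β_j` is, in units of `τ_j σ`, a soft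
thresholded perturbation of a normal variable with mean `β_j / (τ_j σ)`. -/
lemma softEst_error_le (hD : D.Controlled C₁ C₂) (hz : D.IsScore z) (hη : 0 < ηs)
    (hα0 : 0 < α) (hα1 : α < D.p) (hc : 0 < c) (hz2 : ∀ j, D.eta z j ≤ ηs)
    (hb : C₁ * ηs * (D.s * D.rate) ≤ e' * D.L0 α) {e : Fin D.n → ℝ}
    (he : e ∉ D.badL1 C₁ ∪ D.badCalibration e' c) (j : Fin D.p) {h : ℝ → ℝ}
    (hh : ∀ N Δ lam, D.L0 α + |Δ| ≤ lam → lam + |Δ| ≤ (1 + 2 * c) * D.L0 α →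
      (soft (D.β j / (D.tau z j * D.σ) + N + Δ) lam - D.β j / (D.tau z j * D.σ)) ^ 2 ≤ h N) :
    (D.softEst z α c e j - D.β j) ^ 2 ≤
      (D.tau z j * D.σ) ^ 2 * h ((z j ⬝ᵥ e) / l2norm (z j) / D.σ) := by
  rw [Set.mem_union, not_or] at he
  have hσ := hD.standing.sigma_pos
  have hcal := not_not.1 he.2
  obtain ⟨hb1, hb2⟩ := threshold_bounds hcal.1 hσ hc hcal.2
  have hL := L0_pos hα0 hα1
  have ht := tau_pos hz j
  have hk : 0 < D.tau z j * D.σ := mul_pos ht hσ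
  set G := (z j ⬝ᵥ e) / l2norm (z j) with hG
  set b := D.β j / (D.tau z j * D.σ) with hbdef
  set Δ := ((D.tau z j)⁻¹ * (D.est z e j - D.β j) - G) / D.σ with hΔ
  set lam := (1 + c) * D.sigHat e * D.L0 α / D.σ with hlam
  have hΔle : |Δ| ≤ e' * D.sigStar e * D.L0 α / D.σ := by
    rw [hΔ, abs_div, abs_of_pos hσ]
    refine div_le_div_of_nonneg_right ?_ hσ.le
    have := scaled_bias_le hD.standing hη hb hz he.1 (hz2 j)
    linarith
  have h1 : D.L0 α + |Δ| ≤ lam := by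
    have e1 : D.L0 α + e' * D.sigStar e * D.L0 α / D.σ =
        (D.σ + e' * D.sigStar e) * D.L0 α / D.σ := by field_simp
    have := div_le_div_of_nonneg_right (mul_le_mul_of_nonneg_right hb1 hL.le) hσ.le
    linarith
  have h2 : lam + |Δ| ≤ (1 + 2 * c) * D.L0 α := by
    have e1 : lam + e' * D.sigStar e * D.L0 α / D.σ =
        ((1 + c) * D.sigHat e + e' * D.sigStar e) * D.L0 α / D.σ := by
      rw [hlam]; field_simp
    have := div_le_div_of_nonneg_right (mul_le_mul_of_nonneg_right hb2 hL.le) hσ.le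
    have e2 : (1 + 2 * c) * D.σ * D.L0 α / D.σ = (1 + 2 * c) * D.L0 α := by field_simp
    linarith
  have h3 := hh (G / D.σ) Δ lam h1 h2
  have e1 : D.softEst z α c e j = D.tau z j * D.σ * soft (b + G / D.σ + Δ) lam := by
    rw [← soft_mul hk]
    have e2 : D.tau z j * D.σ * (b + G / D.σ + Δ) = D.est z e j := by
      rw [hbdef, hΔ]; field_simp; ring
    have e3 : D.tau z j * D.σ * lam = D.thresh z α c e j := by
      rw [hlam, thresh]; field_simp
    rw [e2, e3]; rfl
  have e2 : D.β j = D.tau z j * D.σ * b := by rw [hbdef]; field_simp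
  have e3 : D.tau z j * D.σ * soft (b + G / D.σ + Δ) lam - D.β j =
      D.tau z j * D.σ * (soft (b + G / D.σ + Δ) lam - b) := by rw [mul_sub, ← e2]
  rw [e1, e3, mul_pow]
  exact mul_le_mul_of_nonneg_left h3 (by positivity)

lemma lintegral_noise_coord (hn : 1 ≤ D.n) (hσ : 0 < D.σ) {v : Fin D.n → ℝ}
    (hv : 0 < l2norm v) {f : ℝ → ℝ≥0∞} (hf : Measurable f) :
    ∫⁻ e, f ((v ⬝ᵥ e) / l2norm v / D.σ) ∂D.P = ∫⁻ g, f g ∂(gaussianReal 0 1) := by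
  obtain ⟨T, hT, h⟩ := exists_rotation hσ v (⟨0, hn⟩ : Fin D.n)
  have h1 := (measurePreserving_eval (fun _ : Fin D.n => gaussianReal 0 1)
    (⟨0, hn⟩ : Fin D.n)).lintegral_comp hf
  rw [P, ← hT.lintegral_comp_emb T.measurableEmbedding, ← h1]
  refine lintegral_congr fun g => ?_
  rw [(h g).1, mul_div_cancel_left₀ _ hv.ne', mul_div_cancel_left₀ _ hσ.ne']

lemma soft_risk_le (hD : D.Controlled C₁ C₂) (hz : D.IsScore z) (hη : 0 < ηs)
    (hα0 : 0 < α) (hα1 : α < D.p) (hc : 0 < c) (hz2 : ∀ j, D.eta z j ≤ ηs)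
    (hb : C₁ * ηs * (D.s * D.rate) ≤ e' * D.L0 α)
    (hφ : normalDensity (D.L0 α) ≤ D.ε / D.p) {Ωn : Set (Fin D.n → ℝ)} (hm : MeasurableSet Ωn)
    (hΩ : Disjoint Ωn (D.badL1 C₁ ∪ D.badCalibration e' c)) :
    ∫⁻ e in Ωn, ENNReal.ofReal (∑ j, (D.softEst z α c e j - D.β j) ^ 2) ∂D.P ≤
      ENNReal.ofReal
        (∑ j, min (D.β j ^ 2)
            (D.tau z j ^ 2 * D.σ ^ 2 * (D.L0 α ^ 2 * (1 + 2 * c) ^ 2 + 1)) +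
          D.ε * (4 / D.L0 α ^ 3 + 4 * c / D.L0 α + 12 * c ^ 2 * D.L0 α) / D.p *
            D.σ ^ 2 * ∑ j, D.tau z j ^ 2) := by
  have hs := hD.standing
  have hσ := hs.sigma_pos
  have hL := L0_pos hα0 hα1
  have hp : 0 < (D.p : ℝ) := hα0.trans hα1
  choose h hmeas h0 hh hi using fun j : Fin D.p =>
    exists_soft_envelope (D.β j / (D.tau z j * D.σ)) hL hc
  set N : Fin D.p → (Fin D.n → ℝ) → ℝ := fun j e => (z j ⬝ᵥ e) / l2norm (z j) / D.σ with hN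
  have hNm : ∀ j, Measurable (N j) := fun j => by
    simp only [hN, dotProduct]; fun_prop
  set Ln := 4 / D.L0 α ^ 3 + 4 * c / D.L0 α + 12 * c ^ 2 * D.L0 α with hLn
  calc _ ≤ ∫⁻ e in Ωn, ∑ j, ENNReal.ofReal ((D.tau z j * D.σ) ^ 2 * h j (N j e)) ∂D.P := by
        refine setLIntegral_mono' hm fun e he => ?_
        rw [← ENNReal.ofReal_sum_of_nonneg fun j _ => mul_nonneg (sq_nonneg _) (h0 j _)]
        exact ENNReal.ofReal_le_ofReal (Finset.sum_le_sum fun j _ =>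
          softEst_error_le hD hz hη hα0 hα1 hc hz2 hb (Set.disjoint_left.1 hΩ he) j (hh j))
    _ ≤ ∫⁻ e, ∑ j, ENNReal.ofReal ((D.tau z j * D.σ) ^ 2 * h j (N j e)) ∂D.P :=
        setLIntegral_le_lintegral _ _
    _ = ∑ j, ∫⁻ e, ENNReal.ofReal ((D.tau z j * D.σ) ^ 2 * h j (N j e)) ∂D.P := by
        refine lintegral_finsetSum _ fun j _ => ?_
        have := (hmeas j).comp (hNm j)
        exact (this.const_mul _).ennreal_ofReal
    _ = ∑ j, ENNReal.ofReal ((D.tau z j * D.σ) ^ 2) *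
          ∫⁻ g, ENNReal.ofReal (h j g) ∂(gaussianReal 0 1) := by
        refine Finset.sum_congr rfl fun j _ => ?_
        simp only [ENNReal.ofReal_mul (sq_nonneg (D.tau z j * D.σ))]
        rw [lintegral_const_mul' _ _ ENNReal.ofReal_ne_top]
        congr 1
        exact lintegral_noise_coord hs.one_le_n hσ (score_norm_pos hz j)
          (f := fun g => ENNReal.ofReal (h j g)) (hmeas j).ennreal_ofReal
    _ ≤ ∑ j, ENNReal.ofReal (min (D.β j ^ 2)
            (D.tau z j ^ 2 * D.σ ^ 2 * (D.L0 α ^ 2 * (1 + 2 * c) ^ 2 + 1)) +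
            D.ε * Ln / D.p * D.σ ^ 2 * D.tau z j ^ 2) := by
        refine Finset.sum_le_sum fun j _ => ?_
        refine (mul_le_mul' le_rfl (hi j)).trans ?_
        rw [← ENNReal.ofReal_mul (sq_nonneg _)]
        refine ENNReal.ofReal_le_ofReal ?_
        have ht := tau_pos hz j
        have e1 : (D.tau z j * D.σ) ^ 2 * min ((D.β j / (D.tau z j * D.σ)) ^ 2)
            (D.L0 α ^ 2 * (1 + 2 * c) ^ 2 + 1) = min (D.β j ^ 2)
            (D.tau z j ^ 2 * D.σ ^ 2 * (D.L0 α ^ 2 * (1 + 2 * c) ^ 2 + 1)) := by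
          rw [mul_min_of_nonneg _ _ (sq_nonneg _), ← mul_pow, mul_pow (D.tau z j),
            mul_div_cancel₀ _ (mul_pos ht hσ).ne']
        have e2 : normalDensity (D.L0 α) * (4 / D.L0 α ^ 3 + 4 * c / D.L0 α) ≤
            D.ε / D.p * Ln := by
          refine mul_le_mul hφ ?_ (by positivity) (div_nonneg hs.eps_pos.le hp.le)
          rw [hLn]
          have : 0 ≤ 12 * c ^ 2 * D.L0 α := by positivity
          linarith
        rw [mul_add, e1]
        refine add_le_add le_rfl ((mul_le_mul_of_nonneg_left e2 (sq_nonneg _)).trans_eq ?_)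
        ring
    _ = _ := by
        rw [← ENNReal.ofReal_sum_of_nonneg, Finset.sum_add_distrib, ← Finset.mul_sum]
        intro j _
        have := hs.eps_pos
        have : 0 ≤ Ln := by rw [hLn]; positivity
        refine add_nonneg (le_min (sq_nonneg _) (by positivity)) (by positivity)

end Threshold

end Setup

lemma thresholdConclusion_of_controlled {C₁ C₂ : ℝ} {R : Setup → Prop} (hC₂ : 0 < C₂)
    (hR : ∀ D, R D → D.Controlled C₁ C₂) : ThresholdConclusion C₁ C₂ R := by
  refine ⟨fun D hD e' e'' e3 c he' he1 _ h3 hb2 hP hc =>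
    Setup.noiseCalibrated_of_controlled (hR D hD) hC₂ he' he1 h3 hb2 hP hc, ?_⟩
  intro D hD z hz ηs e' α c hη hα0 hα1 hc hz2 hb hcal
  refine ⟨fun hφ => ?_, Setup.selection_probability (hR D hD) hz hη hα0 hα1 hc hz2 hb hcal⟩
  set bad := D.badL1 C₁ ∪ D.badCalibration e' c
  refine ⟨(toMeasurable D.P bad)ᶜ, (measurableSet_toMeasurable _ _).compl, ?_, ?_⟩
  · rw [compl_compl, measureReal_def, measure_toMeasurable]
    exact Setup.badThreshold_le (hR D hD) hcal
  · refine Setup.soft_risk_le (hR D hD) hz hη hα0 hα1 hc hz2 hb hφ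
      (measurableSet_toMeasurable _ _).compl ?_
    exact Set.disjoint_left.2 fun e he hbad => he (subset_toMeasurable _ _ hbad)

lemma allConclusions_of_controlled {C₁ C₂ : ℝ} {R : Setup → Prop} (hC₁ : 0 < C₁) (hC₂ : 0 < C₂)
    (hR : ∀ D, R D → D.Controlled C₁ C₂) : AllConclusions C₁ C₂ R :=
  ⟨singleConclusion_of_controlled hC₁ hR, coverageConclusion_of_controlled hR,
    simultaneousConclusion_of_controlled hC₁ hR, familywiseConclusion_of_controlled hC₂ hR,
    thresholdConclusion_of_controlled hC₂ hR⟩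

/-! ### Euclidean inequalities -/

section Geometry

variable {n p : ℕ}

lemma l2norm_sq_eq_dot {ι : Type} [Fintype ι] (v : ι → ℝ) : l2norm v ^ 2 = v ⬝ᵥ v := by
  rw [l2norm_sq, dotProduct]; exact Finset.sum_congr rfl fun i _ => by ring

lemma dot_le_l2norm_mul {ι : Type} [Fintype ι] (v w : ι → ℝ) :
    v ⬝ᵥ w ≤ l2norm v * l2norm w := by
  rw [dot_eq_inner, l2norm_eq_norm, l2norm_eq_norm]; exact real_inner_le_norm _ _

lemma l2norm_sub_sq {ι : Type} [Fintype ι] (v w : ι → ℝ) :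
    l2norm (v - w) ^ 2 = l2norm v ^ 2 - 2 * (v ⬝ᵥ w) + l2norm w ^ 2 := by
  simp only [l2norm_sq_eq_dot, sub_dotProduct, dotProduct_sub]
  rw [dotProduct_comm w v]; ring

lemma dot_mulVec_eq_sum (X : Matrix (Fin n) (Fin p) ℝ) (v : Fin n → ℝ) (u : Fin p → ℝ) :
    v ⬝ᵥ (X *ᵥ u) = ∑ j, (v ⬝ᵥ X.col j) * u j := by
  rw [Matrix.dotProduct_mulVec]; rfl

lemma abs_dot_mulVec_le (X : Matrix (Fin n) (Fin p) ℝ) (v : Fin n → ℝ) (u : Fin p → ℝ) {a : ℝ}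
    (h : ∀ j, |v ⬝ᵥ X.col j| ≤ a) : |v ⬝ᵥ (X *ᵥ u)| ≤ a * l1norm u := by
  rw [dot_mulVec_eq_sum, l1norm, Finset.mul_sum]
  refine (Finset.abs_sum_le_sum_abs _ _).trans (Finset.sum_le_sum fun j _ => ?_)
  rw [abs_mul]
  exact mul_le_mul_of_nonneg_right (h j) (abs_nonneg _)

lemma l1norm_sq_le_card {T : Finset (Fin p)} {u : Fin p → ℝ} (hu : ∀ j, j ∉ T → u j = 0) :
    l1norm u ^ 2 ≤ T.card * ∑ j, u j ^ 2 := by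
  have e1 : l1norm u = ∑ j ∈ T, |u j| := by
    refine (Finset.sum_subset (Finset.subset_univ T) fun j _ hj => ?_).symm
    rw [hu j hj, abs_zero]
  have e2 : ∑ j, u j ^ 2 = ∑ j ∈ T, |u j| ^ 2 := by
    simp only [sq_abs]
    refine (Finset.sum_subset (Finset.subset_univ T) fun j _ hj => ?_).symm
    rw [hu j hj]; ring
  rw [e1, e2]
  exact sq_sum_le_card_mul_sum_sq

/-! ### Extreme eigenvalues as bounds for quadratic forms -/

lemma gram_quadratic (X : Matrix (Fin n) (Fin p) ℝ) {B : Finset (Fin p)} {u : Fin p → ℝ}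
    (hu : ∀ j, j ∉ B → u j = 0) :
    (fun j : B => u j) ⬝ᵥ (gram X B *ᵥ fun j : B => u j) = l2norm (X *ᵥ u) ^ 2 / n := by
  set Y := X.submatrix id (fun j : B => (j : Fin p)) with hY
  have e : Y *ᵥ (fun j : B => u j) = X *ᵥ u := by
    funext i
    change ∑ j : B, X i j * u j = ∑ j, X i j * u j
    rw [Finset.sum_coe_sort B (fun j => X i j * u j)]
    refine Finset.sum_subset (Finset.subset_univ B) fun j _ hj => ?_
    rw [hu j hj, mul_zero]
  rw [gram, Matrix.smul_mulVec, dotProduct_smul, ← hY, ← Matrix.mulVec_mulVec,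
    Matrix.dotProduct_mulVec, Matrix.vecMul_transpose, e, l2norm_sq_eq_dot, smul_eq_mul]
  ring

lemma gram_isHermitian (X : Matrix (Fin n) (Fin p) ℝ) (B : Finset (Fin p)) :
    (gram X B).IsHermitian := by
  have h := Matrix.isHermitian_conjTranspose_mul_self (X.submatrix id (fun j : B => (j : Fin p)))
  rw [Matrix.conjTranspose_eq_transpose_of_trivial] at h
  rw [gram, Matrix.IsHermitian, Matrix.conjTranspose_smul, h.eq]
  simp

lemma quadratic_le_of_eigMax_le {ι : Type} [Fintype ι] [DecidableEq ι] {G : Matrix ι ι ℝ}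
    (hG : G.IsHermitian) {φ : ℝ} (hφ : 0 ≤ φ) (h : eigMax G ≤ ENNReal.ofReal φ) (w : ι → ℝ) :
    w ⬝ᵥ (G *ᵥ w) ≤ φ * (w ⬝ᵥ w) := by
  have hH : (algebraMap ℝ (Matrix ι ι ℝ) φ - G).IsHermitian := by
    refine Matrix.IsHermitian.sub ?_ hG
    rw [Algebra.algebraMap_eq_smul_one, Matrix.IsHermitian, Matrix.conjTranspose_smul]
    simp
  have hpos : (algebraMap ℝ (Matrix ι ι ℝ) φ - G).PosSemidef := by
    rw [hH.posSemidef_iff_eigenvalues_nonneg]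
    intro i
    have h1 := hH.eigenvalues_mem_spectrum_real i
    rw [← spectrum.singleton_sub_eq] at h1
    obtain ⟨a, ha, r, hr, hra⟩ := h1
    rw [Set.mem_singleton_iff] at ha
    have h2 : ENNReal.ofReal r ≤ ENNReal.ofReal φ := le_trans (le_iSup₂ (f := fun r
      (_ : r ∈ spectrum ℝ G) => ENNReal.ofReal r) r hr) h
    rw [ENNReal.ofReal_le_ofReal_iff hφ] at h2
    simp only [Pi.zero_apply]
    rw [← hra, ha]
    simpa using h2
  have h1 := hpos.dotProduct_mulVec_nonneg w
  rw [star_trivial, Matrix.sub_mulVec, dotProduct_sub, Algebra.algebraMap_eq_smul_one,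
    Matrix.smul_mulVec, Matrix.one_mulVec, dotProduct_smul, smul_eq_mul] at h1
  linarith

lemma le_quadratic_of_le_eigMin {ι : Type} [Fintype ι] [DecidableEq ι] {G : Matrix ι ι ℝ}
    (hG : G.IsHermitian) {c : ℝ} (hc : 0 < c) (h : ENNReal.ofReal c ≤ eigMin G) (w : ι → ℝ) :
    c * (w ⬝ᵥ w) ≤ w ⬝ᵥ (G *ᵥ w) := by
  have hH : (G - algebraMap ℝ (Matrix ι ι ℝ) c).IsHermitian := by
    refine Matrix.IsHermitian.sub hG ?_
    rw [Algebra.algebraMap_eq_smul_one, Matrix.IsHermitian, Matrix.conjTranspose_smul]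
    simp
  have hpos : (G - algebraMap ℝ (Matrix ι ι ℝ) c).PosSemidef := by
    rw [hH.posSemidef_iff_eigenvalues_nonneg]
    intro i
    have h1 := hH.eigenvalues_mem_spectrum_real i
    rw [← spectrum.sub_singleton_eq] at h1
    obtain ⟨r, hr, a, ha, hra⟩ := h1
    rw [Set.mem_singleton_iff] at ha
    have h2 : ENNReal.ofReal c ≤ ENNReal.ofReal r := h.trans (iInf₂_le (f := fun r
      (_ : r ∈ spectrum ℝ G) => ENNReal.ofReal r) r hr)
    rw [ENNReal.ofReal_le_ofReal_iff'] at h2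
    simp only [Pi.zero_apply]
    rw [← hra, ha]
    rcases h2 with h2 | h2
    · simpa using h2
    · linarith
  have h1 := hpos.dotProduct_mulVec_nonneg w
  rw [star_trivial, Matrix.sub_mulVec, dotProduct_sub, Algebra.algebraMap_eq_smul_one,
    Matrix.smul_mulVec, Matrix.one_mulVec, dotProduct_smul, smul_eq_mul] at h1
  linarith

lemma sum_sq_restrict {B : Finset (Fin p)} {u : Fin p → ℝ} (hu : ∀ j, j ∉ B → u j = 0) :
    (fun j : B => u j) ⬝ᵥ (fun j : B => u j) = ∑ j, u j ^ 2 := by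
  rw [dotProduct, Finset.sum_coe_sort B (fun j => u j * u j)]
  refine (Finset.sum_subset (Finset.subset_univ B) fun j _ hj => ?_).trans
    (Finset.sum_congr rfl fun j _ => by ring)
  rw [hu j hj, mul_zero]

/-- Bound for the correlations of `v` with the columns in `B`: apply the quadratic form bound to the
vector of these correlations. -/
lemma sum_sq_dot_col_le (X : Matrix (Fin n) (Fin p) ℝ) (hn : 1 ≤ n) {B : Finset (Fin p)} {φ : ℝ}
    (hφ : 0 ≤ φ) (h : eigMax (gram X B) ≤ ENNReal.ofReal φ) (v : Fin n → ℝ) :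
    ∑ j ∈ B, (v ⬝ᵥ X.col j) ^ 2 ≤ n * φ * l2norm v ^ 2 := by
  have hn' : (0 : ℝ) < n := by exact_mod_cast hn
  set u : Fin p → ℝ := fun j => if j ∈ B then v ⬝ᵥ X.col j else 0 with hu
  have hu0 : ∀ j, j ∉ B → u j = 0 := fun j hj => if_neg hj
  set Q := ∑ j ∈ B, (v ⬝ᵥ X.col j) ^ 2 with hQ
  have hQ0 : 0 ≤ Q := Finset.sum_nonneg fun j _ => sq_nonneg _
  have e1 : ∑ j, u j ^ 2 = Q := by
    simp only [hu, ite_pow, hQ]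
    simp [Finset.sum_ite_mem]
  have e2 : v ⬝ᵥ (X *ᵥ u) = Q := by
    rw [dot_mulVec_eq_sum]
    simp only [hu, hQ, mul_ite, mul_zero, Finset.sum_ite_mem, Finset.univ_inter]
    exact Finset.sum_congr rfl fun j _ => by ring
  have h1 := quadratic_le_of_eigMax_le (gram_isHermitian X B) hφ h fun j : B => u j
  rw [gram_quadratic X hu0, sum_sq_restrict hu0, e1, div_le_iff₀ hn'] at h1
  have h2 := dot_le_l2norm_mul v (X *ᵥ u)
  rw [e2] at h2
  have h3 : Q ^ 2 ≤ l2norm v ^ 2 * (φ * Q * n) := by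
    calc Q ^ 2 ≤ (l2norm v * l2norm (X *ᵥ u)) ^ 2 := pow_le_pow_left₀ hQ0 h2 2
      _ = l2norm v ^ 2 * l2norm (X *ᵥ u) ^ 2 := by ring
      _ ≤ _ := mul_le_mul_of_nonneg_left h1 (sq_nonneg _)
  rcases hQ0.eq_or_lt with h0 | h0
  · rw [← h0]; positivity
  · refine le_of_mul_le_mul_right ?_ h0
    nlinarith

lemma sum_sq_le_of_le_eigMin (X : Matrix (Fin n) (Fin p) ℝ) (hn : 1 ≤ n) {B : Finset (Fin p)}
    {c : ℝ} (hc : 0 < c) (h : ENNReal.ofReal c ≤ eigMin (gram X B)) {u : Fin p → ℝ}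
    (hu : ∀ j, j ∉ B → u j = 0) : c * n * ∑ j, u j ^ 2 ≤ l2norm (X *ᵥ u) ^ 2 := by
  have hn' : (0 : ℝ) < n := by exact_mod_cast hn
  have h1 := le_quadratic_of_le_eigMin (gram_isHermitian X B) hc h fun j : B => u j
  rw [gram_quadratic X hu, sum_sq_restrict hu, le_div_iff₀ hn'] at h1
  linarith

lemma compat_sq_le (X : Matrix (Fin n) (Fin p) ℝ) (hn : 1 ≤ n) {ξ k : ℝ} {S : Finset (Fin p)}
    (h : ENNReal.ofReal k ≤ compat X ξ S ^ 2) {u : Fin p → ℝ}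
    (hu : u ∈ cone ξ S) :
    k * n * (∑ j ∈ S, |u j|) ^ 2 ≤ l2norm (X *ᵥ u) ^ 2 * S.card := by
  have hn' : (0 : ℝ) < n := by exact_mod_cast hn
  set a := ∑ j ∈ S, |u j| with ha
  have ha0 : 0 ≤ a := Finset.sum_nonneg fun j _ => abs_nonneg _
  rcases ha0.eq_or_lt with h0 | h0
  · rw [← h0]; nlinarith [sq_nonneg (l2norm (X *ᵥ u)), Nat.cast_nonneg (α := ℝ) S.card,
      mul_nonneg (sq_nonneg (l2norm (X *ᵥ u))) (Nat.cast_nonneg (α := ℝ) S.card)]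
  have hune : u ≠ 0 := by
    rintro rfl
    simp at ha
    exact h0.ne' ha
  set q := l2norm (X *ᵥ u) * Real.sqrt (S.card : ℝ) / (Real.sqrt (n : ℝ) * a) with hq
  have hq0 : 0 ≤ q := div_nonneg (mul_nonneg (l2norm_nonneg _) (Real.sqrt_nonneg _))
    (mul_nonneg (Real.sqrt_nonneg _) ha0)
  have h1 : compat X ξ S ≤ ENNReal.ofReal q := iInf₂_le (f := fun (u : Fin p → ℝ)
    (_ : u ≠ 0 ∧ u ∈ cone ξ S) => ENNReal.ofReal
      (l2norm (X *ᵥ u) * Real.sqrt (S.card : ℝ) / (Real.sqrt (n : ℝ) * ∑ j ∈ S, |u j|)))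
      u ⟨hune, hu⟩
  have h2 : ENNReal.ofReal k ≤ ENNReal.ofReal (q ^ 2) := by
    rw [ENNReal.ofReal_pow hq0]
    exact h.trans (pow_le_pow_left' h1 2)
  rw [ENNReal.ofReal_le_ofReal_iff (sq_nonneg _), hq, div_pow, mul_pow, mul_pow,
    Real.sq_sqrt (Nat.cast_nonneg _), Real.sq_sqrt hn'.le, le_div_iff₀ (by positivity)] at h2
  linarith

/-! ### Scaled least squares criteria -/

/-- Minimizing the joint loss over `σ` gives the criterion `‖y - X b‖₂ / √N + lam ‖b‖₁`. -/
lemma jointLoss_profile (X : Matrix (Fin n) (Fin p) ℝ) (y : Fin n → ℝ) {N lam : ℝ} (hN : 0 < N)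
    (b : Fin p → ℝ) :
    jointLoss X y N lam b (l2norm (y - X *ᵥ b) / Real.sqrt N) =
      ENNReal.ofReal (l2norm (y - X *ᵥ b) / Real.sqrt N / 2) +
      ENNReal.ofReal (l2norm (y - X *ᵥ b) / Real.sqrt N / 2 + lam * l1norm b) := by
  set R := l2norm (y - X *ᵥ b) with hR
  have hR0 : 0 ≤ R := l2norm_nonneg _
  have hs : 0 < Real.sqrt N := Real.sqrt_pos.2 hN
  have hss : Real.sqrt N ^ 2 = N := Real.sq_sqrt hN.le
  rw [jointLoss]
  congr 1
  rcases hR0.eq_or_lt with h0 | h0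
  · rw [← hR, ← h0]; simp
  · rw [← hR, ← ENNReal.ofReal_div_of_pos (by positivity)]
    congr 1
    have : N = Real.sqrt N * Real.sqrt N := (Real.mul_self_sqrt hN.le).symm
    rw [div_div, div_eq_div_iff (by positivity) (by positivity)]
    calc R ^ 2 * (Real.sqrt N * 2) = R ^ 2 * 2 * Real.sqrt N := by ring
      _ = R * (2 * (R / Real.sqrt N) * (Real.sqrt N * Real.sqrt N)) := by field_simp
      _ = _ := by rw [← this]

lemma profile_eq (X : Matrix (Fin n) (Fin p) ℝ) (y : Fin n → ℝ) {N lam : ℝ}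
    (hlam : 0 ≤ lam) (b : Fin p → ℝ) :
    ENNReal.ofReal (l2norm (y - X *ᵥ b) / Real.sqrt N / 2) +
      ENNReal.ofReal (l2norm (y - X *ᵥ b) / Real.sqrt N / 2 + lam * l1norm b) =
    ENNReal.ofReal (l2norm (y - X *ᵥ b) / Real.sqrt N + lam * l1norm b) := by
  have h0 : 0 ≤ l2norm (y - X *ᵥ b) / Real.sqrt N :=
    div_nonneg (l2norm_nonneg _) (Real.sqrt_nonneg _)
  have h1 := mul_nonneg hlam (l1norm_nonneg b)
  rw [← ENNReal.ofReal_add (by positivity) (by positivity)]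
  congr 1; ring

/-- `Q² / (2σ) + σ/2 = Q + (Q - σ)² / (2σ)`, with the convention at `σ = 0`. -/
lemma le_jointLoss (X : Matrix (Fin n) (Fin p) ℝ) (y : Fin n → ℝ) {N lam : ℝ} (hN : 0 < N)
    (hlam : 0 ≤ lam) (b : Fin p → ℝ) {σ : ℝ} (hσ : 0 ≤ σ) :
    ENNReal.ofReal (l2norm (y - X *ᵥ b) / Real.sqrt N + lam * l1norm b) ≤
        jointLoss X y N lam b σ ∧
      (jointLoss X y N lam b σ ≤
        ENNReal.ofReal (l2norm (y - X *ᵥ b) / Real.sqrt N + lam * l1norm b) →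
        σ = l2norm (y - X *ᵥ b) / Real.sqrt N) := by
  set R := l2norm (y - X *ᵥ b) with hR
  have hR0 : 0 ≤ R := l2norm_nonneg _
  have hs : 0 < Real.sqrt N := Real.sqrt_pos.2 hN
  set l := lam * l1norm b with hl
  have hl0 : 0 ≤ l := mul_nonneg hlam (l1norm_nonneg b)
  set Q := R / Real.sqrt N with hQ
  have hQ0 : 0 ≤ Q := div_nonneg hR0 hs.le
  have hQ2 : R ^ 2 = Q ^ 2 * N := by rw [hQ, div_pow, Real.sq_sqrt hN.le]; field_simp
  rcases hσ.eq_or_lt with h0 | h0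
  · rcases hR0.eq_or_lt with h1 | h1
    · have hQz : Q = 0 := by rw [hQ, ← h1, zero_div]
      refine ⟨?_, fun _ => by rw [hQz, ← h0]⟩
      rw [jointLoss, ← hR, ← h1, ← h0, hQz]
      simp [hl]
    · have : jointLoss X y N lam b σ = ⊤ := by
        rw [jointLoss, ← hR, ← h0]
        simp only [mul_zero, zero_mul, ENNReal.ofReal_zero]
        rw [ENNReal.div_zero (by simpa using h1.ne'), top_add]
      rw [this]
      exact ⟨le_top, fun h => absurd h (by simp)⟩
  · have e : jointLoss X y N lam b σ = ENNReal.ofReal (Q + l + (Q - σ) ^ 2 / (2 * σ)) := by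
      rw [jointLoss, ← hR, ← hl, ← ENNReal.ofReal_div_of_pos (by positivity),
        ← ENNReal.ofReal_add (by positivity) (by positivity)]
      congr 1
      rw [hQ2]; field_simp; ring
    have hsq : 0 ≤ (Q - σ) ^ 2 / (2 * σ) := by positivity
    rw [e]
    refine ⟨ENNReal.ofReal_le_ofReal (by linarith), fun h => ?_⟩
    rw [ENNReal.ofReal_le_ofReal_iff (by linarith)] at h
    have h2 : (Q - σ) ^ 2 / (2 * σ) = 0 := by linarith
    rw [div_eq_zero_iff] at h2
    rcases h2 with h2 | h2
    · have := pow_eq_zero_iff two_ne_zero |>.1 h2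
      linarith
    · linarith

/-- The scaled Lasso is the square-root Lasso together with its root mean square residual. -/
lemma IsScaledLasso.profile {X : Matrix (Fin n) (Fin p) ℝ} {y : Fin n → ℝ} {lam : ℝ}
    (hn : 1 ≤ n) (hlam : 0 ≤ lam) {b : Fin p → ℝ} {σ : ℝ} (h : IsScaledLasso X y lam b σ) :
    σ = l2norm (y - X *ᵥ b) / Real.sqrt n ∧
      ∀ b', l2norm (y - X *ᵥ b) / Real.sqrt n + lam * l1norm b ≤
        l2norm (y - X *ᵥ b') / Real.sqrt n + lam * l1norm b' := by
  have hn' : (0 : ℝ) < n := by exact_mod_cast hn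
  have hmin : ∀ b', jointLoss X y n lam b σ ≤
      ENNReal.ofReal (l2norm (y - X *ᵥ b') / Real.sqrt n + lam * l1norm b') := fun b' => by
    rw [← profile_eq X y hlam, ← jointLoss_profile X y hn']
    exact h.2 _ _ (div_nonneg (l2norm_nonneg _) (Real.sqrt_nonneg _))
  obtain ⟨h1, h2⟩ := le_jointLoss X y hn' hlam b h.1
  refine ⟨h2 (hmin b), fun b' => ?_⟩
  have h3 := h1.trans (hmin b')
  rwa [ENNReal.ofReal_le_ofReal_iff (add_nonneg
    (div_nonneg (l2norm_nonneg _) (Real.sqrt_nonneg _)) (mul_nonneg hlam (l1norm_nonneg _)))] at h3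

lemma IsModelLSE.profile {X : Matrix (Fin n) (Fin p) ℝ} {y : Fin n → ℝ} {T : Finset (Fin p)}
    (hT : (T.card : ℝ) < n) {b : Fin p → ℝ} {σ : ℝ} (h : IsModelLSE X y T b σ) :
    σ = l2norm (y - X *ᵥ b) / Real.sqrt ((n : ℝ) - T.card) ∧ (∀ j, j ∉ T → b j = 0) ∧
      ∀ b' : Fin p → ℝ, (∀ j, j ∉ T → b' j = 0) →
        l2norm (y - X *ᵥ b) ≤ l2norm (y - X *ᵥ b') := by
  have hN : 0 < (n : ℝ) - T.card := by linarith
  obtain ⟨⟨hσ, hb⟩, hm⟩ := h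
  have hmin : ∀ b' : Fin p → ℝ, (∀ j, j ∉ T → b' j = 0) →
      jointLoss X y ((n : ℝ) - T.card) 0 b σ ≤
      ENNReal.ofReal (l2norm (y - X *ᵥ b') / Real.sqrt ((n : ℝ) - T.card) + 0 * l1norm b') :=
    fun b' hb' => by
      rw [← profile_eq X y le_rfl, ← jointLoss_profile X y hN]
      exact hm _ _ (div_nonneg (l2norm_nonneg _) (Real.sqrt_nonneg _)) hb'
  obtain ⟨h1, h2⟩ := le_jointLoss X y hN le_rfl b hσ
  refine ⟨h2 (hmin b hb), hb, fun b' hb' => ?_⟩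
  have h3 := h1.trans (hmin b' hb')
  rw [ENNReal.ofReal_le_ofReal_iff (add_nonneg
    (div_nonneg (l2norm_nonneg _) (Real.sqrt_nonneg _))
    (mul_nonneg le_rfl (l1norm_nonneg _))), zero_mul, zero_mul, add_zero, add_zero] at h3
  exact (div_le_div_iff_of_pos_right (Real.sqrt_pos.2 hN)).1 h3

lemma l1norm_segment_le (b w : Fin p → ℝ) {t : ℝ} (h0 : 0 ≤ t) (h1 : t ≤ 1) :
    l1norm (b + t • (w - b)) ≤ (1 - t) * l1norm b + t * l1norm w := by
  simp only [l1norm, Finset.mul_sum]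
  rw [← Finset.sum_add_distrib]
  refine Finset.sum_le_sum fun j _ => ?_
  have e : (b + t • (w - b)) j = (1 - t) * b j + t * w j := by
    simp only [Pi.add_apply, Pi.smul_apply, Pi.sub_apply, smul_eq_mul]; ring
  rw [e]
  refine (abs_add_le _ _).trans (le_of_eq ?_)
  rw [abs_mul, abs_mul, abs_of_nonneg h0, abs_of_nonneg (by linarith : (0:ℝ) ≤ 1 - t)]

/-- The first order condition of the scaled Lasso, in the form of a variational inequality with
penalty `σ̂ lam`: compare the minimizer with points near it on the segment towards `w`. -/
lemma IsScaledLasso.variational {X : Matrix (Fin n) (Fin p) ℝ} {y : Fin n → ℝ} {lam : ℝ}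
    (hn : 1 ≤ n) (hlam : 0 ≤ lam) {b : Fin p → ℝ} {σ : ℝ} (h : IsScaledLasso X y lam b σ)
    (hσ : 0 < σ) (w : Fin p → ℝ) :
    (y - X *ᵥ b) ⬝ᵥ (X *ᵥ (w - b)) ≤ n * (σ * lam) * (l1norm w - l1norm b) := by
  have hn' : (0 : ℝ) < n := by exact_mod_cast hn
  obtain ⟨hσe, hmin⟩ := h.profile hn hlam
  set r := y - X *ᵥ b with hr
  set v := X *ᵥ (w - b) with hv
  have hr2 : l2norm r ^ 2 = n * σ ^ 2 := by
    rw [hσe, div_pow, Real.sq_sqrt hn'.le]; field_simp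
  have key : ∀ t : ℝ, 0 < t → t ≤ 1 →
      r ⬝ᵥ v ≤ n * (σ * lam) * (l1norm w - l1norm b) + t * (l2norm v ^ 2 / 2) := by
    intro t ht0 ht1
    have h1 := hmin (b + t • (w - b))
    have e1 : y - X *ᵥ (b + t • (w - b)) = r - t • v := by
      rw [Matrix.mulVec_add, Matrix.mulVec_smul, hr, hv]; abel
    rw [e1, ← hσe] at h1
    set q := l2norm (r - t • v) / Real.sqrt n with hq
    have hq2 : n * q ^ 2 = n * σ ^ 2 - 2 * t * (r ⬝ᵥ v) + t ^ 2 * l2norm v ^ 2 := by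
      rw [hq, div_pow, Real.sq_sqrt hn'.le, mul_div_cancel₀ _ hn'.ne', l2norm_sub_sq, hr2,
        dotProduct_smul, l2norm_smul, smul_eq_mul, mul_pow, sq_abs]; ring
    have h2 : σ * (q - σ) ≤ (q ^ 2 - σ ^ 2) / 2 := by nlinarith [sq_nonneg (q - σ)]
    have h3 := mul_le_mul_of_nonneg_left (l1norm_segment_le b w ht0.le ht1) hlam
    have h4 : 0 ≤ σ * (q - σ) + σ * (lam * t * (l1norm w - l1norm b)) := by
      rw [← mul_add]; refine mul_nonneg hσ.le ?_; nlinarith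
    have h5 : 0 ≤ t * (n * (σ * lam) * (l1norm w - l1norm b) + t * (l2norm v ^ 2 / 2) - r ⬝ᵥ v) := by
      have h6 : 0 ≤ n * ((q ^ 2 - σ ^ 2) / 2 + σ * (lam * t * (l1norm w - l1norm b))) :=
        mul_nonneg hn'.le (by linarith)
      nlinarith
    have := nonneg_of_mul_nonneg_right h5 ht0
    linarith
  have hlim : Tendsto (fun t : ℝ => n * (σ * lam) * (l1norm w - l1norm b) + t * (l2norm v ^ 2 / 2))
      (𝓝[>] 0) (𝓝 (n * (σ * lam) * (l1norm w - l1norm b))) := by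
    have hc : Continuous fun t : ℝ =>
      n * (σ * lam) * (l1norm w - l1norm b) + t * (l2norm v ^ 2 / 2) := by fun_prop
    have := hc.tendsto 0
    rw [zero_mul, add_zero] at this
    exact this.mono_left nhdsWithin_le_nhds
  refine ge_of_tendsto hlim ?_
  filter_upwards [Ioc_mem_nhdsGT (show (0 : ℝ) < 1 by norm_num)] with t ht
  exact key t ht.1 ht.2

lemma l1norm_update_add (b : Fin p → ℝ) (j : Fin p) (c : ℝ) :
    l1norm (b + Pi.single j c) = l1norm b - |b j| + |b j + c| := by
  rw [l1norm, l1norm, ← Finset.add_sum_erase _ _ (Finset.mem_univ j),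
    ← Finset.add_sum_erase _ (fun i => |b i|) (Finset.mem_univ j)]
  have : ∑ i ∈ Finset.univ.erase j, |(b + Pi.single j c : Fin p → ℝ) i| =
      ∑ i ∈ Finset.univ.erase j, |b i| :=
    Finset.sum_congr rfl fun i hi => by simp [Finset.ne_of_mem_erase hi]
  rw [this, Pi.add_apply, Pi.single_eq_same]; ring

lemma dot_mulVec_single (X : Matrix (Fin n) (Fin p) ℝ) (v : Fin n → ℝ) (j : Fin p) (c : ℝ) :
    v ⬝ᵥ (X *ᵥ Pi.single j c) = (v ⬝ᵥ X.col j) * c := by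
  rw [dot_mulVec_eq_sum, Finset.sum_eq_single j] <;> simp +contextual

lemma IsScaledLasso.abs_corr_le {X : Matrix (Fin n) (Fin p) ℝ} {y : Fin n → ℝ} {lam : ℝ}
    (hn : 1 ≤ n) (hlam : 0 ≤ lam) {b : Fin p → ℝ} {σ : ℝ} (h : IsScaledLasso X y lam b σ)
    (hσ : 0 < σ) (j : Fin p) : |(y - X *ᵥ b) ⬝ᵥ X.col j| ≤ n * (σ * lam) := by
  have hN : 0 ≤ n * (σ * lam) := by positivity
  have key : ∀ c : ℝ, |c| = 1 → ((y - X *ᵥ b) ⬝ᵥ X.col j) * c ≤ n * (σ * lam) := fun c hc => by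
    have h1 := h.variational hn hlam hσ (b + Pi.single j c)
    rw [add_sub_cancel_left, dot_mulVec_single, l1norm_update_add] at h1
    have h2 := abs_add_le (b j) c
    rw [hc] at h2
    refine h1.trans ((mul_le_mul_of_nonneg_left (by linarith) hN).trans_eq (mul_one _))
  have h1 := key 1 (by simp)
  have h2 := key (-1) (by simp)
  exact abs_le.2 ⟨by linarith, by linarith⟩

lemma IsScaledLasso.le_abs_corr {X : Matrix (Fin n) (Fin p) ℝ} {y : Fin n → ℝ} {lam : ℝ}
    (hn : 1 ≤ n) (hlam : 0 ≤ lam) {b : Fin p → ℝ} {σ : ℝ} (h : IsScaledLasso X y lam b σ)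
    (hσ : 0 < σ) {j : Fin p} (hj : b j ≠ 0) : n * (σ * lam) ≤ |(y - X *ᵥ b) ⬝ᵥ X.col j| := by
  have h1 := h.variational hn hlam hσ (b + Pi.single j (-b j))
  rw [add_sub_cancel_left, dot_mulVec_single, l1norm_update_add, add_neg_cancel, abs_zero] at h1
  have h2 : n * (σ * lam) * |b j| ≤ |(y - X *ᵥ b) ⬝ᵥ X.col j| * |b j| := by
    rw [← abs_mul]
    have := le_abs_self (((y - X *ᵥ b) ⬝ᵥ X.col j) * b j)
    linarith
  exact le_of_mul_le_mul_right h2 (abs_pos.2 hj)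

end Geometry

namespace Setup

/-! ### Error bounds for the scaled Lasso -/

lemma lamUniv_pos {D : Setup} (h : D.Standing) : 0 < D.lamUniv := by
  have hn : (0 : ℝ) < D.n := by exact_mod_cast h.one_le_n
  have hp : (1 : ℝ) < D.p := by exact_mod_cast (lt_of_lt_of_le one_lt_two h.two_le_p)
  exact Real.sqrt_pos.2 (mul_pos (by positivity) (Real.log_pos hp))

lemma lamUniv_le_rate {D : Setup} (h : D.Standing) : D.lamUniv ≤ D.rate := by
  have hp : (0 : ℝ) < D.p := by exact_mod_cast (lt_of_lt_of_le two_pos h.two_le_p)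
  refine Real.sqrt_le_sqrt (mul_le_mul_of_nonneg_left (Real.log_le_log hp ?_) (by positivity))
  rw [le_div_iff₀ h.eps_pos]
  nlinarith [h.eps_le_one]

/-- Capped-`ℓ₁` sparsity bounds the number of large coefficients and the size of the others. -/
lemma CappedSparse.small_sum_le {D : Setup} (h : D.Standing) (hs : D.CappedSparse) :
    (D.S.card : ℝ) ≤ D.s ∧
      ∑ j ∈ D.Sᶜ, |D.β j| ≤ D.σ * D.lamUniv * (D.s - D.S.card) := by
  have hk : 0 < D.σ * D.lamUniv := mul_pos h.sigma_pos (lamUniv_pos h)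
  have h1 : ∑ j ∈ D.S, min (|D.β j| / (D.σ * D.lamUniv)) 1 = D.S.card := by
    rw [Finset.sum_congr rfl (g := fun _ => (1 : ℝ)), Finset.sum_const, nsmul_eq_mul, mul_one]
    intro j hj
    have : D.σ * D.lamUniv < |D.β j| := by simpa [S] using hj
    exact min_eq_right ((one_le_div hk).2 this.le)
  have h2 : ∑ j ∈ D.Sᶜ, min (|D.β j| / (D.σ * D.lamUniv)) 1 =
      (∑ j ∈ D.Sᶜ, |D.β j|) / (D.σ * D.lamUniv) := by
    rw [Finset.sum_div]
    refine Finset.sum_congr rfl fun j hj => min_eq_left ?_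
    have : |D.β j| ≤ D.σ * D.lamUniv := by simpa [S] using hj
    exact (div_le_one hk).2 this
  have h3 : ∑ j, min (|D.β j| / (D.σ * D.lamUniv)) 1 ≤ D.s := hs
  rw [← Finset.sum_add_sum_compl D.S, h1, h2] at h3
  have h4 : 0 ≤ (∑ j ∈ D.Sᶜ, |D.β j|) / (D.σ * D.lamUniv) :=
    div_nonneg (Finset.sum_nonneg fun j _ => abs_nonneg _) hk.le
  refine ⟨by linarith, ?_⟩
  rw [← div_le_iff₀' hk]; linarith

lemma l1norm_sub_le {p : ℕ} (S : Finset (Fin p)) (b β : Fin p → ℝ) :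
    l1norm β - l1norm b ≤
      ∑ j ∈ S, |(b - β) j| - ∑ j ∈ Sᶜ, |(b - β) j| + 2 * ∑ j ∈ Sᶜ, |β j| := by
  rw [l1norm, l1norm, ← Finset.sum_add_sum_compl S, ← Finset.sum_add_sum_compl S (fun j => |b j|)]
  have h1 : ∑ j ∈ S, |β j| ≤ ∑ j ∈ S, |b j| + ∑ j ∈ S, |(b - β) j| := by
    rw [← Finset.sum_add_distrib]
    refine Finset.sum_le_sum fun j _ => ?_
    have := abs_sub_abs_le_abs_sub (β j) (b j)
    rw [Pi.sub_apply, abs_sub_comm (b j)]; linarith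
  have h2 : ∑ j ∈ Sᶜ, |(b - β) j| ≤ ∑ j ∈ Sᶜ, |b j| + ∑ j ∈ Sᶜ, |β j| := by
    rw [← Finset.sum_add_distrib]
    exact Finset.sum_le_sum fun j _ => abs_sub _ _
  linarith

lemma residual_eq (D : Setup) (e : Fin D.n → ℝ) (b : Fin D.p → ℝ) :
    D.y e - D.X *ᵥ b = e - D.X *ᵥ (b - D.β) := by
  rw [y, Matrix.mulVec_sub]; abel

lemma l2norm_noise {D : Setup} (hn : 1 ≤ D.n) (e : Fin D.n → ℝ) :
    l2norm e ^ 2 = D.n * D.sigStar e ^ 2 := by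
  have hn' : (0 : ℝ) < D.n := by exact_mod_cast hn
  rw [sigStar, div_pow, Real.sq_sqrt hn'.le]; field_simp

/-- The constant of the `ℓ₁` error bound for the scaled Lasso: the first term covers errors in the
cone, the second one errors outside of the cone. -/
def lassoConst (ξ c₀ θ : ℝ) : ℝ := 8 * ((1 + ξ) ^ 2 / c₀) + 4 * θ / ((1 - θ) - (1 + θ) / ξ)

/-- The lower bound for `σ` is the Cauchy–Schwarz inequality for `e` and the residual, the upper one
compares the values of the criterion at `b` and at `β`. -/
lemma scaledLasso_noise_le {D : Setup} (h : D.Standing) {lam θ : ℝ} (hlam : 0 ≤ lam)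
    (hθ1 : θ < 1) {e : Fin D.n → ℝ} (hS : 0 < D.sigStar e)
    (hz : ∀ j, |e ⬝ᵥ D.X.col j| ≤ D.n * (θ * (D.sigStar e * lam)))
    {b : Fin D.p → ℝ} {σ : ℝ} (hb : IsScaledLasso D.X (D.y e) lam b σ) :
    D.sigStar e - θ * (lam * l1norm (b - D.β)) ≤ σ ∧
      σ + lam * l1norm b ≤ D.sigStar e + lam * l1norm D.β ∧
      |σ - D.sigStar e| ≤ lam * l1norm (b - D.β) := by
  have hn' : (0 : ℝ) < D.n := by exact_mod_cast h.one_le_n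
  obtain ⟨hσ, hmin⟩ := hb.profile h.one_le_n hlam
  set H := l1norm (b - D.β) with hH
  have hH0 : 0 ≤ H := l1norm_nonneg _
  have hup : σ + lam * l1norm b ≤ D.sigStar e + lam * l1norm D.β := by
    have h1 := hmin D.β
    rw [← hσ, residual_eq, sub_self, Matrix.mulVec_zero, sub_zero] at h1
    exact h1
  have hlow : D.sigStar e - θ * (lam * H) ≤ σ := by
    have h1 := dot_le_l2norm_mul e (D.y e - D.X *ᵥ b)
    rw [residual_eq, dotProduct_sub, ← l2norm_sq_eq_dot, l2norm_noise h.one_le_n] at h1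
    have h2 := (le_abs_self _).trans (abs_dot_mulVec_le D.X e (b - D.β) hz)
    have h3 : l2norm e * l2norm (e - D.X *ᵥ (b - D.β)) = D.n * (D.sigStar e * σ) := by
      rw [hσ, residual_eq, sigStar]
      have := Real.mul_self_sqrt hn'.le
      have hs : 0 < Real.sqrt D.n := Real.sqrt_pos.2 hn'
      nth_rw 1 [← this]
      field_simp
    rw [h3] at h1
    have h4 : D.n * D.sigStar e * (D.sigStar e - θ * (lam * H)) ≤ D.n * D.sigStar e * σ := by
      nlinarith
    exact le_of_mul_le_mul_left h4 (by positivity)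
  refine ⟨hlow, hup, abs_le.2 ⟨?_, ?_⟩⟩
  · have : 0 ≤ lam * H := by positivity
    nlinarith
  · have h1 : l1norm D.β - l1norm b ≤ H := by
      have h2 := l1norm_sub_le Finset.univ b D.β
      simpa [hH, l1norm] using h2
    nlinarith

/-- The `ℓ₁` error bound. If the error is not in the cone, it is dominated by the small
coefficients; in the cone, the compatibility factor turns the bound
`‖X h‖² / n ≤ 4 σ* λ ‖h‖₁ + λ² ‖h‖₁²` into a bound for `‖h‖₁`. -/
lemma scaledLasso_l1_le {D : Setup} (h : D.Standing) (hsp : D.CappedSparse) {lam θ ξ c₀ : ℝ}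
    (hlam : 0 ≤ lam) (hθ0 : 0 < θ) (hθ1 : θ < 1) (hξ : 1 < ξ) (hξθ : 1 + θ < ξ * (1 - θ))
    (hc₀ : 0 < c₀) (hκ : ENNReal.ofReal c₀ ≤ compat D.X ξ D.S ^ 2)
    {e : Fin D.n → ℝ} (hS : 0 < D.sigStar e)
    (hz : ∀ j, |e ⬝ᵥ D.X.col j| ≤ D.n * (θ * (D.sigStar e * lam)))
    (hw : D.σ * D.lamUniv ≤ θ * (D.sigStar e * lam))
    (hsmall : (1 + ξ) ^ 2 / c₀ * (D.s * lam ^ 2) ≤ 1 / 2)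
    {b : Fin D.p → ℝ} {σ : ℝ} (hb : IsScaledLasso D.X (D.y e) lam b σ) :
    l1norm (b - D.β) ≤ lassoConst ξ c₀ θ * (D.s * (D.sigStar e * lam)) := by
  have hn' : (0 : ℝ) < D.n := by exact_mod_cast h.one_le_n
  have hs := h.s_pos
  obtain ⟨hlow, hup, -⟩ := scaledLasso_noise_le h hlam hθ1 hS hz hb
  obtain ⟨hσ, -⟩ := hb.profile h.one_le_n hlam
  obtain ⟨hk, hw0⟩ := hsp.small_sum_le h
  set u := b - D.β with hu
  set a := ∑ j ∈ D.S, |u j| with ha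
  set a' := ∑ j ∈ D.Sᶜ, |u j| with ha'
  have hH : l1norm u = a + a' := (Finset.sum_add_sum_compl D.S fun j => |u j|).symm
  have ha0 : 0 ≤ a := Finset.sum_nonneg fun j _ => abs_nonneg _
  have ha0' : 0 ≤ a' := Finset.sum_nonneg fun j _ => abs_nonneg _
  have hdiff := l1norm_sub_le D.S b D.β
  rw [← hu, ← ha, ← ha'] at hdiff
  set w := ∑ j ∈ D.Sᶜ, |D.β j|
  have hk0 : (0 : ℝ) ≤ D.S.card := Nat.cast_nonneg _
  have hσ0 : 0 ≤ σ := hb.1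
  have hSl : 0 ≤ D.sigStar e * lam := by positivity
  have hw1 : w ≤ θ * (D.s * (D.sigStar e * lam)) := by
    have : D.σ * D.lamUniv * (D.s - D.S.card) ≤ θ * (D.sigStar e * lam) * D.s :=
      mul_le_mul hw (by linarith) (by linarith) (by positivity)
    linarith
  have hγ : 0 < (1 - θ) - (1 + θ) / ξ := by
    rw [sub_pos, div_lt_iff₀ (by linarith)]; linarith
  set M := (1 + ξ) ^ 2 / c₀ with hM
  have hM0 : 0 ≤ M := by positivity
  have hT1 : 0 ≤ 8 * M * (D.s * (D.sigStar e * lam)) := by positivity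
  have hT2 : 0 ≤ 4 * θ / ((1 - θ) - (1 + θ) / ξ) * (D.s * (D.sigStar e * lam)) := by positivity
  rw [lassoConst, add_mul]
  rcases hlam.eq_or_lt with hl0 | hl0
  · -- with no penalty the noise bound and the size of `β` on `Sᶜ` force a contradiction
    exfalso
    have := mul_pos h.sigma_pos (lamUniv_pos h)
    rw [← hl0] at hw
    simp at hw; linarith
  rcases le_or_gt a' (ξ * a) with hcone | hcone
  · have hc := compat_sq_le D.X h.one_le_n hκ (show u ∈ cone ξ D.S from hcone)
    rw [← ha] at hc
    set P := l2norm (D.X *ᵥ u) ^ 2 with hP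
    have hP0 : 0 ≤ P := sq_nonneg _
    set H := l1norm u
    have hH0 : 0 ≤ H := l1norm_nonneg _
    have h1 : D.n * H ^ 2 ≤ M * D.s * P := by
      have h2 : H ≤ (1 + ξ) * a := by rw [hH]; linarith
      have h3 : c₀ * D.n * a ^ 2 ≤ P * D.s := hc.trans (mul_le_mul_of_nonneg_left hk hP0)
      have h4 : H ^ 2 ≤ (1 + ξ) ^ 2 * a ^ 2 := by
        rw [← mul_pow]; exact pow_le_pow_left₀ hH0 h2 2
      rw [hM, div_mul_eq_mul_div, div_mul_eq_mul_div, le_div_iff₀ hc₀]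
      calc D.n * H ^ 2 * c₀ ≤ D.n * ((1 + ξ) ^ 2 * a ^ 2) * c₀ := by gcongr
        _ = (1 + ξ) ^ 2 * (c₀ * D.n * a ^ 2) := by ring
        _ ≤ (1 + ξ) ^ 2 * (P * D.s) := by gcongr
        _ = _ := by ring
    have h5 : P ≤ D.n * (4 * (D.sigStar e * lam) * H + lam ^ 2 * H ^ 2) := by
      have h6 : D.n * σ ^ 2 = l2norm (e - D.X *ᵥ u) ^ 2 := by
        rw [hσ, residual_eq, div_pow, Real.sq_sqrt hn'.le, hu]; field_simp
      rw [l2norm_sub_sq, l2norm_noise h.one_le_n] at h6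
      have h7 := (le_abs_self _).trans (abs_dot_mulVec_le D.X e u hz)
      have h8 : σ ≤ D.sigStar e + lam * H := by
        have : l1norm D.β - l1norm b ≤ H := by
          have h2 := l1norm_sub_le Finset.univ b D.β
          simpa [H, hu, l1norm] using h2
        have := mul_le_mul_of_nonneg_left this hlam
        linarith
      have h9 : σ ^ 2 ≤ (D.sigStar e + lam * H) ^ 2 := pow_le_pow_left₀ hσ0 h8 2
      have h10 := mul_le_mul_of_nonneg_left h9 hn'.le
      have h11 : θ * (D.sigStar e * lam) * H ≤ D.sigStar e * lam * H := by
        have h12 : 0 ≤ D.sigStar e * lam * H := mul_nonneg hSl hH0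
        have := mul_le_of_le_one_left h12 hθ1.le
        linarith
      have h12 := mul_le_mul_of_nonneg_left h11 hn'.le
      linarith
    have h13 : H ^ 2 ≤ M * D.s * (4 * (D.sigStar e * lam) * H + lam ^ 2 * H ^ 2) := by
      have h14 := h1.trans (mul_le_mul_of_nonneg_left h5 (by positivity))
      have h15 : D.n * H ^ 2 ≤
          D.n * (M * D.s * (4 * (D.sigStar e * lam) * H + lam ^ 2 * H ^ 2)) := by linarith
      exact le_of_mul_le_mul_left h15 hn'
    have h16 : H * H ≤ H * (8 * M * (D.s * (D.sigStar e * lam))) := by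
      have := mul_le_mul_of_nonneg_right hsmall (sq_nonneg H)
      linarith
    rcases hH0.eq_or_lt with h0 | h0
    · linarith
    · have := le_of_mul_le_mul_left h16 h0
      linarith
  · have h1 : (1 - θ) * a' ≤ (1 + θ) * a + 2 * w := by
      have h2 : lam * (l1norm b - l1norm D.β) ≤ lam * (θ * (a + a')) := by
        rw [← hH]; linarith
      have h3 := le_of_mul_le_mul_left h2 hl0
      linarith
    have h2 : a ≤ a' / ξ := by rw [le_div_iff₀ (by linarith)]; linarith
    have h3 : ((1 - θ) - (1 + θ) / ξ) * a' ≤ 2 * w := by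
      have h4 : (1 + θ) * a ≤ (1 + θ) * (a' / ξ) :=
        mul_le_mul_of_nonneg_left h2 (by linarith)
      have h5 : (1 + θ) * (a' / ξ) = (1 + θ) / ξ * a' := by ring
      nlinarith
    have h6 : a ≤ a' := by nlinarith
    have h7 : l1norm u ≤ 2 * a' := by linarith
    have h8 : 2 * a' ≤ 4 * θ / ((1 - θ) - (1 + θ) / ξ) * (D.s * (D.sigStar e * lam)) := by
      rw [div_mul_eq_mul_div, le_div_iff₀ hγ]
      nlinarith
    linarith

/-! ### The size of the model selected by the scaled Lasso -/

/-- The arithmetic of the prediction error bound: `P` is the squared prediction error, `a` and `a'`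
are the `ℓ₁` norms of the error on the large and the small coefficients, `c` and `d` bound the
contributions of the large and the small coefficients to the sparsity index. -/
lemma prediction_bound {n l θ ξ k a a' c d P : ℝ} (hn : 0 < n) (hl : 0 ≤ l) (hθ0 : 0 < θ)
    (hθ1 : θ < 1) (hξθ : 1 + θ < ξ * (1 - θ)) (hk0 : 0 < k) (hk1 : k ≤ 1)
    (ha : 0 ≤ a) (ha' : 0 ≤ a') (hc : 0 ≤ c) (hd : 0 ≤ d) (hP : 0 ≤ P)
    (hcone : a' ≤ ξ * a → k * n * a ^ 2 ≤ P * c)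
    (hbasic : P ≤ n * l * ((1 + θ) * a - (1 - θ) * a' + 2 * (θ * l * d))) :
    k * P ≤ n * ((1 + θ) ^ 2 * l ^ 2 * (c + d)) := by
  have hθ : 0 ≤ 1 - θ := by linarith
  have hnl : 0 ≤ n * l := mul_nonneg hn.le hl
  have hdd : 0 ≤ n * l ^ 2 * d := by positivity
  have h4θ : k * (4 * θ) ≤ (1 + θ) ^ 2 := by nlinarith [sq_nonneg (1 - θ)]
  have hdd' : k * (4 * θ) * (n * l ^ 2 * d) ≤ (1 + θ) ^ 2 * (n * l ^ 2 * d) :=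
    mul_le_mul_of_nonneg_right h4θ hdd
  rcases le_or_gt a' (ξ * a) with h | h
  · have hcc := hcone h
    obtain ⟨E, hE⟩ : ∃ E, E = n * l * ((1 + θ) * a) := ⟨_, rfl⟩
    obtain ⟨F, hF⟩ : ∃ F, F = n * ((1 + θ) ^ 2 * l ^ 2 * c) := ⟨_, rfl⟩
    have hF0 : 0 ≤ F := by rw [hF]; positivity
    have h1 : k * E ≤ (k * P + F) / 2 := by
      refine abs_le_of_sq_le_sq' ?_ (by positivity) |>.2
      have h2 : (k * E) ^ 2 ≤ k * P * F := by
        have e1 : (k * E) ^ 2 = k * n * (1 + θ) ^ 2 * l ^ 2 * (k * n * a ^ 2) := by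
          rw [hE]; ring
        have e2 : k * P * F = k * n * (1 + θ) ^ 2 * l ^ 2 * (P * c) := by rw [hF]; ring
        rw [e1, e2]
        exact mul_le_mul_of_nonneg_left hcc (by positivity)
      have h3 := sq_nonneg (k * P - F)
      linarith
    have h3 : P ≤ E + 2 * θ * (n * l ^ 2 * d) := by
      have : 0 ≤ n * l * ((1 - θ) * a') := mul_nonneg hnl (mul_nonneg hθ ha')
      rw [hE]; linarith
    have h4 := mul_le_mul_of_nonneg_left h3 hk0.le
    have e3 : n * ((1 + θ) ^ 2 * l ^ 2 * (c + d)) = F + (1 + θ) ^ 2 * (n * l ^ 2 * d) := by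
      rw [hF]; ring
    rw [e3]
    linarith
  · have h1 : (1 + θ) * a ≤ (1 - θ) * a' := by
      have h2 : (1 - θ) * (ξ * a) ≤ (1 - θ) * a' := mul_le_mul_of_nonneg_left h.le hθ
      have h3 : (1 + θ) * a ≤ ξ * (1 - θ) * a := mul_le_mul_of_nonneg_right hξθ.le ha
      linarith
    have h2 := mul_le_mul_of_nonneg_left h1 hnl
    have h3 : P ≤ 2 * θ * (n * l ^ 2 * d) := by linarith
    have h4 := mul_le_mul_of_nonneg_left h3 hk0.le
    have h5 : 0 ≤ (1 + θ) ^ 2 * (n * l ^ 2 * c) := by positivity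
    have h6 : 0 ≤ k * (2 * θ * (n * l ^ 2 * d)) := by positivity
    linarith

/-- The prediction error bound with a sharp constant. The small coefficients contribute
`2 θ λ² (s - |S|)`, which fits into the same constant as the large ones since `4 θ ≤ (1 + θ)²`. -/
lemma scaledLasso_prediction_le {D : Setup} (h : D.Standing) (hsp : D.CappedSparse)
    {lam θ ξ k : ℝ} (hlam : 0 ≤ lam) (hθ0 : 0 < θ) (hξθ : 1 + θ < ξ * (1 - θ))
    (hθ1 : θ < 1) (hk0 : 0 < k) (hk1 : k ≤ 1)
    (hκ : ENNReal.ofReal k ≤ compat D.X ξ D.S ^ 2) {e : Fin D.n → ℝ}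
    {b : Fin D.p → ℝ} {σ : ℝ} (hb : IsScaledLasso D.X (D.y e) lam b σ) (hσ : 0 < σ)
    (hz : ∀ j, |e ⬝ᵥ D.X.col j| ≤ D.n * (θ * (σ * lam)))
    (hw : D.σ * D.lamUniv ≤ θ * (σ * lam)) :
    k * l2norm (D.X *ᵥ (b - D.β)) ^ 2 ≤ D.n * ((1 + θ) ^ 2 * (σ * lam) ^ 2 * D.s) := by
  have hn' : (0 : ℝ) < D.n := by exact_mod_cast h.one_le_n
  obtain ⟨hcard, hw0⟩ := hsp.small_sum_le h
  have hvar := hb.variational h.one_le_n hlam hσ D.β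
  set lm := σ * lam with hlm
  have hlm0 : 0 ≤ lm := by positivity
  set u := b - D.β with hu
  have hneg : D.β - b = -u := by rw [hu]; abel
  rw [residual_eq, ← hu, hneg, Matrix.mulVec_neg, dotProduct_neg, sub_dotProduct,
    ← l2norm_sq_eq_dot] at hvar
  set P := l2norm (D.X *ᵥ u) ^ 2 with hP
  have hP0 : 0 ≤ P := sq_nonneg _
  set a := ∑ j ∈ D.S, |u j| with ha
  set a' := ∑ j ∈ D.Sᶜ, |u j| with ha'
  have hH : l1norm u = a + a' := (Finset.sum_add_sum_compl D.S fun j => |u j|).symm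
  have ha0 : 0 ≤ a := Finset.sum_nonneg fun j _ => abs_nonneg _
  have ha0' : 0 ≤ a' := Finset.sum_nonneg fun j _ => abs_nonneg _
  have hdiff := l1norm_sub_le D.S b D.β
  rw [← hu, ← ha, ← ha'] at hdiff
  have hcorr := (le_abs_self _).trans (abs_dot_mulVec_le D.X e u hz)
  rw [hH] at hcorr
  have hw1 : ∑ j ∈ D.Sᶜ, |D.β j| ≤ θ * lm * (D.s - D.S.card) :=
    hw0.trans (mul_le_mul_of_nonneg_right hw (by linarith))
  have hbasic : P ≤ D.n * lm * ((1 + θ) * a - (1 - θ) * a' +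
      2 * (θ * lm * (D.s - D.S.card))) := by
    have h1 : D.n * lm * (l1norm D.β - l1norm b) ≤
        D.n * lm * (a - a' + 2 * (θ * lm * (D.s - D.S.card))) :=
      mul_le_mul_of_nonneg_left (by linarith) (by positivity)
    linarith
  have := prediction_bound hn' hlm0 hθ0 hθ1 hξθ hk0 hk1 ha0 ha0'
    (Nat.cast_nonneg D.S.card) (sub_nonneg.2 hcard) hP0
    (fun hcone => compat_sq_le D.X h.one_le_n hκ (show u ∈ cone ξ D.S from hcone)) hbasic
  rwa [add_sub_cancel] at this

/-- The sparse eigenvalue condition in real terms. -/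
lemma SparseEig.exists_real {D : Setup} {ξ c₀ c₁ K : ℝ} (hξ : 1 < ξ) (hc₀ : 0 < c₀)
    (hK : 0 < K) (hκ : ENNReal.ofReal c₀ ≤ compat D.X ξ D.S ^ 2) (h : D.SparseEig ξ c₁ K) :
    ∃ (m : ℕ) (k φ : ℝ), K * D.s ≤ m ∧ 0 < k ∧ k ≤ 1 ∧ 0 ≤ φ ∧
      ENNReal.ofReal k ≤ compat D.X ξ D.S ^ 2 ∧ ξ ^ 2 * φ ≤ K * k ∧
      (∀ B : Finset (Fin D.p), Disjoint B D.S → B.card ≤ m →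
        eigMax (gram D.X B) ≤ ENNReal.ofReal φ) ∧
      ∀ B : Finset (Fin D.p), D.S ⊆ B → (B \ D.S).card ≤ m →
        ENNReal.ofReal c₁ ≤ eigMin (gram D.X B) := by
  obtain ⟨m, -, hm, h1, h2⟩ := h
  set q := min (compat D.X ξ D.S ^ 2) 1 with hq
  have hq1 : q ≤ 1 := min_le_right _ _
  have hqt : q ≠ ⊤ := ne_top_of_le_ne_top ENNReal.one_ne_top hq1
  have hq0 : 0 < q := lt_min ((ENNReal.ofReal_pos.2 hc₀).trans_le hκ) one_pos
  have hk0 : 0 < q.toReal := ENNReal.toReal_pos hq0.ne' hqt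
  have hkq : ENNReal.ofReal q.toReal = q := ENNReal.ofReal_toReal hqt
  set Φ := sparseEigMax D.X m D.S with hΦ
  have hξ2 : 0 < ξ ^ 2 := by positivity
  have hΦt : Φ ≠ ⊤ := by
    intro ht
    rw [ht, ENNReal.div_top, nonpos_iff_eq_zero, ENNReal.div_eq_zero_iff] at h1
    rcases h1 with h1 | h1
    · rw [ENNReal.ofReal_eq_zero] at h1; linarith
    · exact hqt h1
  have hφ : ENNReal.ofReal Φ.toReal = Φ := ENNReal.ofReal_toReal hΦt
  refine ⟨m, q.toReal, Φ.toReal, hm, hk0, ?_, ENNReal.toReal_nonneg, ?_, ?_, ?_, ?_⟩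
  · exact ENNReal.toReal_le_of_le_ofReal one_pos.le (by simpa using hq1)
  · rw [hkq]; exact min_le_left _ _
  · rcases (ENNReal.toReal_nonneg (a := Φ)).eq_or_lt with h0 | h0
    · rw [← h0]; nlinarith
    · rw [← hkq, ← hφ, ← ENNReal.ofReal_div_of_pos hk0, ← ENNReal.ofReal_div_of_pos h0,
        ENNReal.ofReal_le_ofReal_iff (by positivity), div_le_div_iff₀ hk0 h0] at h1
      exact h1
  · intro B hB hBm
    rw [hφ]
    exact le_iSup₂ (f := fun (B : Finset (Fin D.p)) (_ : Disjoint B D.S ∧ B.card ≤ m) =>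
      eigMax (gram D.X B)) B ⟨hB, hBm⟩
  · intro B hB hBm
    exact h2.trans (iInf₂_le (f := fun (B : Finset (Fin D.p))
      (_ : D.S ⊆ B ∧ (B \ D.S).card ≤ m) => eigMin (gram D.X B)) B ⟨hB, hBm⟩)

/-- A set of at most `m` falsely selected variables has fewer than `K s` elements: each of them has
correlation at least `(1 - θ) λ n` with `X (b - β)`, while the prediction error bounds the sum of
the squares of these correlations. -/
lemma card_lt_of_selected {D : Setup} (h : D.Standing) (hsp : D.CappedSparse)
    {lam θ ξ k K φ : ℝ} (hlam : 0 < lam) (hθ0 : 0 < θ) (hξθ : 1 + θ < ξ * (1 - θ)) (hξ : 1 < ξ)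
    (hθ1 : θ < 1) (hk0 : 0 < k) (hk1 : k ≤ 1) (hK : 0 < K) (hφ : 0 ≤ φ)
    (hκ : ENNReal.ofReal k ≤ compat D.X ξ D.S ^ 2) (hφk : ξ ^ 2 * φ ≤ K * k)
    {e : Fin D.n → ℝ}
    {b : Fin D.p → ℝ} {σ : ℝ} (hb : IsScaledLasso D.X (D.y e) lam b σ) (hσ : 0 < σ)
    (hz : ∀ j, |e ⬝ᵥ D.X.col j| ≤ D.n * (θ * (σ * lam)))
    (hw : D.σ * D.lamUniv ≤ θ * (σ * lam)) {B : Finset (Fin D.p)}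
    (hB : ∀ j ∈ B, b j ≠ 0) (hBφ : eigMax (gram D.X B) ≤ ENNReal.ofReal φ) :
    (B.card : ℝ) < K * D.s := by
  have hn' : (0 : ℝ) < D.n := by exact_mod_cast h.one_le_n
  have hpred := scaledLasso_prediction_le h hsp hlam.le hθ0 hξθ hθ1 hk0 hk1 hκ hb hσ hz hw
  set lm := σ * lam with hlm
  have hlm0 : 0 < lm := by positivity
  set v := D.X *ᵥ (b - D.β) with hv
  have h1θ : 0 < 1 - θ := by linarith
  have hcol : ∀ j ∈ B, (D.n * ((1 - θ) * lm)) ^ 2 ≤ (v ⬝ᵥ D.X.col j) ^ 2 := by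
    intro j hj
    have h1 := hb.le_abs_corr h.one_le_n hlam.le hσ (hB j hj)
    rw [residual_eq, ← hv, sub_dotProduct] at h1
    have h2 := abs_sub (e ⬝ᵥ D.X.col j) (v ⬝ᵥ D.X.col j)
    have h3 : D.n * ((1 - θ) * lm) ≤ |v ⬝ᵥ D.X.col j| := by
      have := hz j
      nlinarith
    rw [← sq_abs (v ⬝ᵥ D.X.col j)]
    exact pow_le_pow_left₀ (by positivity) h3 2
  have h4 : (B.card : ℝ) * (D.n * ((1 - θ) * lm)) ^ 2 ≤ D.n * φ * l2norm v ^ 2 := by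
    refine le_trans ?_ (sum_sq_dot_col_le D.X h.one_le_n hφ hBφ v)
    rw [← nsmul_eq_mul]
    exact Finset.card_nsmul_le_sum _ _ _ hcol
  -- multiply by `k ξ²` and cancel `k (n λ)²`
  have h5 : (B.card : ℝ) * (ξ * (1 - θ)) ^ 2 ≤ (1 + θ) ^ 2 * (K * D.s) := by
    have h6 : (B.card : ℝ) * (ξ * (1 - θ)) ^ 2 * (k * (D.n * lm) ^ 2) ≤
        (1 + θ) ^ 2 * (K * D.s) * (k * (D.n * lm) ^ 2) := by
      calc (B.card : ℝ) * (ξ * (1 - θ)) ^ 2 * (k * (D.n * lm) ^ 2)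
          = k * ξ ^ 2 * (B.card * (D.n * ((1 - θ) * lm)) ^ 2) := by ring
        _ ≤ k * ξ ^ 2 * (D.n * φ * l2norm v ^ 2) := by gcongr
        _ = (ξ ^ 2 * φ) * D.n * (k * l2norm v ^ 2) := by ring
        _ ≤ (K * k) * D.n * (D.n * ((1 + θ) ^ 2 * lm ^ 2 * D.s)) := by gcongr
        _ = _ := by ring
    exact le_of_mul_le_mul_right h6 (by positivity)
  have h7 : (1 + θ) ^ 2 < (ξ * (1 - θ)) ^ 2 := pow_lt_pow_left₀ hξθ (by linarith) two_ne_zero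
  have hKs : 0 < K * D.s := mul_pos hK h.s_pos
  by_contra hne
  rw [not_lt] at hne
  have h8 : (1 + θ) ^ 2 * (K * D.s) < (ξ * (1 - θ)) ^ 2 * (K * D.s) :=
    mul_lt_mul_of_pos_right h7 hKs
  have h9 : (ξ * (1 - θ)) ^ 2 * (K * D.s) ≤ (ξ * (1 - θ)) ^ 2 * B.card :=
    mul_le_mul_of_nonneg_left hne (sq_nonneg _)
  linarith

lemma card_falsely_selected_le {D : Setup} (h : D.Standing) (hsp : D.CappedSparse)
    {lam θ ξ k K φ : ℝ} {m : ℕ} (hlam : 0 < lam) (hθ0 : 0 < θ) (hξθ : 1 + θ < ξ * (1 - θ))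
    (hξ : 1 < ξ) (hθ1 : θ < 1) (hk0 : 0 < k) (hk1 : k ≤ 1) (hK : 0 < K) (hφ : 0 ≤ φ)
    (hκ : ENNReal.ofReal k ≤ compat D.X ξ D.S ^ 2) (hφk : ξ ^ 2 * φ ≤ K * k)
    (hm : K * D.s ≤ m)
    (hmax : ∀ B : Finset (Fin D.p), Disjoint B D.S → B.card ≤ m →
        eigMax (gram D.X B) ≤ ENNReal.ofReal φ) {e : Fin D.n → ℝ}
    {b : Fin D.p → ℝ} {σ : ℝ} (hb : IsScaledLasso D.X (D.y e) lam b σ) (hσ : 0 < σ)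
    (hz : ∀ j, |e ⬝ᵥ D.X.col j| ≤ D.n * (θ * (σ * lam)))
    (hw : D.σ * D.lamUniv ≤ θ * (σ * lam)) :
    (supp b \ D.S).card ≤ m ∧ ((supp b \ D.S).card : ℝ) ≤ K * D.s := by
  have key : ∀ B ⊆ supp b \ D.S, B.card ≤ m → (B.card : ℝ) < K * D.s := fun B hB hBm => by
    refine card_lt_of_selected h hsp hlam hθ0 hξθ hξ hθ1 hk0 hk1 hK hφ hκ hφk hb hσ hz hw
      (fun j hj => ?_) (hmax B ?_ hBm)
    · have := (Finset.mem_sdiff.1 (hB hj)).1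
      simpa [supp] using this
    · exact Finset.disjoint_left.2 fun j hj => (Finset.mem_sdiff.1 (hB hj)).2
  have hlt : (supp b \ D.S).card ≤ m := by
    by_contra hne
    obtain ⟨B, hB, hcard⟩ := Finset.exists_subset_card_eq (not_le.1 hne).le
    have := key B hB hcard.le
    rw [hcard] at this
    linarith
  exact ⟨hlt, (key _ subset_rfl hlt).le⟩

/-! ### Error bounds for least squares after the scaled Lasso -/

/-- Least squares in the selected model `T` differs from the scaled Lasso by at most
`2 λ |T| / c₁` in the `ℓ₁` norm, and lowers the residual sum of squares only slightly. -/
lemma lse_sub_lasso_le {D : Setup} (h : D.Standing) {lam c₁ : ℝ} (hlam : 0 < lam)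
    (hc₁ : 0 < c₁) {e : Fin D.n → ℝ}
    {b : Fin D.p → ℝ} {σ : ℝ} (hb : IsScaledLasso D.X (D.y e) lam b σ) (hσ : 0 < σ)
    (hmin : ENNReal.ofReal c₁ ≤ eigMin (gram D.X (D.S ∪ supp b)))
    {b' : Fin D.p → ℝ} {σ' : ℝ} (hT : ((supp b).card : ℝ) < D.n)
    (hb' : IsModelLSE D.X (D.y e) (supp b) b' σ') :
    l1norm (b' - b) ≤ 2 * (σ * lam) * (supp b).card / c₁ ∧
      ((D.n : ℝ) - (supp b).card) * σ' ^ 2 ≤ D.n * σ ^ 2 ∧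
      D.n * σ ^ 2 - 2 * D.n * (σ * lam) * l1norm (b' - b) ≤
        ((D.n : ℝ) - (supp b).card) * σ' ^ 2 := by
  have hn' : (0 : ℝ) < D.n := by exact_mod_cast h.one_le_n
  obtain ⟨hσ', hsup', hls⟩ := hb'.profile hT
  obtain ⟨hσe, -⟩ := hb.profile h.one_le_n hlam.le
  set r := D.y e - D.X *ᵥ b with hr
  set g := b' - b with hg
  have hsup : ∀ j, j ∉ supp b → b j = 0 := fun j hj => by simpa [supp] using hj
  have hgs : ∀ j, j ∉ supp b → g j = 0 := fun j hj => by
    rw [hg, Pi.sub_apply, hsup' j hj, hsup j hj, sub_zero]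
  have hres : D.y e - D.X *ᵥ b' = r - D.X *ᵥ g := by
    rw [hr, hg, Matrix.mulVec_sub]; abel
  have h1 : l2norm (r - D.X *ᵥ g) ^ 2 ≤ l2norm r ^ 2 := by
    rw [← hres]; exact pow_le_pow_left₀ (l2norm_nonneg _) (hls b hsup) 2
  have hr2 : l2norm r ^ 2 = D.n * σ ^ 2 := by
    rw [hσe, div_pow, Real.sq_sqrt hn'.le]; field_simp
  have hN : 0 < (D.n : ℝ) - (supp b).card := by linarith
  have hr2' : l2norm (r - D.X *ᵥ g) ^ 2 = ((D.n : ℝ) - (supp b).card) * σ' ^ 2 := by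
    rw [hσ', hres, div_pow, Real.sq_sqrt hN.le]; field_simp
  have h2 := l2norm_sub_sq r (D.X *ᵥ g)
  have h3 := (le_abs_self _).trans
    (abs_dot_mulVec_le D.X r g (hb.abs_corr_le h.one_le_n hlam.le hσ))
  set G := l1norm g
  have hG0 : 0 ≤ G := l1norm_nonneg _
  have hX : 0 ≤ l2norm (D.X *ᵥ g) ^ 2 := sq_nonneg _
  refine ⟨?_, by rw [← hr2', ← hr2]; exact h1, by rw [← hr2', ← hr2]; linarith⟩
  have h4 := sum_sq_le_of_le_eigMin D.X h.one_le_n hc₁ hmin (u := g) fun j hj =>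
    hgs j fun hj' => hj (Finset.mem_union_right _ hj')
  have h5 := l1norm_sq_le_card hgs
  have h6 : c₁ * D.n * G ^ 2 ≤ (supp b).card * (2 * (D.n * (σ * lam) * G)) := by
    calc c₁ * D.n * G ^ 2 ≤ c₁ * D.n * ((supp b).card * ∑ j, g j ^ 2) := by gcongr
      _ = (supp b).card * (c₁ * D.n * ∑ j, g j ^ 2) := by ring
      _ ≤ (supp b).card * (2 * (D.n * (σ * lam) * G)) := by
          refine mul_le_mul_of_nonneg_left ?_ (Nat.cast_nonneg _)
          linarith
  rw [le_div_iff₀ hc₁]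
  rcases hG0.eq_or_lt with h0 | h0
  · rw [← h0, zero_mul]; positivity
  · have h7 : D.n * G * (G * c₁) ≤ D.n * G * (2 * (σ * lam) * (supp b).card) := by linarith
    exact le_of_mul_le_mul_left h7 (by positivity)

/-! ### The good event for the noise -/

/-- The event that the oracle noise level does not underestimate `σ` by more than a factor `1 + δ`
and that the noise has correlation at most `(1 + δ) σ* √((2/n) log (p/ε))` with each variable. -/
def goodNoise (D : Setup) (δ : ℝ) : Set (Fin D.n → ℝ) :=
  {e | D.σ ≤ (1 + δ) * D.sigStar e ∧
    ∀ j, |e ⬝ᵥ D.X.col j| ≤ D.n * (D.sigStar e * ((1 + δ) * D.rate))}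

lemma goodNoise_compl_le {D : Setup} (h : D.Standing) {δ : ℝ} (hδ : 0 < δ) :
    D.P.real (D.goodNoise δ)ᶜ ≤ chiBase (((1 + δ)⁻¹) ^ 2) ^ D.n +
      D.p * Real.exp (-(((D.n : ℝ) - 1) * ((1 + δ) ^ 2 * D.rate ^ 2) / 2)) := by
  have hn' : (0 : ℝ) < D.n := by exact_mod_cast h.one_le_n
  have hsn := Real.sqrt_pos.2 hn'
  have hcol : ∀ j, l2norm (D.X.col j) = Real.sqrt D.n := fun j => by
    rw [l2norm]; exact congrArg _ (h.standardized j)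
  set w := Real.sqrt D.n * ((1 + δ) * D.rate) with hw
  have hr := rate_pos h
  have hw0 : 0 ≤ w := by positivity
  have hsub : (D.goodNoise δ)ᶜ ⊆ {e | D.sigStar e ≤ (1 + δ)⁻¹ * D.σ} ∪
      ⋃ j, {e | w * D.sigStar e ≤ |(D.X.col j ⬝ᵥ e) / l2norm (D.X.col j)|} := by
    intro e he
    by_contra hne
    simp only [Set.mem_union, Set.mem_iUnion, Set.mem_ofPred_eq, not_or, not_exists, not_le] at hne
    refine he ⟨?_, fun j => ?_⟩
    · have := hne.1
      rw [inv_mul_lt_iff₀ (by linarith)] at this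
      exact this.le
    · have h1 := (hne.2 j).le
      rw [hcol, abs_div, abs_of_pos hsn, div_le_iff₀ hsn, dotProduct_comm] at h1
      refine h1.trans_eq ?_
      calc w * D.sigStar e * Real.sqrt D.n
          = (Real.sqrt D.n * Real.sqrt D.n) * (D.sigStar e * ((1 + δ) * D.rate)) := by
            rw [hw]; ring
        _ = _ := by rw [Real.mul_self_sqrt hn'.le]
  refine (measureReal_mono hsub).trans ((measureReal_union_le _ _).trans (add_le_add ?_ ?_))
  · exact D.noise_level_lower h.one_le_n h.sigma_pos (by positivity)
      (inv_lt_one_of_one_lt₀ (by linarith))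
  · refine (measureReal_iUnion_fintype_le _).trans ?_
    refine (Finset.sum_le_card_nsmul _ _ _ fun j _ =>
      D.noise_sphere_tail h.one_le_n h.sigma_pos (by rw [hcol]; exact hsn) hw0).trans ?_
    rw [Finset.card_univ, Fintype.card_fin, nsmul_eq_mul]
    refine le_of_eq ?_
    congr 3
    rw [hw, mul_pow, Real.sq_sqrt hn'.le]
    field_simp

/-- The good event has probability at least `1 - ε` as soon as `(2/n) log (p/ε)` is small. The
slack `δ` gains a factor `(ε/p)^δ ≤ 2^{-δ}` in the bound for the correlations; the rest is left for
the deviation of the noise level, which is exponentially small in `n`. -/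
lemma exists_goodNoise_compl_le {δ : ℝ} (hδ : 0 < δ) :
    ∃ μ : ℝ, 0 < μ ∧ ∀ D : Setup, D.Standing → D.rate ^ 2 ≤ μ →
      D.P.real (D.goodNoise δ)ᶜ ≤ D.ε := by
  have hl2 := Real.log_pos one_lt_two
  have hinv : (1 + δ)⁻¹ < 1 := inv_lt_one_of_one_lt₀ (by linarith)
  have hinv0 : 0 < (1 + δ)⁻¹ := by positivity
  have hsq : ((1 + δ)⁻¹) ^ 2 < 1 := pow_lt_one₀ hinv0.le hinv two_ne_zero
  have hq0 : 0 < chiBase (((1 + δ)⁻¹) ^ 2) := chiBase_pos (by positivity)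
  have hq1 : chiBase (((1 + δ)⁻¹) ^ 2) < 1 := chiBase_lt_one (by positivity) hsq.ne
  set q := chiBase (((1 + δ)⁻¹) ^ 2) with hq
  have hc : 0 < -Real.log q := by linarith [Real.log_neg hq0 hq1]
  set c := -Real.log q with hcdef
  set t := Real.exp (-(δ * Real.log 2)) with ht
  have ht1 : t < 1 := by rw [ht, Real.exp_lt_one_iff]; nlinarith
  have ht0 : 0 < t := Real.exp_pos _
  set N := -Real.log (1 - t) / Real.log 2 with hN
  have hN0 : 0 ≤ N :=
    div_nonneg (by linarith [Real.log_nonpos (by linarith : 0 ≤ 1 - t) (by linarith)]) hl2.le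
  refine ⟨min (2 * c / (1 + N)) (2 * Real.log 2 * δ / (1 + δ)), by positivity, fun D h hD => ?_⟩
  obtain ⟨hD1, hD2⟩ := le_min_iff.1 hD
  refine (goodNoise_compl_le h hδ).trans ?_
  have hL := log_ratio_pos h
  have hn' : (0 : ℝ) < D.n := by exact_mod_cast h.one_le_n
  have hn1 : (1 : ℝ) ≤ D.n := by exact_mod_cast h.one_le_n
  have hp' : (1 : ℝ) ≤ D.p := by exact_mod_cast (one_le_two.trans h.two_le_p)
  have hε := h.eps_pos
  have hexpL : Real.exp (-Real.log (D.p / D.ε)) = D.ε / D.p := by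
    rw [Real.exp_neg, Real.exp_log (by positivity), inv_div]
  rw [rate_sq h] at hD1 hD2 ⊢
  set L := Real.log (D.p / D.ε) with hLdef
  rw [div_mul_eq_mul_div, le_div_iff₀ (by linarith), div_mul_eq_mul_div,
    div_le_iff₀ hn'] at hD1
  rw [div_mul_eq_mul_div, le_div_iff₀ (by linarith), div_mul_eq_mul_div,
    div_le_iff₀ hn'] at hD2
  have h1 : D.p * Real.exp (-(((D.n : ℝ) - 1) * ((1 + δ) ^ 2 * (2 / D.n * L)) / 2)) ≤
      D.ε * t := by
    have h2 : (1 + δ) * L ≤ ((D.n : ℝ) - 1) * ((1 + δ) ^ 2 * (2 / D.n * L)) / 2 := by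
      have h3 : ((D.n : ℝ) - 1) * ((1 + δ) ^ 2 * (2 / D.n * L)) / 2 =
          (1 + δ) * L * (((D.n : ℝ) - 1) * (1 + δ) / D.n) := by field_simp
      rw [h3]
      refine le_mul_of_one_le_right (mul_nonneg (by linarith) (by linarith)) ?_
      rw [le_div_iff₀ hn']
      have h4 : Real.log 2 * (1 + δ) ≤ Real.log 2 * (δ * D.n) := by nlinarith
      have := le_of_mul_le_mul_left h4 hl2
      linarith
    calc D.p * Real.exp (-(((D.n : ℝ) - 1) * ((1 + δ) ^ 2 * (2 / D.n * L)) / 2))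
        ≤ D.p * Real.exp (-L + -(δ * Real.log 2)) := by
          gcongr
          have := mul_le_mul_of_nonneg_left hL hδ.le
          linarith
      _ = D.ε * t := by rw [Real.exp_add, hexpL, ht]; field_simp
  have h5 : q ^ D.n ≤ D.ε * (1 - t) := by
    calc q ^ D.n = Real.exp (-(c * D.n)) := by
          rw [hcdef, neg_mul, neg_neg, mul_comm, Real.exp_nat_mul, Real.exp_log hq0]
      _ ≤ Real.exp (-L + -(N * Real.log 2)) := by
          gcongr
          have := mul_le_mul_of_nonneg_left hL hN0
          linarith
      _ = D.ε / D.p * (1 - t) := by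
          rw [Real.exp_add, hexpL, hN, div_mul_cancel₀ _ hl2.ne', neg_neg,
            Real.exp_log (by linarith)]
      _ ≤ D.ε * (1 - t) :=
          mul_le_mul_of_nonneg_right (div_le_self hε.le hp') (by linarith)
  linarith

/-- Since `A > (ξ + 1) / (ξ - 1)`, the penalty leaves room for a factor `1 + δ` on the noise and a
factor `1 - δ` on its level. -/
lemma exists_penalty_slack {A ξ : ℝ} (hξ : 1 < ξ) (hA : (ξ + 1) / (ξ - 1) < A) :
    ∃ θ δ : ℝ, 0 < θ ∧ θ < 1 ∧ 1 + θ < ξ * (1 - θ) ∧ 0 < δ ∧ δ < 1 ∧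
      1 + δ ≤ θ * (1 - δ) * A := by
  have hξ' : 0 < ξ - 1 := by linarith
  have hA0 : 0 < A := lt_trans (by positivity) hA
  rw [div_lt_iff₀ hξ'] at hA
  have h1 : 1 / A < (ξ - 1) / (ξ + 1) := by
    rw [div_lt_div_iff₀ hA0 (by linarith)]; linarith
  obtain ⟨θ, h2, h3⟩ := exists_between h1
  have hθ0 : 0 < θ := lt_trans (by positivity) h2
  rw [lt_div_iff₀ (by linarith)] at h3
  rw [div_lt_iff₀ hA0] at h2
  refine ⟨θ, (θ * A - 1) / (θ * A + 1), hθ0, ?_, by linarith, ?_, ?_, ?_⟩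
  · by_contra hne
    nlinarith
  · exact div_pos (by linarith) (by linarith)
  · rw [div_lt_one (by linarith)]; linarith
  · have h4 : θ * A + 1 ≠ 0 := by linarith
    refine le_of_eq ?_
    field_simp
    ring

lemma goodNoise_bounds {D : Setup} (h : D.Standing) {A θ δ : ℝ} (hδ : 0 < δ)
    (hA : 1 + δ ≤ θ * (1 - δ) * A) {e : Fin D.n → ℝ} (he : e ∈ D.goodNoise δ) :
    0 < D.sigStar e ∧
      (∀ j, |e ⬝ᵥ D.X.col j| ≤ D.n * (θ * ((1 - δ) * D.sigStar e * (A * D.rate)))) ∧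
      D.σ * D.lamUniv ≤ θ * ((1 - δ) * D.sigStar e * (A * D.rate)) := by
  have hr := rate_pos h
  have hS : 0 < D.sigStar e := by
    have h1 := h.sigma_pos.trans_le he.1
    exact pos_of_mul_pos_right h1 (by linarith)
  have hkey : D.sigStar e * ((1 + δ) * D.rate) ≤
      θ * ((1 - δ) * D.sigStar e * (A * D.rate)) := by
    have := mul_le_mul_of_nonneg_right hA (mul_pos hS hr).le
    linarith
  refine ⟨hS, fun j => (he.2 j).trans (mul_le_mul_of_nonneg_left hkey (Nat.cast_nonneg _)), ?_⟩
  refine le_trans ?_ hkey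
  calc D.σ * D.lamUniv ≤ (1 + δ) * D.sigStar e * D.rate :=
        mul_le_mul he.1 (lamUniv_le_rate h) (lamUniv_pos h).le (by positivity)
    _ = _ := by ring

lemma Common.rate_le {D : Setup} {ξ c₀ μ : ℝ} (h : D.Common ξ c₀ μ) :
    D.rate ^ 2 ≤ μ ∧ D.s * D.rate ^ 2 ≤ μ := by
  have h1 : max D.s 1 * D.rate ^ 2 ≤ μ := by
    rw [rate_sq h.1, ← mul_assoc]; exact h.2.2.2
  constructor
  · refine le_trans ?_ h1
    exact le_mul_of_one_le_left (sq_nonneg _) (le_max_right _ _)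
  · exact (mul_le_mul_of_nonneg_right (le_max_left _ _) (sq_nonneg _)).trans h1

lemma one_le_n_mul_rate_sq {D : Setup} (h : D.Standing) : 1 ≤ D.n * D.rate ^ 2 := by
  have hn' : (0 : ℝ) < D.n := by exact_mod_cast h.one_le_n
  rw [rate_sq h, div_mul_eq_mul_div, mul_div_cancel₀ _ hn'.ne']
  linarith [log_ratio_pos h, Real.log_two_gt_d9]

lemma scaledLasso_of_goodNoise {D : Setup} {A ξ c₀ θ δ μ : ℝ} (h : D.Common ξ c₀ μ)
    (hξ : 1 < ξ) (hc₀ : 0 < c₀) (hA0 : 0 < A) (hθ0 : 0 < θ) (hθ1 : θ < 1)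
    (hξθ : 1 + θ < ξ * (1 - θ)) (hδ : 0 < δ) (hA : 1 + δ ≤ θ * (1 - δ) * A)
    (hμ : (1 + ξ) ^ 2 / c₀ * (A ^ 2 * μ) ≤ 1 / 2) {e : Fin D.n → ℝ} (he : e ∈ D.goodNoise δ)
    {b : Fin D.p → ℝ} {σ : ℝ} (hb : IsScaledLasso D.X (D.y e) (A * D.rate) b σ) :
    l1norm (b - D.β) ≤ lassoConst ξ c₀ θ * A * (D.s * D.sigStar e * D.rate) ∧
      |σ / D.sigStar e - 1| ≤ lassoConst ξ c₀ θ * A ^ 2 * (D.s * D.rate ^ 2) := by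
  have hst := h.1
  have hr := rate_pos hst
  obtain ⟨hS, hz, hw⟩ := goodNoise_bounds hst hδ hA he
  have hle : θ * ((1 - δ) * D.sigStar e * (A * D.rate)) ≤
      θ * (D.sigStar e * (A * D.rate)) := by
    have : 0 ≤ θ * (δ * (D.sigStar e * (A * D.rate))) := by positivity
    linarith
  have hz' : ∀ j, |e ⬝ᵥ D.X.col j| ≤ D.n * (θ * (D.sigStar e * (A * D.rate))) := fun j =>
    (hz j).trans (mul_le_mul_of_nonneg_left hle (Nat.cast_nonneg _))
  have hlam : 0 ≤ A * D.rate := by positivity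
  have hl1 := scaledLasso_l1_le hst h.2.1 hlam hθ0 hθ1 hξ hξθ hc₀ h.2.2.1 hS hz' (hw.trans hle)
    (le_trans (mul_le_mul_of_nonneg_left (by
      rw [mul_pow, mul_left_comm]
      exact mul_le_mul_of_nonneg_left h.rate_le.2 (sq_nonneg _)) (by positivity)) hμ) hb
  refine ⟨hl1.trans_eq (by ring), ?_⟩
  have h1 := (scaledLasso_noise_le hst hlam hθ1 hS hz' hb).2.2
  have h2 := mul_le_mul_of_nonneg_left hl1 hlam
  rw [div_sub_one hS.ne', abs_div, abs_of_pos hS, div_le_iff₀ hS]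
  linarith

/-- The arithmetic of the noise level bound for least squares: `x` and `x'` are the ratios of the
two noise level estimators to `σ*`, and `f` is the proportion of lost degrees of freedom. -/
lemma noise_ratio_bound {x x' f a g : ℝ} (hx' : 0 ≤ x') (ha : |x - 1| ≤ a) (ha1 : a ≤ 1)
    (hf0 : 0 ≤ f) (hf : f ≤ 1 / 2) (hg : 0 ≤ g) (h1 : (1 - f) * x' ^ 2 ≤ x ^ 2)
    (h2 : x ^ 2 - 2 * g ≤ (1 - f) * x' ^ 2) : |x' - 1| ≤ 6 * a + 2 * f + 2 * g := by
  have ha0 : 0 ≤ a := (abs_nonneg _).trans ha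
  obtain ⟨hxl, hxu⟩ := abs_le.1 ha
  have hup : x ^ 2 ≤ 1 + 3 * a := by nlinarith
  have hlow : 1 - 3 * a ≤ x ^ 2 := by nlinarith
  have h3 : |x' ^ 2 - 1| ≤ 6 * a + 2 * f + 2 * g := by
    refine abs_le.2 ⟨?_, ?_⟩
    · have : 0 ≤ f * x' ^ 2 := by positivity
      linarith
    · have h4 : (1 - f) * x' ^ 2 ≤ (1 - f) * (1 + 6 * a + 2 * f) := by
        have h5 : 0 ≤ a * (1 - 2 * f) := mul_nonneg ha0 (by linarith)
        have h6 : 0 ≤ f * (1 - 2 * f) := mul_nonneg hf0 (by linarith)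
        linarith
      have := le_of_mul_le_mul_left h4 (by linarith)
      linarith
  refine le_trans ?_ h3
  have h4 : x' ^ 2 - 1 = (x' - 1) * (x' + 1) := by ring
  rw [h4, abs_mul]
  refine le_mul_of_one_le_right (abs_nonneg _) ?_
  rw [abs_of_nonneg (by linarith)]; linarith

lemma lse_of_goodNoise {D : Setup} {A ξ c₀ c₁ K θ δ μ : ℝ} (h : D.Common ξ c₀ μ)
    (hSE : D.SparseEig ξ c₁ K)
    (hξ : 1 < ξ) (hc₀ : 0 < c₀) (hc₁ : 0 < c₁) (hK : 0 < K) (hA0 : 0 < A) (hθ0 : 0 < θ)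
    (hθ1 : θ < 1) (hξθ : 1 + θ < ξ * (1 - θ)) (hδ : 0 < δ) (hδ1 : δ < 1)
    (hA : 1 + δ ≤ θ * (1 - δ) * A) (hμ : (1 + ξ) ^ 2 / c₀ * (A ^ 2 * μ) ≤ 1 / 2)
    (hμ2 : lassoConst ξ c₀ θ * A ^ 2 * μ ≤ δ) (hμ3 : (1 + K) * μ ≤ 1 / 2)
    {e : Fin D.n → ℝ} (he : e ∈ D.goodNoise δ)
    {b b' : Fin D.p → ℝ} {σ σ' : ℝ} (hb : IsScaledLasso D.X (D.y e) (A * D.rate) b σ)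
    (hb' : IsModelLSE D.X (D.y e) (supp b) b' σ') :
    l1norm (b' - D.β) ≤
        (lassoConst ξ c₀ θ * A + 4 * A * (1 + K) / c₁) * (D.s * D.sigStar e * D.rate) ∧
      |σ' / D.sigStar e - 1| ≤ (6 * (lassoConst ξ c₀ θ * A ^ 2) + 2 * (1 + K) +
        2 * (8 * A ^ 2 * (1 + K) / c₁)) * (D.s * D.rate ^ 2) := by
  have hst := h.1
  have hr := rate_pos hst
  have hs := hst.s_pos
  have hn' : (0 : ℝ) < D.n := by exact_mod_cast hst.one_le_n
  obtain ⟨hS, hz, hw⟩ := goodNoise_bounds hst hδ hA he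
  obtain ⟨hl1, hnoise⟩ := scaledLasso_of_goodNoise h hξ hc₀ hA0 hθ0 hθ1 hξθ hδ hA hμ he hb
  have hγ : 0 < (1 - θ) - (1 + θ) / ξ := by
    rw [sub_pos, div_lt_iff₀ (by linarith)]; linarith
  have hC : 0 ≤ lassoConst ξ c₀ θ := by unfold lassoConst; positivity
  set C := lassoConst ξ c₀ θ
  have hlam : 0 < A * D.rate := by positivity
  obtain ⟨-, hζ⟩ := h.rate_le
  have hζ0 : 0 ≤ D.s * D.rate ^ 2 := by positivity
  have ha : C * A ^ 2 * (D.s * D.rate ^ 2) ≤ δ :=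
    (mul_le_mul_of_nonneg_left hζ (by positivity)).trans hμ2
  obtain ⟨hσl, hσu⟩ := abs_le.1 (hnoise.trans ha)
  have hσl' : (1 - δ) * D.sigStar e ≤ σ := by
    rw [← le_div_iff₀ hS]; linarith
  have hσu' : σ ≤ 2 * D.sigStar e := by
    rw [← div_le_iff₀ hS]; linarith
  have hσ : 0 < σ := lt_of_lt_of_le (mul_pos (by linarith) hS) hσl'
  have hle : θ * ((1 - δ) * D.sigStar e * (A * D.rate)) ≤ θ * (σ * (A * D.rate)) := by gcongr
  have hz' : ∀ j, |e ⬝ᵥ D.X.col j| ≤ D.n * (θ * (σ * (A * D.rate))) := fun j =>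
    (hz j).trans (mul_le_mul_of_nonneg_left hle (Nat.cast_nonneg _))
  -- the size of the selected model
  obtain ⟨m, k, φ, hm, hk0, hk1, hφ, hκ, hφk, hmax, hmin⟩ :=
    hSE.exists_real hξ hc₀ hK h.2.2.1
  obtain ⟨hcm, hcK⟩ := card_falsely_selected_le hst h.2.1 hlam hθ0 hξθ hξ hθ1 hk0 hk1 hK hφ hκ
    hφk hm hmax hb hσ hz' (hw.trans hle)
  have hT : ((supp b).card : ℝ) ≤ (1 + K) * D.s := by
    have h1 : (supp b).card ≤ (supp b \ D.S).card + D.S.card := by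
      rw [← Finset.card_sdiff_add_card_inter (supp b) D.S]
      exact Nat.add_le_add_left (Finset.card_le_card Finset.inter_subset_right) _
    have h2 : ((supp b).card : ℝ) ≤ (supp b \ D.S).card + D.S.card := by exact_mod_cast h1
    linarith [(h.2.1.small_sum_le hst).1]
  have hf : ((supp b).card : ℝ) / D.n ≤ (1 + K) * (D.s * D.rate ^ 2) := by
    rw [div_le_iff₀ hn']
    have h1 := mul_le_mul_of_nonneg_left (one_le_n_mul_rate_sq hst)
      (by positivity : 0 ≤ (1 + K) * D.s)
    linarith
  have hf2 : ((supp b).card : ℝ) / D.n ≤ 1 / 2 :=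
    hf.trans ((mul_le_mul_of_nonneg_left hζ (by linarith)).trans hμ3)
  have hTn : ((supp b).card : ℝ) < D.n := by
    rw [div_le_iff₀ hn'] at hf2; linarith
  obtain ⟨hG, hR1, hR2⟩ := lse_sub_lasso_le hst hlam hc₁ hb hσ
    (hmin _ Finset.subset_union_left (by rwa [Finset.union_sdiff_left])) hTn hb'
  have hlm : σ * (A * D.rate) ≤ 2 * D.sigStar e * (A * D.rate) :=
    mul_le_mul_of_nonneg_right hσu' hlam.le
  have hG2 : l1norm (b' - b) ≤ 4 * A * (1 + K) / c₁ * (D.s * D.sigStar e * D.rate) := by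
    refine hG.trans ?_
    rw [div_mul_eq_mul_div]
    refine div_le_div_of_nonneg_right ?_ hc₁.le
    calc 2 * (σ * (A * D.rate)) * (supp b).card
        ≤ 2 * (2 * D.sigStar e * (A * D.rate)) * ((1 + K) * D.s) := by gcongr
      _ = _ := by ring
  refine ⟨?_, ?_⟩
  · have h1 : l1norm (b' - D.β) ≤ l1norm (b' - b) + l1norm (b - D.β) := by
      rw [l1norm, l1norm, l1norm, ← Finset.sum_add_distrib]
      exact Finset.sum_le_sum fun j _ => abs_sub_le (b' j) (b j) (D.β j)
    linarith
  · have hg : σ * (A * D.rate) * l1norm (b' - b) ≤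
        8 * A ^ 2 * (1 + K) / c₁ * (D.s * D.rate ^ 2) * D.sigStar e ^ 2 := by
      calc σ * (A * D.rate) * l1norm (b' - b)
          ≤ 2 * D.sigStar e * (A * D.rate) *
              (4 * A * (1 + K) / c₁ * (D.s * D.sigStar e * D.rate)) :=
            mul_le_mul hlm hG2 (l1norm_nonneg _) (by positivity)
        _ = _ := by ring
    have hx' : 0 ≤ σ' / D.sigStar e := div_nonneg hb'.1.1 hS.le
    have hdf : (1 - ((supp b).card : ℝ) / D.n) * (σ' / D.sigStar e) ^ 2 =
        (((D.n : ℝ) - (supp b).card) * σ' ^ 2) / (D.n * D.sigStar e ^ 2) := by field_simp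
    have hxx : (σ / D.sigStar e) ^ 2 = (D.n * σ ^ 2) / (D.n * D.sigStar e ^ 2) := by field_simp
    have hnS : 0 < D.n * D.sigStar e ^ 2 := by positivity
    have h2 := noise_ratio_bound (x := σ / D.sigStar e) (x' := σ' / D.sigStar e)
      (f := ((supp b).card : ℝ) / D.n) (g := 8 * A ^ 2 * (1 + K) / c₁ * (D.s * D.rate ^ 2))
      hx' hnoise (ha.trans hδ1.le) (by positivity) hf2 (by positivity)
      (by rw [hdf, hxx]; exact div_le_div_of_nonneg_right hR1 hnS.le)
      (by
        rw [hdf, hxx, le_div_iff₀ hnS, sub_mul, div_mul_cancel₀ _ hnS.ne']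
        have := mul_le_mul_of_nonneg_left hg hn'.le
        linarith)
    linarith

/-! ### The two error conditions -/

/-- Non-strict bounds on the good event give the two error conditions with constants increased
by one. -/
lemma controlled_of_goodNoise {D : Setup} (h : D.Standing) {δ C₁ C₂ : ℝ} (hδ : 0 < δ)
    (hr : D.rate ^ 2 ≤ 1 / 2) (hP : D.P.real (D.goodNoise δ)ᶜ ≤ D.ε)
    (hgood : ∀ e ∈ D.goodNoise δ,
      l1norm (D.bInit e - D.β) ≤ C₁ * (D.s * D.sigStar e * D.rate) ∧
        |D.sigHat e / D.sigStar e - 1| ≤ C₂ * (D.s * D.rate ^ 2)) :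
    D.Controlled (C₁ + 1) (C₂ + 1) := by
  have hr0 := rate_pos h
  have hs := h.s_pos
  refine ⟨h, ?_, by linarith, (measureReal_mono ?_).trans hP, (measureReal_mono ?_).trans hP⟩
  · have h1 := one_le_n_mul_rate_sq h
    have h2 := mul_le_mul_of_nonneg_left hr (Nat.cast_nonneg D.n : (0 : ℝ) ≤ D.n)
    have h3 : (2 : ℝ) ≤ D.n := by linarith
    exact_mod_cast h3
  · intro e he hg
    have h1 := (hgood e hg).1
    have he' : (C₁ + 1) * D.s * D.sigStar e * D.rate ≤ l1norm (D.bInit e - D.β) := he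
    have hS : 0 < D.sigStar e :=
      pos_of_mul_pos_right (h.sigma_pos.trans_le hg.1) (by linarith)
    have : 0 < D.s * D.sigStar e * D.rate := by positivity
    linarith
  · intro e he hg
    have h1 := (hgood e hg).2
    have he' : (C₂ + 1) * D.s * D.rate ^ 2 ≤ |D.sigHat e / D.sigStar e - 1| := he
    have : 0 < D.s * D.rate ^ 2 := by positivity
    linarith

lemma exists_controlled_of_scaledLasso {A ξ c₀ : ℝ} (hξ : 1 < ξ) (hA : (ξ + 1) / (ξ - 1) < A)
    (hc₀ : 0 < c₀) : ∃ μ C₁ C₂ : ℝ, 0 < μ ∧ 0 < C₁ ∧ 0 < C₂ ∧ ∀ D : Setup,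
      D.Common ξ c₀ μ → D.ByScaledLasso (A * D.rate) → D.Controlled C₁ C₂ := by
  have hA0 : 0 < A := lt_trans (div_pos (by linarith) (by linarith)) hA
  obtain ⟨θ, δ, hθ0, hθ1, hξθ, hδ, -, hAδ⟩ := exists_penalty_slack hξ hA
  obtain ⟨μ₀, hμ₀, hgood⟩ := exists_goodNoise_compl_le hδ
  have hγ : 0 < (1 - θ) - (1 + θ) / ξ := by
    rw [sub_pos, div_lt_iff₀ (by linarith)]; linarith
  have hC : 0 ≤ lassoConst ξ c₀ θ := by unfold lassoConst; positivity
  set M := (1 + ξ) ^ 2 / c₀ * A ^ 2 with hM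
  have hM0 : 0 < M := by positivity
  refine ⟨min μ₀ (min (1 / 2) (1 / 2 / M)), lassoConst ξ c₀ θ * A + 1,
    lassoConst ξ c₀ θ * A ^ 2 + 1, by positivity, by positivity, by positivity, fun D hD hL => ?_⟩
  have hr := hD.rate_le.1
  refine controlled_of_goodNoise hD.1 hδ (hr.trans ((min_le_right _ _).trans (min_le_left _ _)))
    (hgood D hD.1 (hr.trans (min_le_left _ _))) fun e he =>
      scaledLasso_of_goodNoise hD hξ hc₀ hA0 hθ0 hθ1 hξθ hδ hAδ ?_ he (hL (D.y e))
  rw [← mul_assoc, ← hM, mul_comm, ← le_div_iff₀ hM0]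
  exact (min_le_right _ _).trans (min_le_right _ _)

lemma exists_controlled_of_scaledLassoLSE {A ξ c₀ c₁ K : ℝ} (hξ : 1 < ξ)
    (hA : (ξ + 1) / (ξ - 1) < A) (hc₀ : 0 < c₀) (hc₁ : 0 < c₁) (hK : 0 < K) :
    ∃ μ C₁ C₂ : ℝ, 0 < μ ∧ 0 < C₁ ∧ 0 < C₂ ∧ ∀ D : Setup, D.Common ξ c₀ μ →
      D.SparseEig ξ c₁ K → D.ByScaledLassoLSE (A * D.rate) → D.Controlled C₁ C₂ := by
  have hA0 : 0 < A := lt_trans (div_pos (by linarith) (by linarith)) hA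
  obtain ⟨θ, δ, hθ0, hθ1, hξθ, hδ, hδ1, hAδ⟩ := exists_penalty_slack hξ hA
  obtain ⟨μ₀, hμ₀, hgood⟩ := exists_goodNoise_compl_le hδ
  have hγ : 0 < (1 - θ) - (1 + θ) / ξ := by
    rw [sub_pos, div_lt_iff₀ (by linarith)]; linarith
  have hC : 0 < lassoConst ξ c₀ θ := by unfold lassoConst; positivity
  set M := (1 + ξ) ^ 2 / c₀ * A ^ 2 with hM
  have hM0 : 0 < M := by positivity
  set Q := lassoConst ξ c₀ θ * A ^ 2 with hQ
  have hQ0 : 0 < Q := by positivity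
  set μ := min (min μ₀ (1 / 2 / (1 + K))) (min (δ / Q) (1 / 2 / M)) with hμ
  have hμ0 : 0 < μ := by positivity
  have hμK : μ ≤ 1 / 2 / (1 + K) := (min_le_left _ _).trans (min_le_right _ _)
  have hμ2 : μ ≤ 1 / 2 := hμK.trans (div_le_self (by norm_num) (by linarith))
  refine ⟨μ, lassoConst ξ c₀ θ * A + 4 * A * (1 + K) / c₁ + 1,
    6 * Q + 2 * (1 + K) + 2 * (8 * A ^ 2 * (1 + K) / c₁) + 1, hμ0, by positivity, by positivity,
    fun D hD hSE hL => ?_⟩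
  obtain ⟨b₀, σ₀, -, -, hL⟩ := hL
  have hr := hD.rate_le.1
  refine controlled_of_goodNoise hD.1 hδ (hr.trans hμ2)
    (hgood D hD.1 (hr.trans ((min_le_left _ _).trans (min_le_left _ _)))) fun e he =>
      lse_of_goodNoise hD hSE hξ hc₀ hc₁ hK hA0 hθ0 hθ1 hξθ hδ hδ1 hAδ ?_ ?_ ?_ he
        (hL (D.y e)).1 (hL (D.y e)).2
  · rw [← mul_assoc, ← hM, mul_comm, ← le_div_iff₀ hM0]
    exact (min_le_right _ _).trans (min_le_right _ _)
  · rw [← hQ, mul_comm, ← le_div_iff₀ hQ0]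
    exact (min_le_right _ _).trans (min_le_left _ _)
  · rwa [mul_comm, ← le_div_iff₀ (by linarith)]

end Setup

end LDPE

end

theorem theorem4 (A ξ c₀ : ℝ) (hξ : 1 < ξ) (hA : (ξ + 1) / (ξ - 1) < A) (hc₀ : 0 < c₀) :
    (∃ μ C₁ C₂ : ℝ, 0 < μ ∧ 0 < C₁ ∧ 0 < C₂ ∧
      (∀ D : LDPE.Setup, D.Common ξ c₀ μ → D.ByScaledLasso (A * D.rate) →
        D.L1ErrorCond C₁ ∧ D.NoiseCond C₂) ∧
      LDPE.AllConclusions C₁ C₂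
        (fun D => D.Common ξ c₀ μ ∧ D.ByScaledLasso (A * D.rate))) ∧
    (∀ c₁ K : ℝ, 0 < c₁ → 0 < K → ∃ μ C₁ C₂ : ℝ, 0 < μ ∧ 0 < C₁ ∧ 0 < C₂ ∧
      (∀ D : LDPE.Setup, D.Common ξ c₀ μ → D.SparseEig ξ c₁ K →
        D.ByScaledLassoLSE (A * D.rate) → D.L1ErrorCond C₁ ∧ D.NoiseCond C₂) ∧
      LDPE.AllConclusions C₁ C₂
        (fun D => D.Common ξ c₀ μ ∧ D.SparseEig ξ c₁ K ∧ D.ByScaledLassoLSE (A * D.rate))) := by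
  constructor
  · obtain ⟨μ, C₁, C₂, hμ, hC₁, hC₂, h⟩ := LDPE.Setup.exists_controlled_of_scaledLasso hξ hA hc₀
    exact ⟨μ, C₁, C₂, hμ, hC₁, hC₂, fun D h1 h2 => ⟨(h D h1 h2).l1, (h D h1 h2).noise⟩,
      LDPE.allConclusions_of_controlled hC₁ hC₂ fun D hD => h D hD.1 hD.2⟩
  · intro c₁ K hc₁ hK
    obtain ⟨μ, C₁, C₂, hμ, hC₁, hC₂, h⟩ :=
      LDPE.Setup.exists_controlled_of_scaledLassoLSE hξ hA hc₀ hc₁ hK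
    exact ⟨μ, C₁, C₂, hμ, hC₁, hC₂, fun D h1 h2 h3 => ⟨(h D h1 h2 h3).l1, (h D h1 h2 h3).noise⟩,
      LDPE.allConclusions_of_controlled hC₁ hC₂ fun D hD => h D hD.1 hD.2.1 hD.2.2⟩
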